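/- Let $m\in\mathbb Z\setminus\{0\}$, $\omega\in\mathbb R$, and let $g\in C^{\alpha(m)}([0,\pi])$, $\alpha(m)=\max\{1,|m|-2\}$ (for instance $g\in C^\infty([0,\pi])$), satisfy (i) there is $\xi\in(0,\pi)$ with $g(0)=g(\xi)=g(\pi)=0$, $g>0$ on $(0,\xi)$ and $g<0$ on $(\xi,\pi)$; (ii) $\int_0^\pi g(x)\,dx>0$; (iii) $g'(\pi)>0$. Put $G(x)=-\int_x^\pi g(t)\,dt$ and $\varphi_1(r)=2\arctan(r^{|m|})$. Let $d(u)$ be the geodesic distance on the unit sphere $S^2\subset\mathbb R^3$ from $u$ to the north pole $(0,0,1)$, and let $\widetilde H(u)=\widetilde G(d(u))$, where $\widetilde G:[0,\pi]\to\mathbb R$ is differentiable with $\widetilde G'(x)=g(x)-\omega\sin x$. Consider maps $u:\mathbb R^2\times\mathbb R\to S^2$ of class $C^2$ that solve $$u_t=u\times(\Delta u-\nabla\widetilde H(u))\quad\text{on }\mathbb R^2\times\mathbb R,$$ where $\nabla\widetilde H$ is the gradient on $S^2$, and that have in polar coordinates $(r,\theta)$ of $\mathbb R^2$ the form $$u=(\sin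 h(r)\cos(m\theta+\omega t),\ \sin h(r)\sin(m\theta+\omega t),\ \cos h(r))$$ for some $h:[0,\infty)\to\mathbb R$ with $h(0)=0$ and $0<h(r)<\pi$ for all $r>0$. Such a solution exists if and only if $$0<\int_0^\infty G(\varphi_1(r))\,r\,dr\le\infty,$$ and a solution of this kind with in addition $\lim_{r\to\infty}h(r)=\pi$ exists if and only if the same condition holds. -/

import Mathlib

open Real Set Filter Topology MeasureTheory
open scoped ENNReal Laplacian

/-- The Euclidean plane `ℝ²`. -/
abbrev Plane := EuclideanSpace ℝ (Fin 2)

/-- Euclidean space `ℝ³`, which contains the target sphere `S² = {y | ‖y‖ = 1}`. -/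
abbrev Space := EuclideanSpace ℝ (Fin 3)

noncomputable section

/-- The cross product of `ℝ³`. -/
def cross (v w : Space) : Space :=
  WithLp.toLp 2 (crossProduct (WithLp.ofLp v) (WithLp.ofLp w))

/-- The north pole `P = (0, 0, 1)` of `S²`. -/
def northPole : Space := !₂[0, 0, 1]

/-- The geodesic distance on `S²` from the north pole: the angle between `y` and `P`. -/
def polarDist (y : Space) : ℝ := InnerProductGeometry.angle northPole y

/-- The gradient on `S²`, at a point `y` of `S²`, of a function `H` on `S²`, as a tangent vector
in `ℝ³`: the Euclidean gradient at `y` of the radially constant extension `z ↦ H (z / ‖z‖)`.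
Only the values of `H` on `S²` enter. -/
def sphereGradient (H : Space → ℝ) (y : Space) : Space :=
  gradient (fun z : Space => H (‖z‖⁻¹ • z)) y

/-- `u : ℝ × ℝ² → S²` (time first) is a classical solution, on all of `ℝ² × ℝ`, of the
Schrödinger flow `u_t = u × (Δu - ∇H(u))`. -/
structure IsSchrodingerFlow (H : Space → ℝ) (u : ℝ → Plane → Space) : Prop where
  mem_sphere : ∀ t x, ‖u t x‖ = 1
  contDiff : ContDiff ℝ 2 (fun p : ℝ × Plane => u p.1 p.2)
  equation : ∀ t x,
    deriv (fun s => u s x) t = cross (u t x) (Δ (u t) x - sphereGradient H (u t x))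

/-- `u` is the `m`-equivariant map with profile `h : [0, ∞) → ℝ`, `h 0 = 0`, rotating with
angular speed `ω`: in polar coordinates `(r, θ)`,
`u = (sin h(r) cos (mθ + ωt), sin h(r) sin (mθ + ωt), cos h(r))`. -/
structure IsRotating (m : ℤ) (ω : ℝ) (h : ℝ → ℝ) (u : ℝ → Plane → Space) : Prop where
  profile_zero : h 0 = 0
  form : ∀ t r θ : ℝ, 0 ≤ r → u t !₂[r * cos θ, r * sin θ] =
    !₂[sin (h r) * cos (m * θ + ω * t), sin (h r) * sin (m * θ + ω * t), cos (h r)]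

/-- The three sign conditions on the nonlinearity `g : [0, π] → ℝ`. -/
structure IsAdmissible (g : ℝ → ℝ) : Prop where
  sign : ∃ ξ ∈ Ioo 0 π, g 0 = 0 ∧ g ξ = 0 ∧ g π = 0 ∧
    (∀ x ∈ Ioo 0 ξ, 0 < g x) ∧ (∀ x ∈ Ioo ξ π, g x < 0)
  integral_pos : 0 < ∫ x in (0 : ℝ)..π, g x
  deriv_pi_pos : 0 < derivWithin g (Icc 0 π) π

/-- The primitive `G(x) = -∫_x^π g` of `g`, which vanishes at `π`. -/
def primitivePi (g : ℝ → ℝ) (x : ℝ) : ℝ := -∫ t in x..π, g t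

/-- The profile `φ₁(r) = 2 arctan (r^|m|)` of the harmonic map of degree `|m|`. -/
def harmonicProfile (m : ℤ) (r : ℝ) : ℝ := 2 * arctan (r ^ m.natAbs)

/-- The integral over `(0, ∞)` of a function, as an extended real number: the integral of the
positive part minus that of the negative part. -/
def extIntegral (F : ℝ → ℝ) : EReal :=
  ((∫⁻ r in Ioi (0 : ℝ), ENNReal.ofReal (F r) : ℝ≥0∞) : EReal) -
    ((∫⁻ r in Ioi (0 : ℝ), ENNReal.ofReal (-F r) : ℝ≥0∞) : EReal)

end

/-!
Substituting the rotating form into the flow turns the equation into the ordinary differential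
equation `h'' + h'/r - m² sin h cos h / r² = g(h)` for the profile: the rotation cancels the term
`ω sin h` of the potential (`rotating_equation`). With `n = |m|` and `p = r h'`, the Pohozaev
quantity `(p² - n² sin² h) / 2` has derivative `r g(h) p`; it vanishes identically along the
harmonic profile `φ(r) = 2 arctan (rⁿ)`, which solves the equation for `g = 0`.

Necessity (`IsProfile.exists_harmonicIntegral_pos`). A solution starts faster than the harmonic
profile and passes the level `ξ`. If the partial integrals of `G(φ(r)) r` beyond the level `ξ` were
never positive, a comparison of `h` with dilates of `φ`, using that `g` changes sign only at `ξ`,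
would bound the Pohozaev quantity from below by a positive number while `h < π`, so that `h` would
grow past `π`.

Sufficiency (`exists_connecting_profile`). Write `h = rⁿ v` with `v(0) = a`, and put a factor `μ` in
front of `g`; the solution exists globally and depends continuously on `(a, μ)`, including `μ = 0`
(`exists_profile_family`). For small `a` and `μ = 1` the profile starts slowly and passes `π` while
increasing (`exists_crossing_of_slow_start`). For `a = 2` and small `μ` it is close to `φ`. The
integral condition makes the work of `g` along `φ` negative at some radius
(`exists_harmonicWork_neg`), so the Pohozaev quantity becomes negative there and the profile turns
back below `π` (`IsProfile.exists_turn`). Both alternatives are open, they exclude each other, and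
the parameter set is connected, so some parameter realizes neither: its profile increases and stays
below `π`, which forces the limit `π` (`IsProfile.tendsto_pi`). A dilation then restores `μ = 1`,
and the map built from `v` is of class `C²` also at the origin (`contDiff_rotatingMap`).
-/

noncomputable section

/-! ### The entire functions `cos √s`, `sin √s / √s` and their relatives -/

/-- The entire function `∑ (-s)^j / (2j+k)!`. For `k = 0` and `k = 1` its values at `x ^ 2` are
`cos x` and `sin x / x`; it makes even functions of a radius visibly smooth. -/
def evenSeries (k : ℕ) (s : ℝ) : ℝ :=
  ∑' j : ℕ, (-1) ^ j / ((2 * j + k).factorial : ℝ) * s ^ j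

lemma evenSeries_eq_ofScalarsSum (k : ℕ) :
    evenSeries k = FormalMultilinearSeries.ofScalarsSum (E := ℝ)
      (fun j : ℕ => ((-1) ^ j / ((2 * j + k).factorial : ℝ) : ℝ)) := by
  rw [FormalMultilinearSeries.ofScalarsSum_eq_tsum]
  rfl

lemma evenSeries_radius (k : ℕ) :
    (FormalMultilinearSeries.ofScalars ℝ
      (fun j : ℕ => ((-1) ^ j / ((2 * j + k).factorial : ℝ) : ℝ))).radius = ⊤ := by
  apply FormalMultilinearSeries.ofScalars_radius_eq_top_of_tendsto
  · refine Eventually.of_forall fun j => ?_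
    have : ((2 * j + k).factorial : ℝ) ≠ 0 := by positivity
    positivity
  · refine squeeze_zero (fun j => by positivity) (fun j => ?_)
      tendsto_one_div_add_atTop_nhds_zero_nat
    have h1 : (2 * (j + 1) + k).factorial
        = (2 * j + k + 2) * ((2 * j + k + 1) * (2 * j + k).factorial) := by
      rw [show 2 * (j + 1) + k = 2 * j + k + 1 + 1 by ring, Nat.factorial_succ, Nat.factorial_succ]
    have h0 : (0 : ℝ) < ((2 * j + k).factorial : ℝ) := by positivity
    simp only [Nat.succ_eq_add_one, norm_div, norm_pow, norm_neg, norm_one, one_pow, h1]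
    rw [Real.norm_of_nonneg (by positivity), Real.norm_of_nonneg (by positivity)]
    push_cast
    rw [show (1 : ℝ) / ((2 * j + k + 2) * ((2 * j + k + 1) * ((2 * j + k).factorial : ℝ)))
        / (1 / ((2 * j + k).factorial : ℝ)) = 1 / ((2 * j + k + 2) * (2 * j + k + 1)) by
      field_simp, div_le_div_iff₀ (by positivity) (by positivity)]
    have : (0 : ℝ) ≤ j := by positivity
    have hk : (0 : ℝ) ≤ k := by positivity
    have : (j + 1 : ℝ) ≤ (2 * j + k + 2) * (2 * j + k + 1) := by nlinarith [mul_nonneg this hk]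
    nlinarith

lemma contDiff_evenSeries (k : ℕ) : ContDiff ℝ 2 (evenSeries k) := by
  rw [evenSeries_eq_ofScalarsSum]
  have h := (FormalMultilinearSeries.ofScalars ℝ
      (fun j : ℕ => ((-1) ^ j / ((2 * j + k).factorial : ℝ) : ℝ))).hasFPowerSeriesOnBall
      (by rw [evenSeries_radius]; simp)
  rw [evenSeries_radius] at h
  have h2 := h.analyticOnNhd
  have : Metric.eball (0 : ℝ) ⊤ = univ := by simp
  rw [this] at h2
  exact h2.contDiff

lemma summable_evenSeries (k : ℕ) (s : ℝ) :
    Summable fun j : ℕ => (-1) ^ j / ((2 * j + k).factorial : ℝ) * s ^ j := by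
  have h := (FormalMultilinearSeries.ofScalars ℝ
      (fun j : ℕ => ((-1) ^ j / ((2 * j + k).factorial : ℝ) : ℝ))).summable (x := s)
      (by rw [evenSeries_radius]; simp)
  simpa [FormalMultilinearSeries.ofScalars_apply_eq, mul_comm] using h

lemma evenSeries_zero_sq (x : ℝ) : evenSeries 0 (x ^ 2) = cos x := by
  rw [Real.cos_eq_tsum]
  refine tsum_congr fun j => ?_
  rw [← pow_mul, add_zero]
  ring

lemma mul_evenSeries_one_sq (x : ℝ) : x * evenSeries 1 (x ^ 2) = sin x := by
  rw [Real.sin_eq_tsum, evenSeries, ← tsum_mul_left]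
  refine tsum_congr fun j => ?_
  rw [← pow_mul]
  ring

lemma evenSeries_one_eq (s : ℝ) : evenSeries 1 s = 1 - s * evenSeries 3 s := by
  rw [evenSeries, (summable_evenSeries 1 s).tsum_eq_zero_add, evenSeries, ← tsum_mul_left,
    sub_eq_add_neg, ← tsum_neg]
  congr 1
  · simp
  · refine tsum_congr fun j => ?_
    rw [show 2 * (j + 1) + 1 = 2 * j + 3 by ring]
    ring

/-- `(sin x cos x - x) / x ^ 3`, continued to `x = 0`. -/
def cubicSinCos (x : ℝ) : ℝ := -4 * evenSeries 3 (4 * x ^ 2)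

lemma continuous_cubicSinCos : Continuous cubicSinCos := by
  have := (contDiff_evenSeries 3).continuous
  unfold cubicSinCos
  fun_prop

lemma pow_three_mul_cubicSinCos (x : ℝ) : x ^ 3 * cubicSinCos x = sin x * cos x - x := by
  have h1 := mul_evenSeries_one_sq (2 * x)
  rw [evenSeries_one_eq, sin_two_mul] at h1
  have h2 : (2 * x) ^ 2 = 4 * x ^ 2 := by ring
  rw [h2] at h1
  unfold cubicSinCos
  linarith

/-! ### Radial profiles emanating from the north pole -/

/-- The right-hand side of the equation `v'' + (2n+1) v' / r = radialForce n μ g r v` satisfied by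
`v = h / r ^ n` when `h'' + h' / r - n² sin h cos h / r² = μ g(h)`. It is continuous up to
`r = 0`. -/
def radialForce (n : ℕ) (μ : ℝ) (g : ℝ → ℝ) (r v : ℝ) : ℝ :=
  n ^ 2 * r ^ (2 * n - 2) * v ^ 3 * cubicSinCos (r ^ n * v) + μ * v * dslope g 0 (r ^ n * v)

lemma continuous_radialForce (n : ℕ) {g : ℝ → ℝ} (hgc : Continuous g)
    (hgd : DifferentiableAt ℝ g 0) :
    Continuous fun q : ℝ × ℝ × ℝ => radialForce n q.1 g q.2.1 q.2.2 := by
  have h1 := continuous_cubicSinCos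
  have h2 : Continuous (dslope g 0) := by
    rw [continuous_iff_continuousAt]
    intro x
    rcases eq_or_ne x 0 with rfl | hx
    · exact continuousAt_dslope_same.2 hgd
    · exact (continuousAt_dslope_of_ne hx).2 hgc.continuousAt
  unfold radialForce
  fun_prop

lemma mul_dslope_zero {g : ℝ → ℝ} (hg0 : g 0 = 0) (x : ℝ) : x * dslope g 0 x = g x := by
  have := sub_smul_dslope g 0 x
  simpa [hg0] using this

lemma pow_mul_radialForce {n : ℕ} (hn : 1 ≤ n) (μ : ℝ) {g : ℝ → ℝ} (hg0 : g 0 = 0) (r v : ℝ) :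
    r ^ (n + 2) * radialForce n μ g r v
      = n ^ 2 * (sin (r ^ n * v) * cos (r ^ n * v) - r ^ n * v) + μ * r ^ 2 * g (r ^ n * v) := by
  rw [← pow_three_mul_cubicSinCos, ← mul_dslope_zero hg0 (r ^ n * v), radialForce]
  have h : r ^ (n + 2) * r ^ (2 * n - 2) = (r ^ n) ^ 3 := by
    rw [← pow_add, ← pow_mul]
    congr 1
    lia
  have h2 : r ^ (n + 2) = r ^ n * r ^ 2 := by ring
  calc _ = n ^ 2 * (r ^ (n + 2) * r ^ (2 * n - 2)) * v ^ 3 * cubicSinCos (r ^ n * v)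
        + μ * v * r ^ (n + 2) * dslope g 0 (r ^ n * v) := by ring
    _ = _ := by rw [h, h2]; ring

lemma radialForce_zero (n : ℕ) (μ : ℝ) (g : ℝ → ℝ) (r : ℝ) : radialForce n μ g r 0 = 0 := by
  simp [radialForce]

lemma abs_sinCos_sub_le {a b c : ℝ} (ha : |a| ≤ c) (hb : |b| ≤ c) :
    |(sin a * cos a - a) - (sin b * cos b - b)| ≤ 2 * c ^ 2 * |a - b| := by
  have key : ∀ x ∈ Icc (-c) c, HasDerivWithinAt (fun x => sin x * cos x - x)
      (-2 * sin x ^ 2) (Icc (-c) c) x := by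
    intro x _
    have := ((Real.hasDerivAt_sin x).mul (Real.hasDerivAt_cos x)).sub (hasDerivAt_id x)
    refine (this.congr_deriv ?_).hasDerivWithinAt
    have := sin_sq_add_cos_sq x
    linarith
  have hbd : ∀ x ∈ Icc (-c) c, ‖-2 * sin x ^ 2‖ ≤ 2 * c ^ 2 := by
    intro x hx
    have h1 : |sin x| ≤ |x| := Real.abs_sin_le_abs
    have h2 : |x| ≤ c := abs_le.2 hx
    have h3 : sin x ^ 2 ≤ c ^ 2 := sq_le_sq' (by have := neg_abs_le (sin x); linarith)
      ((le_abs_self _).trans (h1.trans h2))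
    rw [norm_mul, Real.norm_of_nonneg (sq_nonneg (sin x))]
    norm_num
    exact h3
  exact (convex_Icc (-c) c).norm_image_sub_le_of_norm_hasDerivWithin_le key hbd (abs_le.1 hb)
    (abs_le.1 ha)

lemma abs_sinCos_sub_le_two (a b : ℝ) :
    |(sin a * cos a - a) - (sin b * cos b - b)| ≤ 2 * |a - b| := by
  have key : ∀ x ∈ univ, HasDerivWithinAt (fun x => sin x * cos x - x)
      (-2 * sin x ^ 2) univ x := by
    intro x _
    have := ((Real.hasDerivAt_sin x).mul (Real.hasDerivAt_cos x)).sub (hasDerivAt_id x)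
    refine (this.congr_deriv ?_).hasDerivWithinAt
    have := sin_sq_add_cos_sq x
    linarith
  have hbd : ∀ x ∈ (univ : Set ℝ), ‖-2 * sin x ^ 2‖ ≤ 2 := by
    intro x hx
    rw [norm_mul, Real.norm_of_nonneg (sq_nonneg (sin x))]
    norm_num
    exact Real.abs_sin_le_one x
  exact convex_univ.norm_image_sub_le_of_norm_hasDerivWithin_le key hbd (mem_univ b) (mem_univ a)

lemma abs_radialForce_sub_le {n : ℕ} (hn : 1 ≤ n) {μ : ℝ} (hμ : μ ∈ Icc (0 : ℝ) 1) {g : ℝ → ℝ}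
    {L : ℝ} (hgL : ∀ x y, |g x - g y| ≤ L * |x - y|) (hg0 : g 0 = 0) {r v v' K : ℝ} (hr : r ≠ 0)
    (hK : |sin (r ^ n * v) * cos (r ^ n * v) - r ^ n * v
        - (sin (r ^ n * v') * cos (r ^ n * v') - r ^ n * v')|
      ≤ K * r ^ 2 * |r ^ n * v - r ^ n * v'|) :
    |radialForce n μ g r v - radialForce n μ g r v'| ≤ (n ^ 2 * K + L) * |v - v'| := by
  have hr2 : 0 < |r ^ (n + 2)| := abs_pos.2 (pow_ne_zero _ hr)
  refine le_of_mul_le_mul_left ?_ hr2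
  rw [← abs_mul, mul_sub, pow_mul_radialForce hn μ hg0, pow_mul_radialForce hn μ hg0]
  set x := r ^ n * v with hx
  set y := r ^ n * v' with hy
  have h1 : |r ^ (n + 2)| * |v - v'| = r ^ 2 * |x - y| := by
    rw [hx, hy, ← mul_sub, abs_mul, pow_add, abs_mul, abs_of_nonneg (sq_nonneg r)]
    ring
  have h2 := hgL x y
  have h3 : |μ * r ^ 2 * (g x - g y)| ≤ r ^ 2 * (L * |x - y|) := by
    rw [abs_mul, abs_mul, abs_of_nonneg hμ.1, abs_of_nonneg (sq_nonneg r)]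
    have := abs_nonneg (g x - g y)
    calc _ ≤ 1 * r ^ 2 * |g x - g y| := by gcongr; exact hμ.2
      _ ≤ _ := by rw [one_mul]; gcongr
  have h4 : |(n : ℝ) ^ 2 * (sin x * cos x - x - (sin y * cos y - y))|
      ≤ n ^ 2 * (K * r ^ 2 * |x - y|) := by
    rw [abs_mul, abs_of_nonneg (by positivity : (0 : ℝ) ≤ (n : ℝ) ^ 2)]
    gcongr
  calc _ = |(n : ℝ) ^ 2 * (sin x * cos x - x - (sin y * cos y - y)) + μ * r ^ 2 * (g x - g y)| := by
        congr 1; ring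
    _ ≤ _ := abs_add_le _ _
    _ ≤ n ^ 2 * (K * r ^ 2 * |x - y|) + r ^ 2 * (L * |x - y|) := add_le_add h4 h3
    _ = (n ^ 2 * K + L) * (r ^ 2 * |x - y|) := by ring
    _ = _ := by rw [← h1]; ring

/-- The exponential weight rate `lam` for which the integral operator contracts the weighted sup
norm `sup |v(r)| exp(-lam r²)` by a factor `1/2`. -/
def weightRate (n : ℕ) (L : ℝ) : ℝ := n ^ 2 + L + 16 * n ^ 2 * exp (2 * n ^ 2)

lemma abs_radialForce_sub_le_weight {n : ℕ} (hn : 1 ≤ n) {μ : ℝ} (hμ : μ ∈ Icc (0 : ℝ) 1)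
    {g : ℝ → ℝ} {L : ℝ} (hL : 0 ≤ L) (hgL : ∀ x y, |g x - g y| ≤ L * |x - y|) (hg0 : g 0 = 0)
    {r v v' : ℝ} (hr : r ≠ 0)
    (hv : |v| ≤ 4 * exp (weightRate n L * r ^ 2)) (hv' : |v'| ≤ 4 * exp (weightRate n L * r ^ 2)) :
    |radialForce n μ g r v - radialForce n μ g r v'|
      ≤ 2 * (n + 1) * weightRate n L * |v - v'| := by
  set lam := weightRate n L with hlam
  have hn' : (1 : ℝ) ≤ n := by exact_mod_cast hn
  have hE : (1 : ℝ) ≤ exp (2 * n ^ 2) := Real.one_le_exp (by positivity)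
  have hlam1 : (n : ℝ) ^ 2 ≤ lam := by
    rw [hlam, weightRate]
    have : (0 : ℝ) ≤ 16 * n ^ 2 * exp (2 * n ^ 2) := by positivity
    linarith
  have hlamL : L ≤ lam := by
    rw [hlam, weightRate]
    have : (0 : ℝ) ≤ 16 * n ^ 2 * exp (2 * n ^ 2) := by positivity
    nlinarith
  have hn2 : (1 : ℝ) ≤ (n : ℝ) ^ 2 := one_le_pow₀ hn'
  have hlam0 : 0 < lam := by linarith
  have hr2 : 0 < r ^ 2 := by positivity
  -- Away from the origin the bound `2 / r²` suffices, near it the cubic smallness of the force.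
  rcases le_total ((n : ℝ) ^ 2) (lam * r ^ 2) with hcase | hcase
  · refine (abs_radialForce_sub_le hn hμ hgL hg0 (K := 2 / r ^ 2) hr ?_).trans ?_
    · rw [div_mul_cancel₀ _ hr2.ne']
      exact abs_sinCos_sub_le_two _ _
    · have h1 : (n : ℝ) ^ 2 * (2 / r ^ 2) ≤ 2 * lam := by
        rw [← mul_div_assoc, div_le_iff₀ hr2]
        linarith
      gcongr
      nlinarith
  · have hr1 : r ^ 2 ≤ 1 := by
      by_contra! h
      nlinarith
    have hM : 4 * exp (lam * r ^ 2) ≤ 4 * exp (n ^ 2) := by gcongr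
    have hpow : ∀ z, |z| ≤ 4 * exp (lam * r ^ 2) → |r ^ n * z| ≤ |r| * (4 * exp (n ^ 2)) := by
      intro z hz
      rw [abs_mul, abs_pow]
      have : |r| ^ n ≤ |r| ^ 1 :=
        pow_le_pow_of_le_one (abs_nonneg r) (abs_le_one_iff_mul_self_le_one.2 (by nlinarith)) hn
      rw [pow_one] at this
      exact mul_le_mul this (hz.trans hM) (abs_nonneg _) (abs_nonneg _)
    refine (abs_radialForce_sub_le hn hμ hgL hg0 (K := 32 * exp (2 * n ^ 2)) hr ?_).trans ?_
    · refine (abs_sinCos_sub_le (hpow v hv) (hpow v' hv')).trans (le_of_eq ?_)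
      rw [mul_pow, sq_abs, mul_pow, ← Real.exp_nat_mul]
      push_cast
      ring
    · gcongr
      rw [hlam, weightRate]
      nlinarith [mul_nonneg (sub_nonneg.2 hn') hL, mul_nonneg (sub_nonneg.2 hn') (by positivity :
        (0 : ℝ) ≤ n ^ 2 * exp (2 * n ^ 2)), mul_nonneg (sub_nonneg.2 hn')
          (by positivity : (0 : ℝ) ≤ n ^ 2)]

/-- The weighted average `∫₀¹ τ^(2n+1) f(sτ) dτ`, equal to `s^(-2n-2) ∫₀ˢ σ^(2n+1) f(σ) dσ` for
`s ≠ 0`: the quotient `v'(s) / s` for a solution of `v'' + (2n+1) v' / r = f` regular at `0`. -/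
def radialAverage (n : ℕ) (f : ℝ → ℝ) (s : ℝ) : ℝ :=
  ∫ τ in (0 : ℝ)..1, τ ^ (2 * n + 1) * f (s * τ)

lemma continuous_radialAverage (n : ℕ) {X : Type*} [TopologicalSpace X] {f : X → ℝ → ℝ}
    (hf : Continuous (Function.uncurry f)) :
    Continuous fun q : X × ℝ => radialAverage n (f q.1) q.2 := by
  unfold radialAverage
  apply intervalIntegral.continuous_parametric_intervalIntegral_of_continuous'
  have : Continuous fun z : (X × ℝ) × ℝ => f z.1.1 (z.1.2 * z.2) :=
    hf.comp (by fun_prop : Continuous fun z : (X × ℝ) × ℝ => (z.1.1, z.1.2 * z.2))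
  exact (by fun_prop : Continuous fun z : (X × ℝ) × ℝ => z.2 ^ (2 * n + 1)).mul this

lemma continuous_radialAverage' (n : ℕ) {f : ℝ → ℝ} (hf : Continuous f) :
    Continuous (radialAverage n f) :=
  (continuous_radialAverage n (X := Unit) (f := fun _ => f) (by fun_prop)).comp
    (by fun_prop : Continuous fun s : ℝ => ((), s))

lemma radialAverage_zero (n : ℕ) (f : ℝ → ℝ) : (2 * n + 2) * radialAverage n f 0 = f 0 := by
  simp only [radialAverage, zero_mul, intervalIntegral.integral_mul_const, integral_pow]
  push_cast
  have : (2 * n + 1 + 1 : ℝ) ≠ 0 := by positivity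
  field_simp
  ring

lemma hasDerivAt_radialAverage (n : ℕ) {f : ℝ → ℝ} (hf : Continuous f) {s : ℝ} (hs : s ≠ 0) :
    HasDerivAt (radialAverage n f) ((f s - (2 * n + 2) * radialAverage n f s) / s) s := by
  have hform : ∀ x : ℝ, x ≠ 0 →
      radialAverage n f x = (∫ σ in (0 : ℝ)..x, σ ^ (2 * n + 1) * f σ) / x ^ (2 * n + 2) := by
    intro x hx
    rw [eq_div_iff (pow_ne_zero _ hx)]
    have h1 := intervalIntegral.mul_integral_comp_mul_left (a := 0) (b := 1)
      (f := fun σ => σ ^ (2 * n + 1) * f σ) x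
    rw [mul_zero, mul_one] at h1
    rw [← h1, radialAverage, mul_comm, pow_succ', mul_assoc,
      ← intervalIntegral.integral_const_mul]
    congr 1
    refine intervalIntegral.integral_congr fun τ _ => ?_
    ring
  have hd : HasDerivAt (fun x => ∫ σ in (0 : ℝ)..x, σ ^ (2 * n + 1) * f σ)
      (s ^ (2 * n + 1) * f s) s :=
    intervalIntegral.integral_hasDerivAt_right
      ((by fun_prop : Continuous fun σ => σ ^ (2 * n + 1) * f σ).intervalIntegrable _ _)
      ((by fun_prop : Continuous fun σ => σ ^ (2 * n + 1) * f σ).stronglyMeasurableAtFilter _ _)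
      (by fun_prop : Continuous fun σ => σ ^ (2 * n + 1) * f σ).continuousAt
  have h2 := hd.div (hasDerivAt_pow (2 * n + 2) s) (pow_ne_zero _ hs)
  have h3 := h2.congr_of_eventuallyEq (f₁ := radialAverage n f)
    ((eventually_ne_nhds hs).mono fun x hx => hform x hx)
  refine h3.congr_deriv ?_
  rw [hform s hs]
  rw [show 2 * n + 2 - 1 = 2 * n + 1 by lia]
  push_cast
  have := pow_ne_zero (2 * n + 1) hs
  field_simp
  ring

/-- The bound that makes the integral operator a contraction in the weighted norm. -/
lemma abs_integral_mul_radialAverage_le (n : ℕ) {f : ℝ → ℝ} {lam d : ℝ}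
    (hlam : 0 < lam) (hd : 0 ≤ d)
    (hb : ∀ σ, σ ≠ 0 → |f σ| ≤ 2 * (n + 1) * lam * (d * exp (lam * σ ^ 2))) (r : ℝ) :
    |∫ s in (0 : ℝ)..r, s * radialAverage n f s| ≤ 1 / 2 * d * exp (lam * r ^ 2) := by
  have h1 : ∀ s, s ≠ 0 → |radialAverage n f s| ≤ lam * d * exp (lam * s ^ 2) := by
    intro s hs
    have hle : ‖∫ τ in (0 : ℝ)..1, τ ^ (2 * n + 1) * f (s * τ)‖
        ≤ ∫ τ in (0 : ℝ)..1, τ ^ (2 * n + 1) * (2 * (n + 1) * lam * (d * exp (lam * s ^ 2))) := by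
      refine intervalIntegral.norm_integral_le_of_norm_le zero_le_one
        (Eventually.of_forall fun τ hτ => ?_)
        ((by fun_prop : Continuous fun τ : ℝ => τ ^ (2 * n + 1) *
          (2 * (n + 1) * lam * (d * exp (lam * s ^ 2)))).intervalIntegrable _ _)
      have hτ0 : 0 < τ := hτ.1
      have hτ1 : τ ≤ 1 := hτ.2
      rw [norm_mul, Real.norm_of_nonneg (by positivity)]
      refine mul_le_mul_of_nonneg_left ((hb _ (mul_ne_zero hs hτ0.ne')).trans ?_) (by positivity)
      have : (s * τ) ^ 2 ≤ s ^ 2 := by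
        rw [mul_pow]
        exact mul_le_of_le_one_right (sq_nonneg s) (pow_le_one₀ hτ0.le hτ1)
      gcongr
    rw [intervalIntegral.integral_mul_const, integral_pow] at hle
    refine hle.trans (le_of_eq ?_)
    push_cast
    have : (2 * n + 1 + 1 : ℝ) ≠ 0 := by positivity
    field_simp
    ring
  have h2 := intervalIntegral.mul_integral_comp_mul_left (a := 0) (b := 1)
      (f := fun s => s * radialAverage n f s) r
  rw [mul_zero, mul_one] at h2
  rw [← h2]
  rcases eq_or_ne r 0 with rfl | hr
  · simp only [zero_mul, abs_zero]
    positivity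
  have hle : ‖∫ τ in (0 : ℝ)..1, r * τ * radialAverage n f (r * τ)‖
      ≤ ∫ τ in (0 : ℝ)..1, |r| * τ * (lam * d * exp (lam * (r * τ) ^ 2)) := by
    refine intervalIntegral.norm_integral_le_of_norm_le zero_le_one
        (Eventually.of_forall fun τ hτ => ?_)
        ((by fun_prop : Continuous fun τ : ℝ =>
          |r| * τ * (lam * d * exp (lam * (r * τ) ^ 2))).intervalIntegrable _ _)
    have hτ0 : 0 < τ := hτ.1
    rw [norm_mul, norm_mul, Real.norm_of_nonneg hτ0.le, Real.norm_eq_abs, Real.norm_eq_abs]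
    exact mul_le_mul_of_nonneg_left (h1 _ (mul_ne_zero hr hτ0.ne')) (by positivity)
  have hint : ∫ τ in (0 : ℝ)..1, r ^ 2 * τ * (lam * d * exp (lam * (r * τ) ^ 2))
      = 1 / 2 * d * exp (lam * r ^ 2) - 1 / 2 * d := by
    have hder : ∀ τ ∈ uIcc (0 : ℝ) 1, HasDerivAt (fun τ => 1 / 2 * d * exp (lam * (r * τ) ^ 2))
        (r ^ 2 * τ * (lam * d * exp (lam * (r * τ) ^ 2))) τ := by
      intro τ _
      have h4 : HasDerivAt (fun τ => lam * (r * τ) ^ 2) (lam * (2 * (r * τ) * r)) τ := by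
        have := (((hasDerivAt_id τ).const_mul r).pow 2).const_mul lam
        refine this.congr_deriv ?_
        simp
      refine ((h4.exp).const_mul (1 / 2 * d)).congr_deriv ?_
      ring
    rw [intervalIntegral.integral_eq_sub_of_hasDerivAt hder
      ((by fun_prop : Continuous fun τ : ℝ =>
        r ^ 2 * τ * (lam * d * exp (lam * (r * τ) ^ 2))).intervalIntegrable _ _)]
    simp
  rw [abs_mul]
  calc _ ≤ |r| * ∫ τ in (0 : ℝ)..1, |r| * τ * (lam * d * exp (lam * (r * τ) ^ 2)) := by
        gcongr
        exact hle
    _ = ∫ τ in (0 : ℝ)..1, r ^ 2 * τ * (lam * d * exp (lam * (r * τ) ^ 2)) := by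
        rw [← intervalIntegral.integral_const_mul]
        refine intervalIntegral.integral_congr fun τ _ => ?_
        rw [← sq_abs r]
        ring
    _ ≤ _ := by rw [hint]; linarith

lemma radialAverage_sub (n : ℕ) {f₁ f₂ : ℝ → ℝ} (h₁ : Continuous f₁) (h₂ : Continuous f₂) (s : ℝ) :
    radialAverage n (f₁ - f₂) s = radialAverage n f₁ s - radialAverage n f₂ s := by
  unfold radialAverage
  rw [← intervalIntegral.integral_sub]
  · refine intervalIntegral.integral_congr fun τ _ => ?_
    simp only [Pi.sub_apply]
    ring
  · exact (by fun_prop : Continuous fun τ => τ ^ (2 * n + 1) * f₁ (s * τ)).intervalIntegrable _ _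
  · exact (by fun_prop : Continuous fun τ => τ ^ (2 * n + 1) * f₂ (s * τ)).intervalIntegrable _ _

lemma abs_integral_sub_integral_le (n : ℕ) {f₁ f₂ : ℝ → ℝ} (h₁ : Continuous f₁)
    (h₂ : Continuous f₂) {lam d : ℝ} (hlam : 0 < lam) (hd : 0 ≤ d)
    (hb : ∀ σ, σ ≠ 0 → |f₁ σ - f₂ σ| ≤ 2 * (n + 1) * lam * (d * exp (lam * σ ^ 2))) (r : ℝ) :
    |(∫ s in (0 : ℝ)..r, s * radialAverage n f₁ s) - ∫ s in (0 : ℝ)..r, s * radialAverage n f₂ s|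
      ≤ 1 / 2 * d * exp (lam * r ^ 2) := by
  have := abs_integral_mul_radialAverage_le n (f := f₁ - f₂) hlam hd hb r
  refine le_trans (le_of_eq ?_) this
  congr 1
  have c₁ := continuous_radialAverage' n h₁
  have c₂ := continuous_radialAverage' n h₂
  rw [← intervalIntegral.integral_sub]
  · refine intervalIntegral.integral_congr fun s _ => ?_
    rw [radialAverage_sub n h₁ h₂ s]
    ring
  · exact (by fun_prop : Continuous fun s => s * radialAverage n f₁ s).intervalIntegrable _ _
  · exact (by fun_prop : Continuous fun s => s * radialAverage n f₂ s).intervalIntegrable _ _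

/-- The truncation of `x` to the interval `[c, d]`. -/
def clamp (c d x : ℝ) : ℝ := max c (min d x)

lemma abs_clamp_sub_le (c d x y : ℝ) : |clamp c d x - clamp c d y| ≤ |x - y| := by
  unfold clamp
  rw [max_comm c, max_comm c, min_comm d, min_comm d]
  refine (abs_max_sub_max_le_abs _ _ _).trans ((abs_min_sub_min_le_max _ _ _ _).trans ?_)
  simp

lemma clamp_mem {c d : ℝ} (h : c ≤ d) (x : ℝ) : clamp c d x ∈ Icc c d :=
  ⟨le_max_left _ _, max_le h (min_le_left _ _)⟩

lemma clamp_of_mem {c d x : ℝ} (h : x ∈ Icc c d) : clamp c d x = x := by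
  rw [clamp, min_eq_right h.2, max_eq_right h.1]

lemma continuous_clamp (c d : ℝ) : Continuous (clamp c d) := by
  unfold clamp
  fun_prop

lemma weightRate_pos {n : ℕ} (hn : 1 ≤ n) {L : ℝ} (hL : 0 ≤ L) : 0 < weightRate n L := by
  have hn' : (1 : ℝ) ≤ n := by exact_mod_cast hn
  unfold weightRate
  positivity

lemma le_weightRate (n : ℕ) (L : ℝ) : L ≤ weightRate n L := by
  unfold weightRate
  have : (0 : ℝ) ≤ n ^ 2 + 16 * n ^ 2 * exp (2 * n ^ 2) := by positivity
  linarith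

lemma abs_radialForce_sub_radialForce_le (n : ℕ) (μ μ' : ℝ) {g : ℝ → ℝ} {L : ℝ}
    (hgL : ∀ x y, |g x - g y| ≤ L * |x - y|) (hg0 : g 0 = 0) {r : ℝ} (hr : r ≠ 0) (v : ℝ) :
    |radialForce n μ g r v - radialForce n μ' g r v| ≤ |μ - μ'| * (L * |v|) := by
  have h1 : radialForce n μ g r v - radialForce n μ' g r v
      = (μ - μ') * (v * dslope g 0 (r ^ n * v)) := by
    unfold radialForce
    ring
  rw [h1, abs_mul]
  refine mul_le_mul_of_nonneg_left ?_ (abs_nonneg _)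
  rcases eq_or_ne v 0 with rfl | hv
  · simp
  have h2 : 0 < |r ^ n| := abs_pos.2 (pow_ne_zero _ hr)
  refine le_of_mul_le_mul_left ?_ h2
  rw [← abs_mul, ← mul_assoc, mul_dslope_zero hg0]
  have := hgL (r ^ n * v) 0
  rw [hg0, sub_zero, sub_zero, abs_mul] at this
  linarith

section Operator

variable (n : ℕ) (g : ℝ → ℝ) (lam : ℝ)

/-- The force along the curve `v(σ) = exp(lam σ²) w(σ)`, for the parameters
`θ = (a, μ)`. The values of `w` are truncated to `[-4, 4]` and the parameters to
`[0, 2] × [0, 1]`, which makes the operator below globally defined and contracting; the fixed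
point does not see the truncation. -/
def weightedForce (θ : ℝ × ℝ) (w : ℝ → ℝ) (σ : ℝ) : ℝ :=
  radialForce n (clamp 0 1 θ.2) g σ (exp (lam * σ ^ 2) * clamp (-4) 4 (w σ))

/-- The integral operator whose fixed points are the weighted solutions with `v(0) = a`. -/
def weightedOperator (θ : ℝ × ℝ) (w : ℝ → ℝ) (r : ℝ) : ℝ :=
  exp (-(lam * r ^ 2)) *
    (clamp 0 2 θ.1 + ∫ s in (0 : ℝ)..r, s * radialAverage n (weightedForce n g lam θ w) s)

end Operator

lemma continuous_weightedForce (n : ℕ) {g : ℝ → ℝ} (lam : ℝ) (hgc : Continuous g)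
    (hgd : DifferentiableAt ℝ g 0) {w : ℝ × ℝ → ℝ → ℝ} (hw : Continuous (Function.uncurry w)) :
    Continuous fun q : (ℝ × ℝ) × ℝ => weightedForce n g lam q.1 (w q.1) q.2 := by
  have h1 := continuous_clamp 0 1
  have h2 := continuous_clamp (-4) 4
  have h3 : Continuous fun q : (ℝ × ℝ) × ℝ => w q.1 q.2 := hw
  exact (continuous_radialForce n hgc hgd).comp (by fun_prop : Continuous fun q : (ℝ × ℝ) × ℝ =>
    (clamp 0 1 q.1.2, q.2, exp (lam * q.2 ^ 2) * clamp (-4) 4 (w q.1 q.2)))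

lemma continuous_weightedForce' (n : ℕ) {g : ℝ → ℝ} (lam : ℝ) (hgc : Continuous g)
    (hgd : DifferentiableAt ℝ g 0) (θ : ℝ × ℝ) {w : ℝ → ℝ} (hw : Continuous w) :
    Continuous (weightedForce n g lam θ w) :=
  (continuous_weightedForce n lam hgc hgd (w := fun _ => w) (by
    exact hw.comp continuous_snd)).comp (by fun_prop : Continuous fun σ : ℝ => (θ, σ))

/-- Existence of the family of regular profiles `h(r) = r ^ n v(r)`, with `q = v' / r`, for all
initial coefficients `a ∈ [0, 2]` and coupling constants `μ ∈ [0, 1]`, depending continuously on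
all variables. It is obtained by one application of the contraction principle on the whole line,
in a weighted sup norm. -/
theorem exists_profile_family {n : ℕ} (hn : 1 ≤ n) {g : ℝ → ℝ} {L : ℝ} (hL : 0 ≤ L)
    (hgL : ∀ x y, |g x - g y| ≤ L * |x - y|) (hg0 : g 0 = 0) (hgd : DifferentiableAt ℝ g 0) :
    ∃ v q : ℝ × ℝ → ℝ → ℝ, Continuous (Function.uncurry v) ∧ Continuous (Function.uncurry q) ∧
      (∀ μ ∈ Icc (0 : ℝ) 1, ∀ r, v (0, μ) r = 0) ∧
      ∀ a ∈ Icc (0 : ℝ) 2, ∀ μ ∈ Icc (0 : ℝ) 1, v (a, μ) 0 = a ∧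
        (∀ r, HasDerivAt (v (a, μ)) (r * q (a, μ) r) r) ∧
        (∀ r, r ≠ 0 → HasDerivAt (q (a, μ))
          ((radialForce n μ g r (v (a, μ) r) - (2 * n + 2) * q (a, μ) r) / r) r) ∧
        (2 * n + 2) * q (a, μ) 0 = radialForce n μ g 0 a := by
  have hgc : Continuous g := by
    have : LipschitzWith ⟨L, hL⟩ g := LipschitzWith.of_dist_le_mul fun x y => hgL x y
    exact this.continuous
  set lam := weightRate n L with hlamdef
  have hlam : 0 < lam := weightRate_pos hn hL
  have hforce : ∀ (θ : ℝ × ℝ) (w : ℝ → ℝ), Continuous w →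
      Continuous (weightedForce n g lam θ w) := fun θ w hw =>
    continuous_weightedForce' n lam hgc hgd θ hw
  have hint : ∀ (θ : ℝ × ℝ) (w : ℝ → ℝ), Continuous w →
      Continuous fun s => s * radialAverage n (weightedForce n g lam θ w) s := fun θ w hw =>
    continuous_id.mul (continuous_radialAverage' n (hforce θ w hw))
  have hcontOp : ∀ (θ : ℝ × ℝ) (w : ℝ → ℝ), Continuous w →
      Continuous (weightedOperator n g lam θ w) := by
    intro θ w hw
    have := intervalIntegral.continuous_primitive
      (fun a b => (hint θ w hw).intervalIntegrable (μ := volume) a b) 0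
    unfold weightedOperator
    fun_prop
  have hcl : ∀ (w : ℝ → ℝ) (σ : ℝ), |exp (lam * σ ^ 2) * clamp (-4) 4 (w σ)|
      ≤ 4 * exp (lam * σ ^ 2) := by
    intro w σ
    rw [abs_mul, abs_of_pos (exp_pos _), mul_comm]
    gcongr
    exact abs_le.2 (clamp_mem (by norm_num) _)
  have hμm : ∀ θ : ℝ × ℝ, clamp 0 1 θ.2 ∈ Icc (0 : ℝ) 1 := fun θ => clamp_mem zero_le_one _
  -- Lipschitz dependence of the force on the curve and on the parameters
  have hdiff : ∀ (θ : ℝ × ℝ) (w w' : ℝ → ℝ) (d : ℝ), (∀ σ, |w σ - w' σ| ≤ d) → ∀ σ, σ ≠ 0 →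
      |weightedForce n g lam θ w σ - weightedForce n g lam θ w' σ|
        ≤ 2 * (n + 1) * lam * (d * exp (lam * σ ^ 2)) := by
    intro θ w w' d hd σ hσ
    refine (abs_radialForce_sub_le_weight hn (hμm θ) hL hgL hg0 hσ (hcl w σ) (hcl w' σ)).trans ?_
    rw [← mul_sub, abs_mul, abs_of_pos (exp_pos _), mul_comm d]
    gcongr
    exact (abs_clamp_sub_le _ _ _ _).trans (hd σ)
  have hzero : ∀ θ : ℝ × ℝ, weightedForce n g lam θ 0 = 0 := by
    intro θ
    funext σ
    simp [weightedForce, clamp, radialForce_zero]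
  have hbound0 : ∀ (θ : ℝ × ℝ) (w : ℝ → ℝ) (σ : ℝ), σ ≠ 0 →
      |weightedForce n g lam θ w σ| ≤ 2 * (n + 1) * lam * (4 * exp (lam * σ ^ 2)) := by
    intro θ w σ hσ
    have h := abs_radialForce_sub_le_weight hn (hμm θ) hL hgL hg0 hσ (hcl w σ)
      (v' := 0) (by simp; positivity)
    rw [radialForce_zero, sub_zero, sub_zero] at h
    exact h.trans (by gcongr; exact hcl w σ)
  -- the ball of radius `4` is mapped into itself: `2` from the initial value, half of `4` from the
  -- contraction
  have hbound : ∀ (θ : ℝ × ℝ) (w : ℝ → ℝ), Continuous w → ∀ r,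
      ‖weightedOperator n g lam θ w r‖ ≤ 4 := by
    intro θ w hw r
    have h1 := abs_integral_mul_radialAverage_le n hlam (by norm_num : (0 : ℝ) ≤ 4)
      (hbound0 θ w) r
    have h2 : |clamp 0 2 θ.1| ≤ 2 * exp (lam * r ^ 2) := by
      have h := clamp_mem (by norm_num : (0 : ℝ) ≤ 2) θ.1
      rw [abs_of_nonneg h.1]
      have : 1 ≤ exp (lam * r ^ 2) := Real.one_le_exp (by positivity)
      linarith [h.2]
    rw [weightedOperator, norm_mul, Real.norm_of_nonneg (exp_pos _).le, Real.norm_eq_abs, exp_neg,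
      inv_mul_le_iff₀ (exp_pos _)]
    refine (abs_add_le _ _).trans ?_
    linarith
  let Φ : ℝ × ℝ → BoundedContinuousFunction ℝ ℝ → BoundedContinuousFunction ℝ ℝ := fun θ w =>
    BoundedContinuousFunction.ofNormedAddCommGroup (weightedOperator n g lam θ w)
      (hcontOp θ w w.continuous) 4 (hbound θ w w.continuous)
  have hΦ : ∀ θ w r, Φ θ w r = weightedOperator n g lam θ w r := fun _ _ _ => rfl
  have hcontr : ∀ θ, ContractingWith (1 / 2) (Φ θ) := by
    intro θ
    refine ⟨by norm_num, LipschitzWith.of_dist_le_mul fun w w' => ?_⟩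
    rw [BoundedContinuousFunction.dist_le (by positivity)]
    intro r
    have h := abs_integral_sub_integral_le n (hforce θ w w.continuous) (hforce θ w' w'.continuous)
      hlam (dist_nonneg (x := w) (y := w')) (hdiff θ w w' _ fun σ => w.dist_coe_le_dist σ) r
    rw [hΦ, hΦ, Real.dist_eq, weightedOperator, weightedOperator, ← mul_sub, abs_mul,
      abs_of_pos (exp_pos _), exp_neg, inv_mul_le_iff₀ (exp_pos _), add_sub_add_left_eq_sub]
    refine h.trans (le_of_eq ?_)
    push_cast
    ring
  let W : ℝ × ℝ → BoundedContinuousFunction ℝ ℝ := fun θ => (hcontr θ).fixedPoint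
  have hWfix : ∀ θ, Φ θ (W θ) = W θ := fun θ => (hcontr θ).fixedPoint_isFixedPt
  have hWval : ∀ θ r, W θ r = weightedOperator n g lam θ (W θ) r := fun θ r => by
    rw [← hΦ, hWfix]
  -- the fixed point of a contraction depends continuously on the parameters
  have hWcont : Continuous W := by
    rw [continuous_iff_continuousAt]
    intro θ₀
    rw [ContinuousAt, tendsto_iff_dist_tendsto_zero]
    have hmaj : ∀ θ, dist (W θ) (W θ₀)
        ≤ (|θ.1 - θ₀.1| + 2 * |θ.2 - θ₀.2|) / (1 - ((1 / 2 : NNReal) : ℝ)) := by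
      intro θ
      refine (hcontr θ).dist_fixedPoint_fixedPoint_of_dist_le' (Φ θ₀) (hWfix θ) (hWfix θ₀)
        fun w => ?_
      rw [BoundedContinuousFunction.dist_le (by positivity)]
      intro r
      have h := abs_integral_sub_integral_le n (hforce θ w w.continuous)
        (hforce θ₀ w w.continuous) hlam (d := 4 * |θ.2 - θ₀.2|) (by positivity) (by
          intro σ hσ
          refine (abs_radialForce_sub_radialForce_le n _ _ hgL hg0 hσ _).trans ?_
          have h1 := abs_clamp_sub_le 0 1 θ.2 θ₀.2
          have h2 := hcl w σ
          have hLl := le_weightRate n L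
          rw [← hlamdef] at hLl
          calc _ ≤ |θ.2 - θ₀.2| * (lam * (4 * exp (lam * σ ^ 2))) := by gcongr
            _ ≤ 2 * (n + 1) * (|θ.2 - θ₀.2| * (lam * (4 * exp (lam * σ ^ 2)))) := by
              have : (0 : ℝ) ≤ n := by positivity
              exact le_mul_of_one_le_left (by positivity) (by linarith)
            _ = _ := by ring) r
      rw [hΦ, hΦ, Real.dist_eq, weightedOperator, weightedOperator, ← mul_sub, abs_mul,
        abs_of_pos (exp_pos _), exp_neg, inv_mul_le_iff₀ (exp_pos _), add_sub_add_comm]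
      refine (abs_add_le _ _).trans ?_
      have h1 := abs_clamp_sub_le 0 2 θ.1 θ₀.1
      have hE : 1 ≤ exp (lam * r ^ 2) := Real.one_le_exp (by positivity)
      have := abs_nonneg (θ.1 - θ₀.1)
      nlinarith
    refine squeeze_zero (fun _ => dist_nonneg) hmaj ?_
    have : Continuous fun θ : ℝ × ℝ =>
        (|θ.1 - θ₀.1| + 2 * |θ.2 - θ₀.2|) / (1 - ((1 / 2 : NNReal) : ℝ)) := by fun_prop
    simpa using this.tendsto θ₀
  have hWunc : Continuous (Function.uncurry fun θ r => W θ r) :=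
    continuous_eval.comp ((hWcont.comp continuous_fst).prodMk continuous_snd)
  have hWle : ∀ θ r, clamp (-4) 4 (W θ r) = W θ r := by
    intro θ r
    apply clamp_of_mem
    have := hbound θ (W θ) (W θ).continuous r
    rw [← hWval, Real.norm_eq_abs] at this
    exact abs_le.1 this
  let v : ℝ × ℝ → ℝ → ℝ := fun θ r => exp (lam * r ^ 2) * W θ r
  let q : ℝ × ℝ → ℝ → ℝ := fun θ r => radialAverage n (weightedForce n g lam θ (W θ)) r
  have hveq : ∀ θ r, v θ r = clamp 0 2 θ.1 + ∫ s in (0 : ℝ)..r, s * q θ s := by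
    intro θ r
    simp only [v]
    rw [hWval, weightedOperator, ← mul_assoc, ← exp_add, add_neg_cancel, exp_zero, one_mul]
  have hfv : ∀ θ σ, weightedForce n g lam θ (W θ) σ
      = radialForce n (clamp 0 1 θ.2) g σ (v θ σ) := by
    intro θ σ
    rw [weightedForce, hWle]
  refine ⟨v, q, ?_, ?_, ?_, ?_⟩
  · have : Continuous fun p : (ℝ × ℝ) × ℝ => exp (lam * p.2 ^ 2) := by fun_prop
    exact this.mul hWunc
  · exact continuous_radialAverage n (f := fun θ => weightedForce n g lam θ (W θ))
      (continuous_weightedForce n lam hgc hgd hWunc)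
  · intro μ hμ r
    have h0 : (0 : BoundedContinuousFunction ℝ ℝ) = W (0, μ) := by
      apply (hcontr (0, μ)).fixedPoint_unique
      ext r
      rw [hΦ]
      have : weightedForce n g lam (0, μ) ((0 : BoundedContinuousFunction ℝ ℝ) : ℝ → ℝ) = 0 :=
        hzero _
      rw [weightedOperator, this]
      simp [radialAverage, clamp]
    simp only [v, ← h0]
    simp
  · intro a ha μ hμ
    have hca : clamp 0 2 a = a := clamp_of_mem ha
    have hcμ : clamp 0 1 μ = μ := clamp_of_mem hμ
    have hv0 : v (a, μ) 0 = a := by rw [hveq]; simp [hca]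
    refine ⟨hv0, ?_, ?_, ?_⟩
    · intro r
      have hc := hint (a, μ) (W (a, μ)) (W (a, μ)).continuous
      have h1 := (intervalIntegral.integral_hasDerivAt_right (hc.intervalIntegrable 0 r)
        (hc.stronglyMeasurableAtFilter _ _) hc.continuousAt).const_add (clamp 0 2 a)
      exact h1.congr_of_eventuallyEq (Eventually.of_forall fun x => hveq (a, μ) x)
    · intro r hr
      have h1 := hasDerivAt_radialAverage n (hforce (a, μ) (W (a, μ)) (W (a, μ)).continuous) hr
      rw [hfv] at h1
      simp only [hcμ] at h1
      exact h1
    · have h1 := radialAverage_zero n (weightedForce n g lam (a, μ) (W (a, μ)))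
      rw [hfv, hv0] at h1
      simp only [hcμ] at h1
      exact h1

/-! ### Smoothness of radial functions and of equivariant maps -/

/-- A radial vector field `q(‖x‖) x` is `C¹` when `q` is continuous, `C¹` away from `0`, and
`r q'(r) → 0` as `r → 0`. -/
lemma contDiff_one_norm_smul {q q' : ℝ → ℝ} (hq : Continuous q)
    (hd : ∀ r, 0 < r → HasDerivAt q (q' r) r) (hq' : ContinuousOn q' (Ioi 0))
    (h0 : Tendsto (fun r => r * q' r) (𝓝[>] 0) (𝓝 0)) :
    ContDiff ℝ 1 fun x : Plane => q ‖x‖ • x := by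
  rw [contDiff_one_iff_hasFDerivAt]
  refine ⟨fun x => q ‖x‖ • ContinuousLinearMap.id ℝ Plane
    + (q' ‖x‖ / ‖x‖) • (innerSL ℝ x).smulRight x, ?_, ?_⟩
  · rw [continuous_iff_continuousAt]
    intro x
    refine ContinuousAt.add (by fun_prop) ?_
    rcases eq_or_ne x 0 with rfl | hx
    · rw [ContinuousAt]
      have : (q' ‖(0 : Plane)‖ / ‖(0 : Plane)‖) • (innerSL ℝ (0 : Plane)).smulRight (0 : Plane)
          = 0 := by simp
      rw [this, tendsto_zero_iff_norm_tendsto_zero]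
      have h1 : Tendsto (fun x : Plane => ‖(fun r => r * q' r) ‖x‖‖) (𝓝[≠] 0) (𝓝 0) := by
        have h2 : Tendsto (fun x : Plane => ‖x‖) (𝓝[≠] 0) (𝓝[>] 0) := tendsto_norm_nhdsNE_zero
        simpa using (h0.comp h2).norm
      have h3 : Tendsto (fun x : Plane => ‖(fun r => r * q' r) ‖x‖‖) (𝓝 0) (𝓝 0) := by
        rw [← nhdsNE_sup_pure, tendsto_sup]
        refine ⟨h1, ?_⟩
        rw [tendsto_pure_left]
        intro s hs
        simpa using mem_of_mem_nhds hs
      refine squeeze_zero (fun _ => norm_nonneg _) (fun x => ?_) h3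
      rcases eq_or_ne x 0 with rfl | hx
      · simp
      have hxn : 0 < ‖x‖ := norm_pos_iff.2 hx
      rw [norm_smul, ContinuousLinearMap.norm_smulRight_apply, innerSL_apply_norm, norm_div,
        norm_norm, norm_mul, norm_norm]
      apply le_of_eq
      field_simp
    · have hxn : ‖x‖ ≠ 0 := norm_ne_zero_iff.2 hx
      have h1 : ContinuousAt q' ‖x‖ :=
        hq'.continuousAt (Ioi_mem_nhds (norm_pos_iff.2 hx))
      have h2 : ContinuousAt (fun x : Plane => q' ‖x‖) x :=
        ContinuousAt.comp (f := fun x : Plane => ‖x‖) h1 continuous_norm.continuousAt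
      refine (h2.div continuous_norm.continuousAt hxn).smul ?_
      have h3 : Continuous fun x : Plane => (innerSL ℝ x).smulRight x := by
        have := (ContinuousLinearMap.smulRightL ℝ Plane Plane).continuous₂
        exact this.comp ((innerSL ℝ).continuous.prodMk continuous_id)
      exact h3.continuousAt
  · intro x
    rcases eq_or_ne x 0 with rfl | hx
    · rw [hasFDerivAt_iff_isLittleO_nhds_zero, Asymptotics.isLittleO_iff]
      intro c hc
      have h1 : Tendsto (fun x : Plane => q ‖x‖) (𝓝 0) (𝓝 (q 0)) := by
        have : Continuous fun x : Plane => q ‖x‖ := by fun_prop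
        simpa using this.tendsto 0
      filter_upwards [Metric.tendsto_nhds.1 h1 c hc] with y hy
      have h2 : q ‖0 + y‖ • (0 + y) - q ‖(0 : Plane)‖ • (0 : Plane) - (q ‖(0 : Plane)‖ •
          ContinuousLinearMap.id ℝ Plane + (q' ‖(0 : Plane)‖ / ‖(0 : Plane)‖) •
          (innerSL ℝ (0 : Plane)).smulRight (0 : Plane)) y = (q ‖y‖ - q 0) • y := by
        simp [sub_smul]
      rw [h2, norm_smul]
      rw [Real.dist_eq] at hy
      exact mul_le_mul_of_nonneg_right hy.le (norm_nonneg _)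
    · have hxn : ‖x‖ ≠ 0 := norm_ne_zero_iff.2 hx
      have h1 : HasFDerivAt (fun x : Plane => ‖x‖) (‖x‖⁻¹ • innerSL ℝ x) x := by
        have h2 := (hasStrictFDerivAt_norm_sq x).hasFDerivAt.sqrt (by positivity)
        simp only [norm_nonneg, sqrt_sq] at h2
        refine h2.congr_fderiv ?_
        ext y
        simp
        field_simp
      have h3 := ((hd ‖x‖ (norm_pos_iff.2 hx)).comp_hasFDerivAt x h1).smul (hasFDerivAt_id x)
      refine h3.congr_fderiv ?_
      ext1 y
      simp [div_eq_mul_inv, mul_smul]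

/-- A radial function `v(‖x‖)` on the plane is `C²` when `v' = r q` with `q` as in
`contDiff_one_norm_smul`. -/
lemma contDiff_two_comp_norm {v q q' : ℝ → ℝ} (hv : ∀ r, HasDerivAt v (r * q r) r)
    (hq : Continuous q) (hd : ∀ r, 0 < r → HasDerivAt q (q' r) r) (hq' : ContinuousOn q' (Ioi 0))
    (h0 : Tendsto (fun r => r * q' r) (𝓝[>] 0) (𝓝 0)) :
    ContDiff ℝ 2 fun x : Plane => v ‖x‖ := by
  -- As a function of `s = r²`, `v` is a primitive of `q(√s) / 2`.
  have hc : Continuous fun s : ℝ => q (√s) / 2 := by fun_prop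
  have hV : ∀ s, HasDerivAt (fun s => v 0 + ∫ σ in (0 : ℝ)..s, q (√σ) / 2) (q (√s) / 2) s :=
    fun s => (intervalIntegral.integral_hasDerivAt_right (hc.intervalIntegrable 0 s)
      (hc.stronglyMeasurableAtFilter _ _) hc.continuousAt).const_add (v 0)
  have heq : ∀ r, 0 ≤ r → v r = v 0 + ∫ σ in (0 : ℝ)..(r ^ 2), q (√σ) / 2 := by
    intro r hr
    have h1 : ∀ x ∈ Ico 0 r, HasDerivWithinAt
        (fun r => v r - (v 0 + ∫ σ in (0 : ℝ)..(r ^ 2), q (√σ) / 2)) 0 (Ici x) x := by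
      intro x hx
      have h2 := (hv x).sub ((hV (x ^ 2)).comp x (hasDerivAt_pow 2 x))
      refine (h2.congr_deriv ?_).hasDerivWithinAt
      rw [Real.sqrt_sq hx.1]
      push_cast
      ring
    have h3 : ContinuousOn (fun r => v r - (v 0 + ∫ σ in (0 : ℝ)..(r ^ 2), q (√σ) / 2))
        (Icc 0 r) := by
      refine Continuous.continuousOn (Continuous.sub ?_ ?_)
      · exact continuous_iff_continuousAt.2 fun x => (hv x).continuousAt
      · exact (continuous_iff_continuousAt.2 fun x => (hV x).continuousAt).comp (continuous_pow 2)
    have := constant_of_has_deriv_right_zero h3 h1 r ⟨hr, le_rfl⟩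
    have h4 : v 0 - (v 0 + ∫ σ in (0 : ℝ)..(0 ^ 2), q (√σ) / 2) = 0 := by simp
    have h5 : v r - (v 0 + ∫ σ in (0 : ℝ)..(r ^ 2), q (√σ) / 2) = 0 := this.trans h4
    linarith
  rw [show (2 : WithTop ℕ∞) = 1 + 1 from rfl, contDiff_succ_iff_fderiv_apply]
  have hF : ∀ x : Plane, HasFDerivAt (fun x : Plane => v ‖x‖) (q ‖x‖ • innerSL ℝ x) x := by
    intro x
    have h1 := (hV (‖x‖ ^ 2)).comp_hasFDerivAt x (hasStrictFDerivAt_norm_sq x).hasFDerivAt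
    have h2 := h1.congr_of_eventuallyEq (f₁ := fun x : Plane => v ‖x‖)
      (Eventually.of_forall fun y => heq _ (norm_nonneg y))
    refine h2.congr_fderiv ?_
    rw [Real.sqrt_sq (norm_nonneg x)]
    ext y
    simp
    ring
  refine ⟨fun x => (hF x).differentiableAt, by simp, fun y => ?_⟩
  have h1 : (fun x : Plane => fderiv ℝ (fun x : Plane => v ‖x‖) x y)
      = fun x : Plane => inner ℝ (q ‖x‖ • x) y := by
    funext x
    rw [(hF x).fderiv]
    simp [real_inner_smul_left]
  rw [h1]
  exact (contDiff_one_norm_smul hq hd hq' h0).inner ℝ contDiff_const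

/-- The point of `S²` with polar angle `h` and longitude `ψ`. -/
def spherePoint (h ψ : ℝ) : Space := !₂[sin h * cos ψ, sin h * sin ψ, cos h]

lemma norm_spherePoint (h ψ : ℝ) : ‖spherePoint h ψ‖ = 1 := by
  rw [EuclideanSpace.norm_eq, Real.sqrt_eq_one]
  simp only [spherePoint, Fin.sum_univ_three, Real.norm_eq_abs, sq_abs]
  simp
  nlinarith [sin_sq_add_cos_sq h, sin_sq_add_cos_sq ψ]

lemma exists_polar (x : Plane) : ∃ θ, x = !₂[‖x‖ * cos θ, ‖x‖ * sin θ] := by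
  have hn : ‖(⟨x 0, x 1⟩ : ℂ)‖ = ‖x‖ := by
    rw [EuclideanSpace.norm_eq, Complex.norm_eq_sqrt_sq_add_sq]
    simp
  refine ⟨Complex.arg ⟨x 0, x 1⟩, ?_⟩
  have h1 := Complex.norm_mul_cos_arg ⟨x 0, x 1⟩
  have h2 := Complex.norm_mul_sin_arg ⟨x 0, x 1⟩
  rw [hn] at h1 h2
  ext i
  fin_cases i
  · simpa using h1.symm
  · simpa using h2.symm

lemma norm_polar {r : ℝ} (hr : 0 ≤ r) (θ : ℝ) : ‖(!₂[r * cos θ, r * sin θ] : Plane)‖ = r := by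
  rw [EuclideanSpace.norm_eq]
  simp only [Fin.sum_univ_two, Real.norm_eq_abs, sq_abs]
  simp
  rw [mul_pow, mul_pow, ← mul_add, cos_sq_add_sin_sq, mul_one, Real.sqrt_sq hr]

/-- The complex coordinate of the plane, conjugated when the degree `m` is negative, so that
`z ^ |m| = r ^ |m| exp(i m θ)`. -/
def signedCoord (m : ℤ) (x : Plane) : ℂ := (x 0 : ℂ) + (m.sign : ℝ) * (x 1 : ℂ) * Complex.I

lemma signedCoord_pow {m : ℤ} (hm : m ≠ 0) (r θ : ℝ) :
    signedCoord m !₂[r * cos θ, r * sin θ] ^ m.natAbs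
      = (r : ℂ) ^ m.natAbs * Complex.exp ((m * θ : ℝ) * Complex.I) := by
  have h1 : signedCoord m !₂[r * cos θ, r * sin θ]
      = r * Complex.exp ((m.sign * θ : ℝ) * Complex.I) := by
    rw [Complex.exp_mul_I, ← Complex.ofReal_cos, ← Complex.ofReal_sin]
    rcases lt_or_gt_of_ne hm with h | h
    · simp [signedCoord, Int.sign_eq_neg_one_of_neg h]
      ring
    · simp [signedCoord, Int.sign_eq_one_of_pos h]
      ring
  rw [h1, mul_pow, ← Complex.exp_nat_mul]
  congr 2
  have h2 : (m.natAbs : ℂ) * (m.sign : ℂ) = m := by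
    have := Int.sign_mul_natAbs m
    have h3 : ((m.sign * m.natAbs : ℤ) : ℂ) = m := by rw [this]
    push_cast at h3
    rw [← h3]
    simp
    ring
  push_cast
  rw [← h2]
  ring

/-- The rotating equivariant map with profile `r ^ |m| v(r)`, written with functions that are
visibly smooth at the origin. -/
def rotatingMap (m : ℤ) (ω : ℝ) (v : ℝ → ℝ) (t : ℝ) (x : Plane) : Space :=
  !₂[evenSeries 1 ((‖x‖ ^ 2) ^ m.natAbs * v ‖x‖ ^ 2) * v ‖x‖ *
      (Complex.exp ((ω * t : ℝ) * Complex.I) * signedCoord m x ^ m.natAbs).re,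
    evenSeries 1 ((‖x‖ ^ 2) ^ m.natAbs * v ‖x‖ ^ 2) * v ‖x‖ *
      (Complex.exp ((ω * t : ℝ) * Complex.I) * signedCoord m x ^ m.natAbs).im,
    evenSeries 0 ((‖x‖ ^ 2) ^ m.natAbs * v ‖x‖ ^ 2)]

lemma rotatingMap_polar {m : ℤ} (hm : m ≠ 0) (ω : ℝ) (v : ℝ → ℝ) (t : ℝ) {r : ℝ} (hr : 0 ≤ r)
    (θ : ℝ) : rotatingMap m ω v t !₂[r * cos θ, r * sin θ]
      = spherePoint (r ^ m.natAbs * v r) (m * θ + ω * t) := by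
  have h1 : (r ^ 2) ^ m.natAbs * v r ^ 2 = (r ^ m.natAbs * v r) ^ 2 := by ring
  have h2 : Complex.exp ((ω * t : ℝ) * Complex.I)
        * signedCoord m !₂[r * cos θ, r * sin θ] ^ m.natAbs
      = (r ^ m.natAbs : ℝ) * Complex.exp ((m * θ + ω * t : ℝ) * Complex.I) := by
    rw [signedCoord_pow hm, mul_left_comm, ← Complex.exp_add]
    push_cast
    congr 2
    ring
  rw [rotatingMap, norm_polar hr, h1, h2, evenSeries_zero_sq, spherePoint,
    ← mul_evenSeries_one_sq (r ^ m.natAbs * v r), Complex.re_ofReal_mul, Complex.im_ofReal_mul,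
    Complex.exp_ofReal_mul_I_re, Complex.exp_ofReal_mul_I_im]
  congr 2
  · ring
  · congr 1
    ring

lemma contDiff_rotatingMap (m : ℤ) (ω : ℝ) {v : ℝ → ℝ}
    (hv : ContDiff ℝ 2 fun x : Plane => v ‖x‖) :
    ContDiff ℝ 2 fun p : ℝ × Plane => rotatingMap m ω v p.1 p.2 := by
  have hv' : ContDiff ℝ 2 fun p : ℝ × Plane => v ‖p.2‖ := hv.comp contDiff_snd
  have hs : ContDiff ℝ 2 fun p : ℝ × Plane => (‖p.2‖ ^ 2) ^ m.natAbs * v ‖p.2‖ ^ 2 :=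
    ((contDiff_snd.norm_sq ℝ).pow _).mul (hv'.pow 2)
  have hE : ∀ k, ContDiff ℝ 2 fun p : ℝ × Plane =>
      evenSeries k ((‖p.2‖ ^ 2) ^ m.natAbs * v ‖p.2‖ ^ 2) := fun k =>
    (contDiff_evenSeries k).comp hs
  have hx : ∀ i : Fin 2, ContDiff ℝ 2 fun p : ℝ × Plane => ((p.2 i : ℝ) : ℂ) := fun i =>
    Complex.ofRealCLM.contDiff.comp ((contDiff_euclidean.1 contDiff_id i).comp contDiff_snd)
  have hz : ContDiff ℝ 2 fun p : ℝ × Plane => signedCoord m p.2 := by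
    unfold signedCoord
    exact (hx 0).add ((contDiff_const.mul (hx 1)).mul contDiff_const)
  have he : ContDiff ℝ 2 fun p : ℝ × Plane => Complex.exp ((ω * p.1 : ℝ) * Complex.I) := by
    have : ContDiff ℝ 2 fun p : ℝ × Plane => ((ω * p.1 : ℝ) : ℂ) :=
      Complex.ofRealCLM.contDiff.comp (contDiff_const.mul contDiff_fst)
    exact (this.mul contDiff_const).cexp
  have hc := he.mul (hz.pow m.natAbs)
  rw [contDiff_euclidean]
  intro i
  fin_cases i
  · exact ((hE 1).mul hv').mul (Complex.reCLM.contDiff.comp hc)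
  · exact ((hE 1).mul hv').mul (Complex.imCLM.contDiff.comp hc)
  · exact hE 0

/-! ### The flow equation in polar coordinates -/

lemma hasDerivAt_space {f : ℝ → Space} {f' : Space} {x : ℝ} :
    HasDerivAt f f' x ↔ ∀ i, HasDerivAt (fun y => f y i) (f' i) x := by
  rw [hasDerivAt_iff_hasFDerivAt, ← hasFDerivWithinAt_univ, hasFDerivWithinAt_euclidean]
  refine forall_congr' fun i => ?_
  rw [hasDerivAt_iff_hasFDerivAt, hasFDerivWithinAt_univ]
  constructor <;> intro h <;> refine h.congr_fderiv ?_ <;> ext <;> simp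

/-- The unit radial vector of the plane at the angle `θ`. -/
def unitVec (θ : ℝ) : Plane := !₂[cos θ, sin θ]

lemma smul_unitVec (r θ : ℝ) : r • unitVec θ = !₂[r * cos θ, r * sin θ] := by
  ext i
  fin_cases i <;> simp [unitVec]

lemma hasDerivAt_unitVec (θ : ℝ) : HasDerivAt unitVec (unitVec (θ + π / 2)) θ := by
  rw [hasDerivAt_iff_hasFDerivAt, ← hasFDerivWithinAt_univ, hasFDerivWithinAt_euclidean]
  intro i
  rw [hasFDerivWithinAt_univ]
  fin_cases i
  · refine (hasDerivAt_iff_hasFDerivAt.1 (Real.hasDerivAt_cos θ)).congr_fderiv ?_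
    ext
    simp [unitVec, cos_add_pi_div_two]
  · refine (hasDerivAt_iff_hasFDerivAt.1 (Real.hasDerivAt_sin θ)).congr_fderiv ?_
    ext
    simp [unitVec, sin_add_pi_div_two]

lemma laplacian_eq_unitVec (f : Plane → Space) (x : Plane) (θ : ℝ) :
    Δ f x = fderiv ℝ (fderiv ℝ f) x (unitVec θ) (unitVec θ)
      + fderiv ℝ (fderiv ℝ f) x (unitVec (θ + π / 2)) (unitVec (θ + π / 2)) := by
  rw [InnerProductSpace.laplacian_eq_iteratedFDeriv_orthonormalBasis f
    (EuclideanSpace.basisFun (Fin 2) ℝ)]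
  simp only [iteratedFDeriv_two_apply, Fin.sum_univ_two]
  set D := fderiv ℝ (fderiv ℝ f) x
  set b₀ := EuclideanSpace.basisFun (Fin 2) ℝ 0
  set b₁ := EuclideanSpace.basisFun (Fin 2) ℝ 1
  have h : ∀ φ, unitVec φ = cos φ • b₀ + sin φ • b₁ := by
    intro φ
    ext i
    fin_cases i <;> simp [unitVec, b₀, b₁]
  rw [h, h, cos_add_pi_div_two, sin_add_pi_div_two]
  simp only [Matrix.cons_val_zero, Matrix.cons_val_one, map_add, map_smul,
    _root_.add_apply, _root_.smul_apply]
  have h1 := cos_sq_add_sin_sq θ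
  have h2 : D b₀ b₀ + D b₁ b₁ = (cos θ ^ 2 + sin θ ^ 2) • (D b₀ b₀ + D b₁ b₁) := by
    rw [h1, one_smul]
  rw [h2]
  module

/-- The Laplacian in polar coordinates, `r² Δ f = r² f_rr + r f_r + f_θθ`. -/
lemma sq_smul_laplacian {f : Plane → Space} (hf : ContDiff ℝ 2 f) {r₀ θ₀ : ℝ}
    {Ur Uθ : ℝ → Space} {Urr Uθθ : Space}
    (h1 : ∀ᶠ r in 𝓝 r₀, HasDerivAt (fun r => f (r • unitVec θ₀)) (Ur r) r)
    (h2 : HasDerivAt Ur Urr r₀)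
    (h3 : ∀ θ, HasDerivAt (fun θ => f (r₀ • unitVec θ)) (Uθ θ) θ)
    (h4 : HasDerivAt Uθ Uθθ θ₀) :
    r₀ ^ 2 • Δ f (r₀ • unitVec θ₀) = r₀ ^ 2 • Urr + r₀ • Ur r₀ + Uθθ := by
  have hD : ∀ x, HasFDerivAt f (fderiv ℝ f x) x := fun x =>
    (hf.differentiable (by norm_num) x).hasFDerivAt
  have hDD : ∀ x, HasFDerivAt (fderiv ℝ f) (fderiv ℝ (fderiv ℝ f) x) x := fun x =>
    ((hf.fderiv_right (m := 1) (by norm_num)).differentiable (by norm_num) x).hasFDerivAt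
  have hray : ∀ r, HasDerivAt (fun r : ℝ => r • unitVec θ₀) (unitVec θ₀) r := fun r => by
    simpa using (hasDerivAt_id r).smul_const (unitVec θ₀)
  have hcirc : ∀ θ, HasDerivAt (fun θ => r₀ • unitVec θ) (r₀ • unitVec (θ + π / 2)) θ :=
    fun θ => (hasDerivAt_unitVec θ).const_smul r₀
  have e1 : ∀ᶠ r in 𝓝 r₀, Ur r = fderiv ℝ f (r • unitVec θ₀) (unitVec θ₀) := by
    filter_upwards [h1] with r hr
    have : HasDerivAt (fun r : ℝ => f (r • unitVec θ₀))
        (fderiv ℝ f (r • unitVec θ₀) (unitVec θ₀)) r :=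
      (hD (r • unitVec θ₀)).comp_hasDerivAt r (hray r)
    exact hr.unique this
  have e2 : Urr = fderiv ℝ (fderiv ℝ f) (r₀ • unitVec θ₀) (unitVec θ₀) (unitVec θ₀) := by
    have h : HasDerivAt (fun r : ℝ => fderiv ℝ f (r • unitVec θ₀))
        (fderiv ℝ (fderiv ℝ f) (r₀ • unitVec θ₀) (unitVec θ₀)) r₀ :=
      (hDD (r₀ • unitVec θ₀)).comp_hasDerivAt r₀ (hray r₀)
    have := h.clm_apply (hasDerivAt_const r₀ (unitVec θ₀))
    refine h2.unique ((this.congr_of_eventuallyEq e1).congr_deriv ?_)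
    simp
  have e3 : ∀ θ, Uθ θ = fderiv ℝ f (r₀ • unitVec θ) (r₀ • unitVec (θ + π / 2)) := by
    intro θ
    have : HasDerivAt (fun θ : ℝ => f (r₀ • unitVec θ))
        (fderiv ℝ f (r₀ • unitVec θ) (r₀ • unitVec (θ + π / 2))) θ :=
      (hD (r₀ • unitVec θ)).comp_hasDerivAt θ (hcirc θ)
    exact (h3 θ).unique this
  have e4 : Uθθ = r₀ ^ 2 • fderiv ℝ (fderiv ℝ f) (r₀ • unitVec θ₀) (unitVec (θ₀ + π / 2))
      (unitVec (θ₀ + π / 2)) - r₀ • fderiv ℝ f (r₀ • unitVec θ₀) (unitVec θ₀) := by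
    have hshift : HasDerivAt (fun θ => r₀ • unitVec (θ + π / 2)) (-(r₀ • unitVec θ₀)) θ₀ := by
      have := ((hasDerivAt_unitVec (θ₀ + π / 2)).comp_add_const θ₀ (π / 2)).const_smul r₀
      refine this.congr_deriv ?_
      rw [← smul_neg]
      congr 1
      ext i
      fin_cases i <;> simp [unitVec, add_assoc, cos_add_pi, sin_add_pi]
    have h : HasDerivAt (fun θ : ℝ => fderiv ℝ f (r₀ • unitVec θ))
        (fderiv ℝ (fderiv ℝ f) (r₀ • unitVec θ₀) (r₀ • unitVec (θ₀ + π / 2))) θ₀ :=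
      (hDD (r₀ • unitVec θ₀)).comp_hasDerivAt θ₀ (hcirc θ₀)
    have := h.clm_apply hshift
    refine h4.unique ((this.congr_of_eventuallyEq (Eventually.of_forall e3)).congr_deriv ?_)
    simp only [map_smul, _root_.smul_apply, map_neg]
    module
  rw [laplacian_eq_unitVec f _ θ₀, e2, e4, e1.self_of_nhds]
  module

lemma hasDerivAt_spherePoint {h ψ : ℝ → ℝ} {h' ψ' s : ℝ} (hh : HasDerivAt h h' s)
    (hψ : HasDerivAt ψ ψ' s) :
    HasDerivAt (fun s => spherePoint (h s) (ψ s))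
      !₂[h' * cos (h s) * cos (ψ s) - ψ' * sin (h s) * sin (ψ s),
        h' * cos (h s) * sin (ψ s) + ψ' * sin (h s) * cos (ψ s), -h' * sin (h s)] s := by
  rw [hasDerivAt_space]
  intro i
  fin_cases i
  · refine (hh.sin.mul hψ.cos).congr_deriv ?_
    simp
    ring
  · refine (hh.sin.mul hψ.sin).congr_deriv ?_
    simp
    ring
  · refine hh.cos.congr_deriv ?_
    simp
    ring

/-- For an equivariant map with profile `h`, `u × Δu` points along the parallels and its length is
the tension of the profile. -/
lemma cross_laplacian {m : ℤ} {c : ℝ} {f : Plane → Space} (hf : ContDiff ℝ 2 f) {h h₁ : ℝ → ℝ}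
    {h₂ r θ : ℝ} (hr : 0 < r)
    (hform : ∀ r θ, 0 < r → f (r • unitVec θ) = spherePoint (h r) (m * θ + c))
    (hh : ∀ s, 0 < s → HasDerivAt h (h₁ s) s) (hh₁ : HasDerivAt h₁ h₂ r) :
    cross (f (r • unitVec θ)) (Δ f (r • unitVec θ))
      = (h₂ + h₁ r / r - m ^ 2 * (sin (h r) * cos (h r)) / r ^ 2) •
        !₂[-sin (m * θ + c), cos (m * θ + c), 0] := by
  set ψ := m * θ + c with hψ
  have hψd : ∀ θ, HasDerivAt (fun θ : ℝ => m * θ + c) m θ := fun θ => by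
    simpa using ((hasDerivAt_id θ).const_mul (m : ℝ)).add_const c
  have h1 : ∀ᶠ s in 𝓝 r, HasDerivAt (fun s => f (s • unitVec θ))
      !₂[h₁ s * cos (h s) * cos ψ, h₁ s * cos (h s) * sin ψ, -h₁ s * sin (h s)] s := by
    filter_upwards [Ioi_mem_nhds hr] with s hs
    have := hasDerivAt_spherePoint (hh s hs) (hasDerivAt_const s ψ)
    have e : (fun s => f (s • unitVec θ)) =ᶠ[𝓝 s] fun s => spherePoint (h s) ψ := by
      filter_upwards [Ioi_mem_nhds hs] with t ht
      exact hform t θ ht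
    refine (this.congr_of_eventuallyEq e).congr_deriv ?_
    simp
  have h2 : HasDerivAt
      (fun s => (!₂[h₁ s * cos (h s) * cos ψ, h₁ s * cos (h s) * sin ψ, -h₁ s * sin (h s)] : Space))
      !₂[(h₂ * cos (h r) - h₁ r ^ 2 * sin (h r)) * cos ψ,
        (h₂ * cos (h r) - h₁ r ^ 2 * sin (h r)) * sin ψ,
        -h₂ * sin (h r) - h₁ r ^ 2 * cos (h r)] r := by
    rw [hasDerivAt_space]
    intro i
    fin_cases i
    · refine ((hh₁.mul (hh r hr).cos).mul_const (cos ψ)).congr_deriv ?_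
      simp [-mul_eq_mul_right_iff]
      ring
    · refine ((hh₁.mul (hh r hr).cos).mul_const (sin ψ)).congr_deriv ?_
      simp [-mul_eq_mul_right_iff]
      ring
    · refine (hh₁.neg.mul (hh r hr).sin).congr_deriv ?_
      simp
      ring
  have h3 : ∀ θ, HasDerivAt (fun θ => f (r • unitVec θ))
      !₂[-m * sin (h r) * sin (m * θ + c), m * sin (h r) * cos (m * θ + c), 0] θ := by
    intro θ
    have := hasDerivAt_spherePoint (hasDerivAt_const θ (h r)) (hψd θ)
    refine (this.congr_of_eventuallyEq (Eventually.of_forall fun φ => hform r φ hr)).congr_deriv ?_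
    simp
  have h4 : HasDerivAt (fun θ : ℝ =>
      (!₂[-m * sin (h r) * sin (m * θ + c), m * sin (h r) * cos (m * θ + c), 0] : Space))
      !₂[-m ^ 2 * sin (h r) * cos ψ, -m ^ 2 * sin (h r) * sin ψ, 0] θ := by
    rw [hasDerivAt_space]
    intro i
    fin_cases i
    · refine ((hψd θ).sin.const_mul (-m * sin (h r))).congr_deriv ?_
      simp [hψ]
      ring
    · refine ((hψd θ).cos.const_mul (m * sin (h r))).congr_deriv ?_
      simp [hψ]
      ring
    · exact hasDerivAt_const _ _
  have hL := sq_smul_laplacian hf h1 h2 h3 h4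
  have hL' : Δ f (r • unitVec θ) = (r ^ 2)⁻¹ • (r ^ 2 • Δ f (r • unitVec θ)) := by
    rw [inv_smul_smul₀ (by positivity)]
  rw [hL', hL, hform r θ hr, ← hψ]
  have t1 : sin (h r) ^ 2 = 1 - cos (h r) ^ 2 := by rw [sin_sq]
  have t2 : sin ψ ^ 2 = 1 - cos ψ ^ 2 := by rw [sin_sq]
  ext i
  fin_cases i
  · simp [cross, spherePoint, cross_apply]
    field_simp
    ring_nf
    simp only [t1]
    ring
  · simp [cross, spherePoint, cross_apply]
    field_simp
    ring_nf
    simp only [t1]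
    ring
  · simp [cross, spherePoint, cross_apply]
    ring

lemma polarDist_smul {z : Space} {s : ℝ} (hs : 0 < s) : polarDist (s • z) = polarDist z :=
  InnerProductGeometry.angle_smul_right_of_pos _ _ hs

lemma norm_northPole : ‖northPole‖ = 1 := by
  have := norm_spherePoint 0 0
  simpa [spherePoint, northPole] using this

lemma polarDist_eq (z : Space) : polarDist z = arccos (z 2 / ‖z‖) := by
  rw [polarDist, InnerProductGeometry.angle, norm_northPole, one_mul]
  congr 2
  simp [northPole, PiLp.inner_apply, Fin.sum_univ_three]

/-- The gradient of a function of the polar angle: `G'(h)` times the unit vector of the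
meridian. -/
lemma sphereGradient_spherePoint {G : ℝ → ℝ} {G' h ψ : ℝ} (hh : h ∈ Ioo 0 π)
    (hG : HasDerivAt G G' h) :
    sphereGradient (fun y => G (polarDist y)) (spherePoint h ψ)
      = G' • !₂[cos h * cos ψ, cos h * sin ψ, -sin h] := by
  set y := spherePoint h ψ with hy
  have hyn : ‖y‖ = 1 := norm_spherePoint h ψ
  have hy0 : y ≠ 0 := by
    intro h0
    rw [h0, norm_zero] at hyn
    norm_num at hyn
  have hsin : 0 < sin h := sin_pos_of_pos_of_lt_pi hh.1 hh.2
  have hy2 : y 2 = cos h := by simp [hy, spherePoint]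
  apply HasGradientAt.gradient
  rw [hasGradientAt_iff_hasFDerivAt]
  have hnorm : HasFDerivAt (fun z : Space => ‖z‖⁻¹) (-(innerSL ℝ y)) y := by
    have h2 := (hasStrictFDerivAt_norm_sq y).hasFDerivAt.sqrt (by rw [hyn]; norm_num)
    simp only [norm_nonneg, sqrt_sq, hyn] at h2
    have h3 := (hasDerivAt_inv (x := ‖y‖) (by rw [hyn]; norm_num)).comp_hasFDerivAt y h2
    refine h3.congr_fderiv ?_
    ext w
    simp [hyn]
  have hproj : HasFDerivAt (fun z : Space => z 2)
      (EuclideanSpace.proj (2 : Fin 3) : Space →L[ℝ] ℝ) y :=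
    (EuclideanSpace.proj (2 : Fin 3) : Space →L[ℝ] ℝ).hasFDerivAt
  have hq := hproj.mul hnorm
  have hval : y 2 * ‖y‖⁻¹ = cos h := by rw [hyn, hy2]; norm_num
  have hlt : cos h < 1 := by
    have := sin_sq_add_cos_sq h
    nlinarith
  have hgt : -1 < cos h := by
    have := sin_sq_add_cos_sq h
    nlinarith
  have hac : HasDerivAt arccos (-(1 / √(1 - cos h ^ 2))) (y 2 * ‖y‖⁻¹) := by
    rw [hval]
    exact Real.hasDerivAt_arccos hgt.ne' hlt.ne
  have hG2 : HasDerivAt G G' (arccos (y 2 * ‖y‖⁻¹)) := by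
    rw [hval, arccos_cos hh.1.le hh.2.le]
    exact hG
  have hcomp := (hG2.comp (y 2 * ‖y‖⁻¹) hac).comp_hasFDerivAt y hq
  have heq : (fun z : Space => G (polarDist (‖z‖⁻¹ • z))) =ᶠ[𝓝 y]
      (G ∘ arccos) ∘ fun z : Space => z 2 * ‖z‖⁻¹ := by
    filter_upwards [isOpen_ne.mem_nhds hy0] with z hz
    rw [polarDist_smul (inv_pos.2 (norm_pos_iff.2 hz)), polarDist_eq]
    rfl
  refine (hcomp.congr_of_eventuallyEq heq).congr_fderiv ?_
  have hsq : √(1 - cos h ^ 2) = sin h := by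
    rw [← sin_sq, sqrt_sq hsin.le]
  rw [hsq, hyn, hy2]
  ext w
  have t1 : cos h ^ 2 = 1 - sin h ^ 2 := by rw [cos_sq']
  simp [hy, spherePoint, PiLp.inner_apply, Fin.sum_univ_three]
  field_simp
  ring_nf
  simp only [t1]
  ring

/-- At the north pole the gradient of a function of the polar angle is vertical. -/
lemma cross_sphereGradient_northPole (G : ℝ → ℝ) :
    cross northPole (sphereGradient (fun y => G (polarDist y)) northPole) = 0 := by
  set f : Space → ℝ := fun z => G (polarDist (‖z‖⁻¹ • z)) with hf
  have key : ∀ i : Fin 3, i ≠ 2 → gradient f northPole i = 0 := by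
    intro i hi
    by_cases hd : DifferentiableAt ℝ f northPole
    · set b : Space := EuclideanSpace.single i 1 with hb
      -- `f` is even along the horizontal line through the pole in the direction of `b`.
      have hline : HasDerivAt (fun s : ℝ => northPole + s • b) b 0 := by
        simpa using ((hasDerivAt_id (0 : ℝ)).smul_const b).const_add northPole
      have hd' : HasFDerivAt f (fderiv ℝ f northPole) (northPole + (0 : ℝ) • b) := by
        simpa using hd.hasFDerivAt
      have h1 := hd'.comp_hasDerivAt (0 : ℝ) hline
      have heven : ∀ s : ℝ, f (northPole + s • b) = f (northPole + (-s) • b) := by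
        intro s
        have hn : ∀ s : ℝ, ‖northPole + s • b‖ = √(s ^ 2 + 1) := by
          intro s
          rw [EuclideanSpace.norm_eq, Fin.sum_univ_three]
          fin_cases i <;> simp_all [northPole]
        have hp : ∀ s : ℝ, f (northPole + s • b) = G (arccos (1 / √(s ^ 2 + 1))) := by
          intro s
          have hpos : 0 < ‖northPole + s • b‖ := by rw [hn]; positivity
          rw [hf]
          simp only
          rw [polarDist_smul (inv_pos.2 hpos), polarDist_eq, hn]
          congr 3
          fin_cases i <;> simp_all [northPole]
        rw [hp, hp, neg_sq]
      have h2 : HasDerivAt (fun s : ℝ => f (northPole + s • b)) (-(fderiv ℝ f northPole b)) 0 := by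
        have h3 : HasDerivAt (fun s : ℝ => -s) (-1) 0 := hasDerivAt_neg' 0
        have h4 : HasDerivAt (f ∘ fun s : ℝ => northPole + s • b) (fderiv ℝ f northPole b)
            (-0) := by simpa using h1
        have h5 := h4.comp (0 : ℝ) h3
        refine (h5.congr_of_eventuallyEq (Eventually.of_forall fun s => ?_)).congr_deriv (by simp)
        exact heven s
      have h6 : fderiv ℝ f northPole b = -(fderiv ℝ f northPole b) := h1.unique h2
      have h7 : fderiv ℝ f northPole b = 0 := by linarith
      have h8 : inner ℝ (gradient f northPole) b = fderiv ℝ f northPole b := by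
        rw [gradient, InnerProductSpace.toDual_symm_apply]
      rw [h7, hb, EuclideanSpace.inner_single_right] at h8
      simpa using h8
    · rw [gradient_eq_zero_of_not_differentiableAt hd]
      rfl
  have h0 := key 0 (by decide)
  have h1 := key 1 (by decide)
  rw [sphereGradient]
  change cross northPole (gradient f northPole) = 0
  generalize gradient f northPole = w at h0 h1
  ext i
  fin_cases i <;> simp [cross, northPole, cross_apply, h0, h1]

/-! ### Monotonicity and first-zero tools on the half-line -/

lemma le_of_hasDerivAt_nonneg {f f' : ℝ → ℝ} {a b : ℝ} (hab : a ≤ b)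
    (hd : ∀ x ∈ Icc a b, HasDerivAt f (f' x) x) (h : ∀ x ∈ Ioo a b, 0 ≤ f' x) : f a ≤ f b := by
  refine monotoneOn_of_deriv_nonneg (convex_Icc a b)
    (fun x hx => (hd x hx).continuousAt.continuousWithinAt) (fun x hx => ?_) (fun x hx => ?_)
    ⟨le_rfl, hab⟩ ⟨hab, le_rfl⟩ hab
  · exact (hd x (interior_subset hx)).differentiableAt.differentiableWithinAt
  · rw [(hd x (interior_subset hx)).deriv]
    rw [interior_Icc] at hx
    exact h x hx

lemma lt_of_hasDerivAt_pos {f f' : ℝ → ℝ} {a b : ℝ} (hab : a < b)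
    (hd : ∀ x ∈ Icc a b, HasDerivAt f (f' x) x) (h : ∀ x ∈ Ioo a b, 0 < f' x) : f a < f b := by
  refine strictMonoOn_of_deriv_pos (convex_Icc a b)
    (fun x hx => (hd x hx).continuousAt.continuousWithinAt) (fun x hx => ?_)
    ⟨le_rfl, hab.le⟩ ⟨hab.le, le_rfl⟩ hab
  rw [(hd x (interior_subset hx)).deriv]
  rw [interior_Icc] at hx
  exact h x hx

lemma nonneg_of_tendsto_zero {f f' : ℝ → ℝ} {R : ℝ} (hR : 0 < R)
    (hlim : Tendsto f (𝓝[>] 0) (𝓝 0)) (hd : ∀ x ∈ Ioc 0 R, HasDerivAt f (f' x) x)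
    (h : ∀ x ∈ Ioo 0 R, 0 ≤ f' x) : 0 ≤ f R := by
  refine le_of_tendsto hlim ?_
  filter_upwards [Ioo_mem_nhdsGT hR] with x hx
  exact le_of_hasDerivAt_nonneg hx.2.le (fun y hy => hd y ⟨hx.1.trans_le hy.1, hy.2⟩)
    fun y hy => h y ⟨hx.1.trans hy.1, hy.2⟩

lemma pos_of_tendsto_zero {f f' : ℝ → ℝ} {R : ℝ} (hR : 0 < R)
    (hlim : Tendsto f (𝓝[>] 0) (𝓝 0)) (hd : ∀ x ∈ Ioc 0 R, HasDerivAt f (f' x) x)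
    (h : ∀ x ∈ Ioo 0 R, 0 < f' x) : 0 < f R := by
  have h1 : 0 ≤ f (R / 2) := nonneg_of_tendsto_zero (half_pos hR) hlim
    (fun x hx => hd x ⟨hx.1, hx.2.trans (by linarith)⟩)
    fun x hx => (h x ⟨hx.1, hx.2.trans (by linarith)⟩).le
  have h2 : f (R / 2) < f R := lt_of_hasDerivAt_pos (by linarith)
    (fun x hx => hd x ⟨by linarith [hx.1], hx.2⟩) fun x hx => h x ⟨by linarith [hx.1], hx.2⟩
  linarith

/-- A continuous function that is positive near `0` and not positive on all of `(0, R]` has a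
first zero there. -/
lemma exists_first_zero {f : ℝ → ℝ} {R : ℝ} (hc : ∀ r, 0 < r → ContinuousAt f r)
    (h0 : ∀ᶠ r in 𝓝[>] (0 : ℝ), 0 < f r) (hR : ∃ r ∈ Ioc 0 R, f r ≤ 0) :
    ∃ s ∈ Ioc 0 R, f s = 0 ∧ ∀ r ∈ Ioo 0 s, 0 < f r := by
  obtain ⟨ε, hε, hεf⟩ := mem_nhdsGT_iff_exists_Ioo_subset.1 h0
  obtain ⟨r₁, hr₁, hfr₁⟩ := hR
  have hε' : (0 : ℝ) < ε := hε
  have hcomp : IsCompact {r ∈ Icc (min ε R) R | f r ≤ 0} := by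
    have hcl : ContinuousOn f (Icc (min ε R) R) := fun x hx =>
      (hc x ((lt_min hε' (hr₁.1.trans_le hr₁.2)).trans_le hx.1)).continuousWithinAt
    exact isCompact_Icc.of_isClosed_subset
      (hcl.preimage_isClosed_of_isClosed isClosed_Icc isClosed_Iic) fun x hx => hx.1
  have hge : ∀ r, 0 < r → f r ≤ 0 → ε ≤ r := by
    intro r hr hfr
    by_contra! hlt
    exact absurd (hεf ⟨hr, hlt⟩ : 0 < f r) (not_lt.2 hfr)
  obtain ⟨s, hs, hsmin⟩ := hcomp.exists_isLeast
    ⟨r₁, ⟨(min_le_left _ _).trans (hge r₁ hr₁.1 hfr₁), hr₁.2⟩, hfr₁⟩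
  have hs0 : 0 < s := (lt_min hε' (hr₁.1.trans_le hr₁.2)).trans_le hs.1.1
  have hpos : ∀ r ∈ Ioo 0 s, 0 < f r := by
    intro r hr
    by_contra! hle
    exact absurd (hsmin ⟨⟨(min_le_left _ _).trans (hge r hr.1 hle), hr.2.le.trans hs.1.2⟩, hle⟩)
      (not_le.2 hr.2)
  refine ⟨s, ⟨hs0, hs.1.2⟩, le_antisymm hs.2 ?_, hpos⟩
  refine ge_of_tendsto ((hc s hs0).continuousWithinAt (s := Iio s)) ?_
  filter_upwards [Ioo_mem_nhdsLT hs0] with r hr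
  exact (hpos r hr).le

/-! ### The profile equation -/

/-- The data of the profile equation: `g` is positive on `(0, ξ)`, negative on `(ξ, π)`, and
extended to a Lipschitz function on `ℝ`; `G` is its primitive with `G(π) = 0`, and `G(0) < 0`. -/
structure BistableForce (g G : ℝ → ℝ) (ξ L : ℝ) : Prop where
  mem : ξ ∈ Ioo 0 π
  zero : g 0 = 0
  at_pi : g π = 0
  pos : ∀ x ∈ Ioo 0 ξ, 0 < g x
  neg : ∀ x ∈ Ioo ξ π, g x < 0
  lip_nonneg : 0 ≤ L
  lip : ∀ x y, |g x - g y| ≤ L * |x - y|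
  diff : ∀ x ∈ Ico 0 π, DifferentiableAt ℝ g x
  prim : ∀ x, HasDerivAt G (g x) x
  prim_pi : G π = 0
  prim_zero : G 0 < 0

/-- A solution of `h'' + h'/r - n² sin h cos h / r² = μ g(h)` on `(0, ∞)` that leaves `h = 0` at
`r = 0` upwards, with `p(r) = r h'(r)`. -/
structure IsProfile (n : ℕ) (μ : ℝ) (g h p : ℝ → ℝ) : Prop where
  deriv_h : ∀ r, 0 < r → HasDerivAt h (p r / r) r
  deriv_p : ∀ r, 0 < r →
    HasDerivAt p ((n ^ 2 * (sin (h r) * cos (h r)) + μ * r ^ 2 * g (h r)) / r) r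
  lim_h : Tendsto h (𝓝[>] 0) (𝓝 0)
  lim_p : Tendsto p (𝓝[>] 0) (𝓝 0)
  pos : ∀ᶠ r in 𝓝[>] 0, 0 < h r ∧ 0 < p r

/-- The Pohozaev quantity `((r h')² - n² sin² h) / 2`, conserved when `g = 0`. -/
def pohozaev (n : ℕ) (h p : ℝ → ℝ) (r : ℝ) : ℝ := (p r ^ 2 - n ^ 2 * sin (h r) ^ 2) / 2

/-- The profile `2 arctan (rⁿ)` of the harmonic map of degree `n`. -/
def arctanProfile (n : ℕ) (r : ℝ) : ℝ := 2 * arctan (r ^ n)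

/-- The integral `∫₀ʳ G(φ(s)) s ds` along the harmonic profile `φ`. -/
def harmonicIntegral (n : ℕ) (G : ℝ → ℝ) (r : ℝ) : ℝ :=
  ∫ s in (0 : ℝ)..r, G (arctanProfile n s) * s

/-- The work `∫₀ʳ s² g(φ(s)) φ'(s) ds` of `g` along the harmonic profile `φ`, written after an
integration by parts. -/
def harmonicWork (n : ℕ) (G : ℝ → ℝ) (r : ℝ) : ℝ :=
  r ^ 2 * G (arctanProfile n r) - 2 * harmonicIntegral n G r

/-- The radius at which the harmonic profile takes the value `x`. -/
def harmonicRadius (n : ℕ) (x : ℝ) : ℝ := exp (log (tan (x / 2)) / n)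

lemma BistableForce.continuous {g G : ℝ → ℝ} {ξ L : ℝ} (hg : BistableForce g G ξ L) :
    Continuous g :=
  (LipschitzWith.of_dist_le_mul (K := ⟨L, hg.lip_nonneg⟩) fun x y => hg.lip x y).continuous

lemma BistableForce.continuous_prim {g G : ℝ → ℝ} {ξ L : ℝ} (hg : BistableForce g G ξ L) :
    Continuous G := continuous_iff_continuousAt.2 fun x => (hg.prim x).continuousAt

lemma BistableForce.at_xi {g G : ℝ → ℝ} {ξ L : ℝ} (hg : BistableForce g G ξ L) : g ξ = 0 := by
  have hc := hg.continuous.continuousAt (x := ξ)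
  apply le_antisymm
  · refine le_of_tendsto (hc.continuousWithinAt (s := Ioi ξ)) ?_
    filter_upwards [Ioo_mem_nhdsGT hg.mem.2] with x hx
    exact (hg.neg x hx).le
  · refine ge_of_tendsto (hc.continuousWithinAt (s := Iio ξ)) ?_
    filter_upwards [Ioo_mem_nhdsLT hg.mem.1] with x hx
    exact (hg.pos x hx).le

lemma BistableForce.nonneg {g G : ℝ → ℝ} {ξ L : ℝ} (hg : BistableForce g G ξ L) {x : ℝ}
    (hx : x ∈ Icc 0 ξ) : 0 ≤ g x := by
  rcases hx.1.eq_or_lt with h | h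
  · rw [← h, hg.zero]
  rcases hx.2.eq_or_lt with h' | h'
  · rw [h', hg.at_xi]
  exact (hg.pos x ⟨h, h'⟩).le

lemma BistableForce.nonpos {g G : ℝ → ℝ} {ξ L : ℝ} (hg : BistableForce g G ξ L) {x : ℝ}
    (hx : x ∈ Icc ξ π) : g x ≤ 0 := by
  rcases hx.1.eq_or_lt with h | h
  · rw [← h, hg.at_xi]
  rcases hx.2.eq_or_lt with h' | h'
  · rw [h', hg.at_pi]
  exact (hg.neg x ⟨h, h'⟩).le

lemma BistableForce.prim_mono {g G : ℝ → ℝ} {ξ L : ℝ} (hg : BistableForce g G ξ L) {x y : ℝ}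
    (hx : 0 ≤ x) (hxy : x ≤ y) (hy : y ≤ ξ) : G x ≤ G y :=
  le_of_hasDerivAt_nonneg hxy (fun _ _ => hg.prim _)
    fun _ hz => hg.nonneg ⟨hx.trans hz.1.le, hz.2.le.trans hy⟩

lemma BistableForce.prim_anti {g G : ℝ → ℝ} {ξ L : ℝ} (hg : BistableForce g G ξ L) {x y : ℝ}
    (hx : ξ ≤ x) (hxy : x ≤ y) (hy : y ≤ π) : G y ≤ G x := by
  have := le_of_hasDerivAt_nonneg hxy (fun _ _ => (hg.prim _).neg)
    fun _ hz => neg_nonneg.2 (hg.nonpos ⟨hx.trans hz.1.le, hz.2.le.trans hy⟩)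
  simpa using this

lemma BistableForce.prim_nonneg {g G : ℝ → ℝ} {ξ L : ℝ} (hg : BistableForce g G ξ L) {x : ℝ}
    (hx : x ∈ Icc ξ π) : 0 ≤ G x := by
  rw [← hg.prim_pi]
  exact hg.prim_anti hx.1 hx.2 le_rfl

lemma BistableForce.prim_ge {g G : ℝ → ℝ} {ξ L : ℝ} (hg : BistableForce g G ξ L) {x : ℝ}
    (hx : x ∈ Icc 0 π) : G 0 ≤ G x := by
  rcases le_total x ξ with h | h
  · exact hg.prim_mono le_rfl hx.1 h
  · exact hg.prim_zero.le.trans (hg.prim_nonneg ⟨h, hx.2⟩)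

lemma BistableForce.prim_le {g G : ℝ → ℝ} {ξ L : ℝ} (hg : BistableForce g G ξ L) {x : ℝ}
    (hx : x ∈ Icc 0 π) : G x ≤ G ξ := by
  rcases le_total x ξ with h | h
  · exact hg.prim_mono hx.1 h le_rfl
  · exact hg.prim_anti le_rfl h hx.2

lemma hasDerivAt_arctanProfile (n : ℕ) {r : ℝ} (hr : 0 < r) :
    HasDerivAt (arctanProfile n) (n * sin (arctanProfile n r) / r) r := by
  have h := ((hasDerivAt_pow n r).arctan).const_mul 2
  refine h.congr_deriv ?_
  rw [arctanProfile, sin_two_mul, mul_assoc 2, mul_comm (sin _),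
    ← Real.tan_mul_cos (cos_arctan_pos _).ne',
    tan_arctan, show (2 : ℝ) * (cos (arctan (r ^ n)) * (r ^ n * cos (arctan (r ^ n))))
      = 2 * r ^ n * cos (arctan (r ^ n)) ^ 2 by ring, cos_sq_arctan]
  rcases Nat.eq_zero_or_pos n with rfl | hn
  · simp
  · have : r ^ n = r ^ (n - 1) * r := by rw [← pow_succ, Nat.sub_add_cancel hn]
    rw [this]
    field_simp

lemma arctanProfile_mem (n : ℕ) {r : ℝ} (hr : 0 < r) : arctanProfile n r ∈ Ioo 0 π := by
  have h1 : 0 < arctan (r ^ n) := Real.arctan_pos.2 (by positivity)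
  have h2 := Real.arctan_lt_pi_div_two (r ^ n)
  exact ⟨by unfold arctanProfile; linarith, by unfold arctanProfile; linarith⟩

lemma continuous_arctanProfile (n : ℕ) : Continuous (arctanProfile n) := by
  unfold arctanProfile
  exact continuous_const.mul (Real.continuous_arctan.comp (continuous_pow n))

lemma hasDerivAt_harmonicIntegral (n : ℕ) {G : ℝ → ℝ} (hG : Continuous G) (r : ℝ) :
    HasDerivAt (harmonicIntegral n G) (G (arctanProfile n r) * r) r := by
  have hc : Continuous fun s => G (arctanProfile n s) * s :=
    (hG.comp (continuous_arctanProfile n)).mul continuous_id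
  exact intervalIntegral.integral_hasDerivAt_right (hc.intervalIntegrable 0 r)
    (hc.stronglyMeasurableAtFilter _ _) hc.continuousAt

lemma hasDerivAt_harmonicWork (n : ℕ) {g G : ℝ → ℝ} (hG : ∀ x, HasDerivAt G (g x) x) {r : ℝ}
    (hr : 0 < r) :
    HasDerivAt (harmonicWork n G)
      (r * g (arctanProfile n r) * (n * sin (arctanProfile n r))) r := by
  have hGc : Continuous G := continuous_iff_continuousAt.2 fun x => (hG x).continuousAt
  have h := ((hasDerivAt_pow 2 r).mul ((hG _).comp r (hasDerivAt_arctanProfile n hr))).sub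
    ((hasDerivAt_harmonicIntegral n hGc r).const_mul 2)
  refine h.congr_deriv ?_
  simp
  field_simp
  ring

lemma continuous_harmonicWork (n : ℕ) {G : ℝ → ℝ} (hG : Continuous G) :
    Continuous (harmonicWork n G) := by
  have h1 : Continuous (harmonicIntegral n G) :=
    continuous_iff_continuousAt.2 fun r => (hasDerivAt_harmonicIntegral n hG r).continuousAt
  have h2 : Continuous fun r => G (arctanProfile n r) := hG.comp (continuous_arctanProfile n)
  exact ((continuous_pow 2).mul h2).sub (h1.const_mul 2)

lemma harmonicWork_zero (n : ℕ) (G : ℝ → ℝ) : harmonicWork n G 0 = 0 := by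
  simp [harmonicWork, harmonicIntegral]

lemma tan_half_pos {x : ℝ} (hx : x ∈ Ioo 0 π) : 0 < tan (x / 2) :=
  tan_pos_of_pos_of_lt_pi_div_two (by linarith [hx.1]) (by linarith [hx.2])

lemma harmonicRadius_pos (n : ℕ) (x : ℝ) : 0 < harmonicRadius n x := exp_pos _

lemma arctanProfile_harmonicRadius {n : ℕ} (hn : 1 ≤ n) {x : ℝ} (hx : x ∈ Ioo 0 π) :
    arctanProfile n (harmonicRadius n x) = x := by
  have hn' : (n : ℝ) ≠ 0 := by positivity
  rw [arctanProfile, harmonicRadius, ← exp_nat_mul, mul_div_cancel₀ _ hn',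
    exp_log (tan_half_pos hx),
    arctan_tan (by linarith [hx.1, pi_pos]) (by linarith [hx.2])]
  ring

lemma hasDerivAt_harmonicRadius {n : ℕ} (hn : 1 ≤ n) {x : ℝ} (hx : x ∈ Ioo 0 π) :
    HasDerivAt (harmonicRadius n) (harmonicRadius n x / (n * sin x)) x := by
  have hc : 0 < cos (x / 2) :=
    cos_pos_of_mem_Ioo ⟨by linarith [hx.1, pi_pos], by linarith [hx.2]⟩
  have hs : 0 < sin (x / 2) :=
    sin_pos_of_pos_of_lt_pi (by linarith [hx.1]) (by linarith [hx.2, pi_pos])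
  have h1 : HasDerivAt (fun x : ℝ => tan (x / 2)) (1 / cos (x / 2) ^ 2 * (1 / 2)) x := by
    have h3 : HasDerivAt (fun x : ℝ => x / 2) (1 / 2) x := (hasDerivAt_id x).div_const 2
    exact (Real.hasDerivAt_tan hc.ne').comp x h3
  have h2 := ((h1.log (tan_half_pos hx).ne').div_const (n : ℝ)).exp
  refine h2.congr_deriv ?_
  have hsx : sin x = 2 * sin (x / 2) * cos (x / 2) := by rw [← sin_two_mul]; congr 1; ring
  have hn' : (n : ℝ) ≠ 0 := by positivity
  rw [hsx, tan_eq_sin_div_cos, harmonicRadius, tan_eq_sin_div_cos]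
  field_simp

lemma tendsto_harmonicRadius {n : ℕ} (hn : 1 ≤ n) :
    Tendsto (harmonicRadius n) (𝓝[>] 0) (𝓝 0) := by
  have hn' : (0 : ℝ) < n := by positivity
  have h1 : Tendsto (fun x : ℝ => tan (x / 2)) (𝓝[>] 0) (𝓝[>] 0) := by
    refine tendsto_nhdsWithin_iff.2 ⟨?_, ?_⟩
    · have : ContinuousAt (fun x : ℝ => tan (x / 2)) 0 := by
        refine ContinuousAt.comp (g := tan) (f := fun x : ℝ => x / 2) ?_ (by fun_prop)
        exact Real.continuousAt_tan.2 (by simp)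
      have h := this.tendsto
      simp only [zero_div, tan_zero] at h
      exact h.mono_left nhdsWithin_le_nhds
    · filter_upwards [Ioo_mem_nhdsGT pi_pos] with x hx
      exact tan_half_pos hx
  exact tendsto_exp_atBot.comp ((tendsto_log_nhdsGT_zero.comp h1).atBot_div_const hn')

section Profile

variable {n : ℕ} {μ ξ L : ℝ} {g G h p : ℝ → ℝ}

lemma IsProfile.hasDerivAt_pohozaev (hP : IsProfile n μ g h p) {r : ℝ} (hr : 0 < r) :
    HasDerivAt (pohozaev n h p) (μ * r * g (h r) * p r) r := by
  have h1 := (((hP.deriv_p r hr).pow 2).sub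
    (((hP.deriv_h r hr).sin.pow 2).const_mul ((n : ℝ) ^ 2))).div_const 2
  refine h1.congr_deriv ?_
  field_simp
  ring

lemma IsProfile.tendsto_pohozaev (hP : IsProfile n μ g h p) :
    Tendsto (pohozaev n h p) (𝓝[>] 0) (𝓝 0) := by
  have h1 : Tendsto (fun r => sin (h r)) (𝓝[>] 0) (𝓝 0) := by
    have := (Real.continuous_sin.tendsto 0).comp hP.lim_h
    rwa [sin_zero] at this
  have := (((hP.lim_p.pow 2).sub ((h1.pow 2).const_mul ((n : ℝ) ^ 2)))).div_const 2
  refine Tendsto.congr (fun r => rfl) (this.trans (by simp))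

lemma IsProfile.pos_of_p_pos (hP : IsProfile n μ g h p) {R : ℝ} (hR : 0 < R)
    (hp : ∀ r ∈ Ioo 0 R, 0 < p r) : 0 < h R :=
  pos_of_tendsto_zero hR hP.lim_h (fun r hr => hP.deriv_h r hr.1)
    fun r hr => div_pos (hp r hr) hr.1

lemma IsProfile.mono_h (hP : IsProfile n μ g h p) {a b : ℝ} (ha : 0 < a) (hab : a ≤ b)
    (hp : ∀ r ∈ Ioo a b, 0 ≤ p r) : h a ≤ h b :=
  le_of_hasDerivAt_nonneg hab (fun r hr => hP.deriv_h r (ha.trans_le hr.1))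
    fun r hr => div_nonneg (hp r hr) (ha.trans hr.1).le

lemma IsProfile.strictMono_h (hP : IsProfile n μ g h p) {a b : ℝ} (ha : 0 < a) (hab : a < b)
    (hp : ∀ r ∈ Ioo a b, 0 < p r) : h a < h b :=
  lt_of_hasDerivAt_pos hab (fun r hr => hP.deriv_h r (ha.trans_le hr.1))
    fun r hr => div_pos (hp r hr) (ha.trans hr.1)

lemma IsProfile.rise_aux (hP : IsProfile n μ g h p) (hg : BistableForce g G ξ L) (hμ : 0 < μ)
    {R : ℝ} (hR : 0 < R) (hp : ∀ r ∈ Ioo 0 R, 0 < p r) (hlt : ∀ r ∈ Ioo 0 R, h r < ξ) :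
    0 < pohozaev n h p R := by
  refine pos_of_tendsto_zero hR hP.tendsto_pohozaev (fun r hr => hP.hasDerivAt_pohozaev hr.1)
    fun r hr => ?_
  have h1 : 0 < h r := hP.pos_of_p_pos hr.1 fun s hs => hp s ⟨hs.1, hs.2.trans hr.2⟩
  have h2 := hg.pos (h r) ⟨h1, hlt r hr⟩
  have h3 := hp r hr
  have h4 := hr.1
  positivity

/-- As long as `h < ξ`, the profile keeps increasing, faster than the harmonic one. -/
lemma IsProfile.rise (hP : IsProfile n μ g h p) (hg : BistableForce g G ξ L) (hμ : 0 < μ)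
    {R : ℝ} (hlt : ∀ r ∈ Ioo 0 R, h r < ξ) :
    ∀ r ∈ Ioc 0 R, 0 < h r ∧ 0 < p r ∧ 0 < pohozaev n h p r := by
  have hpp : ∀ r ∈ Ioc 0 R, 0 < p r := by
    by_contra! hcon
    obtain ⟨s, hs, hs0, hspos⟩ := exists_first_zero
      (fun r hr => (hP.deriv_p r hr).continuousAt) (hP.pos.mono fun r hr => hr.2) hcon
    have := hP.rise_aux hg hμ hs.1 hspos fun r hr => hlt r ⟨hr.1, hr.2.trans_le hs.2⟩
    rw [pohozaev, hs0] at this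
    have h2 : 0 ≤ (n : ℝ) ^ 2 * sin (h s) ^ 2 := by positivity
    linarith
  intro r hr
  have hp' : ∀ s ∈ Ioo 0 r, 0 < p s := fun s hs => hpp s ⟨hs.1, hs.2.le.trans hr.2⟩
  exact ⟨hP.pos_of_p_pos hr.1 hp', hpp r hr,
    hP.rise_aux hg hμ hr.1 hp' fun s hs => hlt s ⟨hs.1, hs.2.trans_le hr.2⟩⟩

lemma IsProfile.unbounded (hP : IsProfile n μ g h p) {c r₀ : ℝ} (hc : 0 < c) (hr₀ : 0 < r₀)
    (hp : ∀ r, r₀ ≤ r → c ≤ p r) (M : ℝ) : ∃ r, r₀ ≤ r ∧ M < h r := by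
  have h1 : ∀ r, r₀ ≤ r → h r₀ - c * log r₀ ≤ h r - c * log r := by
    intro r hr
    refine le_of_hasDerivAt_nonneg (f := fun r => h r - c * log r)
      (f' := fun r => p r / r - c * r⁻¹) hr (fun s hs => ?_) fun s hs => ?_
    · have hs0 := hr₀.trans_le hs.1
      exact (hP.deriv_h s hs0).sub ((Real.hasDerivAt_log hs0.ne').const_mul c)
    · have hs0 := hr₀.trans hs.1
      rw [← div_eq_mul_inv, ← sub_div]
      exact div_nonneg (sub_nonneg.2 (hp s hs.1.le)) hs0.le
  have h2 : Tendsto (fun r => h r₀ - c * log r₀ + c * log r) atTop atTop :=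
    tendsto_atTop_add_const_left _ _ (tendsto_log_atTop.const_mul_atTop hc)
  obtain ⟨r, hr1, hr2⟩ := ((h2.eventually_gt_atTop M).and (eventually_ge_atTop r₀)).exists
  exact ⟨r, hr2, by have := h1 r hr2; linarith⟩

lemma IsProfile.sqrt_le (hp : 0 < p r) {c : ℝ} (hF : c ≤ pohozaev n h p r) : √(2 * c) ≤ p r := by
  apply Real.sqrt_le_iff.2 ⟨hp.le, ?_⟩
  have h2 : 0 ≤ (n : ℝ) ^ 2 * sin (h r) ^ 2 := by positivity
  rw [pohozaev] at hF
  linarith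

/-- Every level up to `ξ` is reached. -/
lemma IsProfile.exists_level (hP : IsProfile n μ g h p) (hg : BistableForce g G ξ L) (hμ : 0 < μ)
    {δ : ℝ} (hδ : δ ∈ Ioc 0 ξ) : ∃ r₀, 0 < r₀ ∧ h r₀ = δ ∧ ∀ r ∈ Ioo 0 r₀, h r < δ := by
  have hex : ∃ r, 0 < r ∧ δ ≤ h r := by
    by_contra! hcon
    have hrise : ∀ r, 0 < r → 0 < h r ∧ 0 < p r ∧ 0 < pohozaev n h p r := fun r hr =>
      hP.rise hg hμ (R := r) (fun s hs => (hcon s hs.1).trans_le hδ.2) r ⟨hr, le_rfl⟩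
    have hF : ∀ r, 1 ≤ r → pohozaev n h p 1 ≤ pohozaev n h p r := by
      intro r hr
      refine le_of_hasDerivAt_nonneg hr
        (fun s hs => hP.hasDerivAt_pohozaev (by linarith [hs.1])) fun s hs => ?_
      have hs0 : 0 < s := by linarith [hs.1]
      have h1 := hg.pos (h s) ⟨(hrise s hs0).1, (hcon s hs0).trans_le hδ.2⟩
      have h2 := (hrise s hs0).2.1
      positivity
    obtain ⟨r, hr, hr2⟩ := hP.unbounded (c := √(2 * pohozaev n h p 1))
      (Real.sqrt_pos.2 (by linarith [(hrise 1 one_pos).2.2])) one_pos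
      (fun r hr => IsProfile.sqrt_le (hrise r (by linarith)).2.1 (hF r hr)) δ
    exact absurd (hcon r (by linarith)) (not_lt.2 hr2.le)
  obtain ⟨r, hr, hle⟩ := hex
  obtain ⟨s, hs, hs0, hsp⟩ := exists_first_zero (f := fun r => δ - h r) (R := r)
    (fun r hr => continuousAt_const.sub (hP.deriv_h r hr).continuousAt)
    ((hP.lim_h.eventually (Iio_mem_nhds hδ.1)).mono fun r hr => sub_pos.2 hr)
    ⟨r, ⟨hr, le_rfl⟩, by linarith⟩
  exact ⟨s, hs.1, by linarith, fun r hr => by linarith [hsp r hr]⟩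

end Profile

/-! ### Comparison with the harmonic profile -/

section Profile

variable {n : ℕ} {μ ξ L : ℝ} {g G h p : ℝ → ℝ}

lemma mul_sin_lt_of_pohozaev_pos {r : ℝ} (hp : 0 < p r) (hF : 0 < pohozaev n h p r) :
    n * sin (h r) < p r := by
  rw [pohozaev] at hF
  refine lt_of_pow_lt_pow_left₀ 2 hp.le ?_
  rw [mul_pow]
  linarith

lemma IsProfile.p_pos_of_pohozaev_pos (hP : IsProfile n μ g h p) {R : ℝ}
    (hF : ∀ r ∈ Ioo 0 R, 0 < pohozaev n h p r) : ∀ r ∈ Ioo 0 R, 0 < p r := by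
  by_contra! hc
  obtain ⟨r, hr, hr2⟩ := hc
  obtain ⟨s, hs, hs0, -⟩ := exists_first_zero (R := r)
    (fun r hr => (hP.deriv_p r hr).continuousAt) (hP.pos.mono fun r hr => hr.2)
    ⟨r, ⟨hr.1, le_rfl⟩, hr2⟩
  have := hF s ⟨hs.1, hs.2.trans_lt hr.2⟩
  rw [pohozaev, hs0] at this
  have h2 : 0 ≤ (n : ℝ) ^ 2 * sin (h s) ^ 2 := by positivity
  linarith

/-- While the Pohozaev quantity is positive, the profile climbs faster than the harmonic profile,
so the ratio of the harmonic radius of `h(r)` to `r` increases. -/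
lemma IsProfile.ratio_lt (hP : IsProfile n μ g h p) (hn : 1 ≤ n) {a b : ℝ} (ha : 0 < a)
    (hab : a < b) (hm : ∀ r ∈ Icc a b, h r ∈ Ioo 0 π) (hp : ∀ r ∈ Ioo a b, 0 < p r)
    (hF : ∀ r ∈ Ioo a b, 0 < pohozaev n h p r) :
    harmonicRadius n (h a) / a < harmonicRadius n (h b) / b := by
  have hn' : (0 : ℝ) < n := by positivity
  refine lt_of_hasDerivAt_pos (f := fun r => harmonicRadius n (h r) / r) hab
    (fun r hr => (((hasDerivAt_harmonicRadius hn (hm r hr)).comp r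
      (hP.deriv_h r (ha.trans_le hr.1))).div (hasDerivAt_id r) (ha.trans_le hr.1).ne')) ?_
  intro r hr
  have hr0 : 0 < r := ha.trans hr.1
  have hmr := hm r ⟨hr.1.le, hr.2.le⟩
  have hs : 0 < sin (h r) := sin_pos_of_pos_of_lt_pi hmr.1 hmr.2
  have h1 := mul_sin_lt_of_pohozaev_pos (hp r hr) (hF r hr)
  have h2 := harmonicRadius_pos n (h r)
  have h3 : harmonicRadius n (h r) / (n * sin (h r)) * (p r / r) * r - harmonicRadius n (h r)
      = harmonicRadius n (h r) * (p r - n * sin (h r)) / (n * sin (h r)) := by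
    field_simp
  simp only [Function.comp, mul_one]
  rw [h3]
  have h4 : 0 < p r - n * sin (h r) := sub_pos.2 h1
  positivity

/-- The Pohozaev quantity minus `μ C` times the harmonic work at the harmonic radius `σ` of `h(r)`.
Where `p > 0`, the sign of the derivative is that of `((r / σ)² - C) g(h)`; since `r / σ` decreases
(`IsProfile.ratio_lt`) and `g` changes sign at `ξ`, the choice `C = (r / σ)²` at `h = ξ` makes the
difference increase. -/
lemma IsProfile.hasDerivAt_excess (hP : IsProfile n μ g h p) (hg : BistableForce g G ξ L)
    (hn : 1 ≤ n) (C : ℝ) {r : ℝ} (hr : 0 < r) (hm : h r ∈ Ioo 0 π) :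
    HasDerivAt (fun r => pohozaev n h p r - μ * C * harmonicWork n G (harmonicRadius n (h r)))
      (μ * (r ^ 2 - C * harmonicRadius n (h r) ^ 2) * g (h r) * p r / r) r := by
  have hn' : (n : ℝ) ≠ 0 := by positivity
  have hs : sin (h r) ≠ 0 := (sin_pos_of_pos_of_lt_pi hm.1 hm.2).ne'
  have h1 := (hasDerivAt_harmonicRadius hn hm).comp r (hP.deriv_h r hr)
  have h2 := (hasDerivAt_harmonicWork n hg.prim (harmonicRadius_pos n (h r))).comp r h1
  rw [arctanProfile_harmonicRadius hn hm] at h2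
  have h3 := (hP.hasDerivAt_pohozaev hr).sub (h2.const_mul (μ * C))
  refine h3.congr_deriv ?_
  field_simp

/-- Below the level `ξ`, the Pohozaev quantity exceeds the rescaled work of `g` along the harmonic
profile through the same point. -/
lemma IsProfile.work_lt_pohozaev (hP : IsProfile n μ g h p) (hg : BistableForce g G ξ L)
    (hμ : 0 < μ) (hn : 1 ≤ n) {r₀ : ℝ} (hr₀ : 0 < r₀) (hlt : ∀ r ∈ Ioo 0 r₀, h r < ξ)
    (hle : h r₀ ≤ ξ) :
    μ * (r₀ / harmonicRadius n (h r₀)) ^ 2 * harmonicWork n G (harmonicRadius n (h r₀))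
      < pohozaev n h p r₀ := by
  have hrise := hP.rise hg hμ hlt
  have hm : ∀ r ∈ Ioc 0 r₀, h r ∈ Ioo 0 π := by
    intro r hr
    refine ⟨(hrise r hr).1, ?_⟩
    rcases hr.2.eq_or_lt with h1 | h1
    · rw [h1]; exact hle.trans_lt hg.mem.2
    · exact (hlt r ⟨hr.1, h1⟩).trans hg.mem.2
  set C := (r₀ / harmonicRadius n (h r₀)) ^ 2 with hC
  have hlim : Tendsto (fun r => pohozaev n h p r
      - μ * C * harmonicWork n G (harmonicRadius n (h r))) (𝓝[>] 0) (𝓝 0) := by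
    have h1 : Tendsto h (𝓝[>] 0) (𝓝[>] 0) :=
      tendsto_nhdsWithin_iff.2 ⟨hP.lim_h, hP.pos.mono fun r hr => hr.1⟩
    have h2 := (continuous_harmonicWork n hg.continuous_prim).tendsto 0
    rw [harmonicWork_zero] at h2
    have h3 := h2.comp ((tendsto_harmonicRadius hn).comp h1)
    have h4 := hP.tendsto_pohozaev.sub (h3.const_mul (μ * C))
    refine Tendsto.congr (fun r => rfl) (h4.trans (by simp))
  have := pos_of_tendsto_zero hr₀ hlim
    (fun r hr => hP.hasDerivAt_excess hg hn C hr.1 (hm r hr)) (fun r hr => ?_)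
  · linarith
  · have hr' : r ∈ Ioc 0 r₀ := ⟨hr.1, hr.2.le⟩
    have h1 := hP.ratio_lt hn hr.1 hr.2 (fun s hs => hm s ⟨hr.1.trans_le hs.1, hs.2⟩)
      (fun s hs => (hrise s ⟨hr.1.trans hs.1, hs.2.le⟩).2.1)
      (fun s hs => (hrise s ⟨hr.1.trans hs.1, hs.2.le⟩).2.2)
    have hs0 := harmonicRadius_pos n (h r₀)
    have hs1 := harmonicRadius_pos n (h r)
    have hr0 := hr.1
    rw [div_lt_div_iff₀ hr.1 hr₀] at h1
    have h2 : r₀ / harmonicRadius n (h r₀) * harmonicRadius n (h r) < r := by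
      rw [div_mul_eq_mul_div, div_lt_iff₀ hs0]
      linarith
    have h3 : 0 < r ^ 2 - C * harmonicRadius n (h r) ^ 2 := by
      rw [hC, ← mul_pow, sub_pos]
      exact pow_lt_pow_left₀ h2 (by positivity) two_ne_zero
    have h4 := hg.pos (h r) ⟨(hrise r hr').1, hlt r hr⟩
    have h5 := (hrise r hr').2.1
    positivity

/-- Above the level `ξ`, the excess of the Pohozaev quantity over the rescaled harmonic work keeps
increasing. -/
lemma IsProfile.excess_mono (hP : IsProfile n μ g h p) (hg : BistableForce g G ξ L)
    (hμ : 0 < μ) (hn : 1 ≤ n) {r₀ R : ℝ} (hr₀ : 0 < r₀) (hR : r₀ ≤ R) (h0 : h r₀ = ξ)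
    (hm : ∀ r ∈ Icc r₀ R, h r < π) (hp : ∀ r ∈ Ioo r₀ R, 0 < p r)
    (hF : ∀ r ∈ Ioo r₀ R, 0 < pohozaev n h p r) :
    pohozaev n h p r₀ - μ * (r₀ / harmonicRadius n ξ) ^ 2 * harmonicWork n G (harmonicRadius n ξ)
      ≤ pohozaev n h p R - μ * (r₀ / harmonicRadius n ξ) ^ 2 *
        harmonicWork n G (harmonicRadius n (h R)) := by
  have hge : ∀ r ∈ Icc r₀ R, ξ ≤ h r := by
    intro r hr
    rw [← h0]
    exact hP.mono_h hr₀ hr.1 fun s hs => (hp s ⟨hs.1, hs.2.trans_le hr.2⟩).le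
  have hm' : ∀ r ∈ Icc r₀ R, h r ∈ Ioo 0 π := fun r hr =>
    ⟨hg.mem.1.trans_le (hge r hr), hm r hr⟩
  have key := le_of_hasDerivAt_nonneg hR (fun r hr => hP.hasDerivAt_excess hg hn
    ((r₀ / harmonicRadius n ξ) ^ 2) (hr₀.trans_le hr.1) (hm' r hr)) (fun r hr => ?_)
  · rw [h0] at key
    exact key
  · have hr0 : 0 < r := hr₀.trans hr.1
    have h1 := hP.ratio_lt hn hr₀ hr.1 (fun s hs => hm' s ⟨hs.1, hs.2.trans hr.2.le⟩)
      (fun s hs => hp s ⟨hs.1, hs.2.trans hr.2⟩) (fun s hs => hF s ⟨hs.1, hs.2.trans hr.2⟩)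
    rw [h0, div_lt_div_iff₀ hr₀ hr0] at h1
    have hs0 := harmonicRadius_pos n ξ
    have hs1 := harmonicRadius_pos n (h r)
    have h2 : r ≤ r₀ / harmonicRadius n ξ * harmonicRadius n (h r) := by
      rw [div_mul_eq_mul_div, le_div_iff₀ hs0]
      linarith
    have h3 : r ^ 2 - (r₀ / harmonicRadius n ξ) ^ 2 * harmonicRadius n (h r) ^ 2 ≤ 0 := by
      rw [← mul_pow, sub_nonpos]
      exact pow_le_pow_left₀ hr0.le h2 2
    have h4 := hg.nonpos (x := h r) ⟨hge r ⟨hr.1.le, hr.2.le⟩, (hm' r ⟨hr.1.le, hr.2.le⟩).2.le⟩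
    have h5 := hp r hr
    exact div_nonneg (mul_nonneg (by
      rw [mul_assoc]
      exact mul_nonneg hμ.le (mul_nonneg_of_nonpos_of_nonpos h3 h4)) h5.le) hr0.le

/-- Necessity: if a profile stays in `(0, π)`, the integral of `G` along the harmonic profile is
eventually positive. Otherwise the Pohozaev quantity would stay bounded below by a positive
constant and the profile would cross `π`. -/
theorem IsProfile.exists_harmonicIntegral_pos (hP : IsProfile n μ g h p)
    (hg : BistableForce g G ξ L) (hμ : 0 < μ) (hn : 1 ≤ n)
    (hm : ∀ r, 0 < r → h r < π) :
    ∃ s, 0 < s ∧ ξ ≤ arctanProfile n s ∧ 0 < harmonicIntegral n G s := by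
  by_contra! hcon
  obtain ⟨r₀, hr₀, h0, hlt⟩ := hP.exists_level hg hμ ⟨hg.mem.1, le_rfl⟩
  have hrise := hP.rise hg hμ hlt
  have hD0 := hP.work_lt_pohozaev hg hμ hn hr₀ hlt h0.le
  rw [h0] at hD0
  set C := (r₀ / harmonicRadius n ξ) ^ 2 with hC
  set D := pohozaev n h p r₀ - μ * C * harmonicWork n G (harmonicRadius n ξ) with hD
  have hDpos : 0 < D := sub_pos.2 hD0
  have hwork : ∀ x, x ∈ Ico ξ π → 0 ≤ harmonicWork n G (harmonicRadius n x) := by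
    intro x hx
    have hx' : x ∈ Ioo 0 π := ⟨hg.mem.1.trans_le hx.1, hx.2⟩
    have h1 := hcon (harmonicRadius n x) (harmonicRadius_pos n x)
      (by rw [arctanProfile_harmonicRadius hn hx']; exact hx.1)
    have h2 := hg.prim_nonneg ⟨hx.1, hx.2.le⟩
    rw [harmonicWork, arctanProfile_harmonicRadius hn hx']
    nlinarith [mul_nonneg (sq_nonneg (harmonicRadius n x)) h2]
  have hbelow : ∀ R, r₀ ≤ R → (∀ r ∈ Ioo 0 R, 0 < pohozaev n h p r) → D ≤ pohozaev n h p R := by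
    intro R hR hF
    have hp' := hP.p_pos_of_pohozaev_pos hF
    have h1 := hP.excess_mono hg hμ hn hr₀ hR h0 (fun r hr => hm r (hr₀.trans_le hr.1))
      (fun r hr => hp' r ⟨hr₀.trans hr.1, hr.2⟩) (fun r hr => hF r ⟨hr₀.trans hr.1, hr.2⟩)
    have h2 : ξ ≤ h R := by
      rw [← h0]
      exact hP.mono_h hr₀ hR fun s hs => (hp' s ⟨hr₀.trans hs.1, hs.2⟩).le
    have h3 := hwork (h R) ⟨h2, hm R (hr₀.trans_le hR)⟩
    have h4 : 0 ≤ μ * C * harmonicWork n G (harmonicRadius n (h R)) := by positivity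
    linarith
  have hF : ∀ r, 0 < r → 0 < pohozaev n h p r := by
    by_contra! hc
    obtain ⟨R, hR, hR2⟩ := hc
    obtain ⟨s, hs, hs0, hspos⟩ := exists_first_zero (f := pohozaev n h p) (R := R)
      (fun r hr => (hP.hasDerivAt_pohozaev hr).continuousAt) (by
        filter_upwards [Ioo_mem_nhdsGT hr₀] with r hr
        exact (hrise r ⟨hr.1, hr.2.le⟩).2.2) ⟨R, ⟨hR, le_rfl⟩, hR2⟩
    rcases le_or_gt s r₀ with h1 | h1
    · have := (hrise s ⟨hs.1, h1⟩).2.2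
      linarith
    · have := hbelow s h1.le hspos
      linarith
  have hp : ∀ r, 0 < r → 0 < p r := fun r hr =>
    hP.p_pos_of_pohozaev_pos (R := r + 1) (fun s hs => hF s hs.1) r ⟨hr, by linarith⟩
  obtain ⟨r, hr, hr2⟩ := hP.unbounded (c := √(2 * D)) (Real.sqrt_pos.2 (by linarith)) hr₀
    (fun r hr => IsProfile.sqrt_le (hp r (hr₀.trans_le hr))
      (hbelow r hr fun s hs => hF s hs.1)) π
  exact absurd (hm r (hr₀.trans_le hr)) (not_lt.2 hr2.le)

/-! ### Profiles that never turn and never cross `π` -/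

lemma IsProfile.pos_of_p_nonneg (hP : IsProfile n μ g h p) {R : ℝ} (hR : 0 < R)
    (hp : ∀ r ∈ Ioo 0 R, 0 ≤ p r) : 0 < h R := by
  obtain ⟨s, hs, hsR⟩ := (hP.pos.and (Ioo_mem_nhdsGT hR)).exists
  exact hs.1.trans_le (hP.mono_h hsR.1 hsR.2.le fun t ht => hp t ⟨hsR.1.trans ht.1, ht.2⟩)

/-- A profile that stays below `π` and never turns tends to `π`: below a level `π - ε` the force
`μ r² g(h)` would eventually dominate and drive `p` to `-∞`. -/
theorem IsProfile.tendsto_pi (hP : IsProfile n μ g h p) (hg : BistableForce g G ξ L)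
    (hμ : 0 < μ) (hm : ∀ r, 0 < r → h r < π) (hp : ∀ r, 0 < r → 0 ≤ p r) :
    Tendsto h atTop (𝓝 π) := by
  obtain ⟨r₀, hr₀, h0, hlt⟩ := hP.exists_level hg hμ ⟨hg.mem.1, le_rfl⟩
  have hmono : ∀ a b, 0 < a → a ≤ b → h a ≤ h b := fun a b ha hab =>
    hP.mono_h ha hab fun s hs => hp s (ha.trans hs.1)
  have hp0 : 0 < p r₀ := (hP.rise hg hμ hlt r₀ ⟨hr₀, le_rfl⟩).2.1
  -- `h` passes the level `ξ` with positive speed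
  obtain ⟨r₁, hr₁, h1⟩ : ∃ r₁, r₀ < r₁ ∧ ξ < h r₁ := by
    obtain ⟨ε, hε, hball⟩ := Metric.eventually_nhds_iff.1
      ((hP.deriv_p r₀ hr₀).continuousAt.eventually (Ioi_mem_nhds hp0))
    refine ⟨r₀ + ε / 2, by linarith, ?_⟩
    rw [← h0]
    refine hP.strictMono_h hr₀ (by linarith) fun s hs => hball ?_
    rw [Real.dist_eq, abs_of_pos (by linarith [hs.1])]
    linarith [hs.2]
  have hr₁0 : 0 < r₁ := hr₀.trans hr₁
  rw [Metric.tendsto_atTop]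
  intro ε hε
  by_contra! hcon
  have hub : ∀ r, 0 < r → h r ≤ π - ε := by
    intro r hr
    obtain ⟨s, hs, hs2⟩ := hcon r
    rw [Real.dist_eq, abs_sub_comm, abs_of_pos (sub_pos.2 (hm s (hr.trans_le hs)))] at hs2
    have := hmono r s hr hs
    linarith
  -- on `[h r₁, π - ε]` the force is bounded away from zero
  obtain ⟨x₀, hx₀, hmax⟩ := isCompact_Icc.exists_isMaxOn (s := Icc (h r₁) (π - ε))
    ⟨h r₁, le_rfl, hub r₁ hr₁0⟩ hg.continuous.continuousOn
  have hη : g x₀ < 0 := hg.neg x₀ ⟨h1.trans_le hx₀.1, by linarith [hx₀.2]⟩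
  have hforce : ∀ r, r₁ ≤ r → g (h r) ≤ g x₀ := fun r hr =>
    hmax ⟨hmono r₁ r hr₁0 hr, hub r (hr₁0.trans_le hr)⟩
  obtain ⟨r₂, hr₂, hr₂'⟩ : ∃ r₂, r₁ ≤ r₂ ∧ ∀ r, r₂ ≤ r →
      n ^ 2 + 1 ≤ μ * r ^ 2 * (-g x₀) := by
    have ht : Tendsto (fun r : ℝ => μ * r ^ 2 * (-g x₀)) atTop atTop :=
      ((tendsto_pow_atTop two_ne_zero).const_mul_atTop hμ).atTop_mul_const (by linarith)
    obtain ⟨r₂, hr₂⟩ := ((ht.eventually_ge_atTop ((n : ℝ) ^ 2 + 1)).and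
      (eventually_ge_atTop r₁)).exists_forall_of_atTop
    exact ⟨r₂, (hr₂ r₂ le_rfl).2, fun r hr => (hr₂ r hr).1⟩
  have hr₂0 : 0 < r₂ := hr₁0.trans_le hr₂
  have hdec : ∀ r, r₂ ≤ r → p r + log r ≤ p r₂ + log r₂ := by
    intro r hr
    have := le_of_hasDerivAt_nonneg (f := fun r => -(p r + log r)) hr
      (fun s hs => ((hP.deriv_p s (hr₂0.trans_le hs.1)).add
        (Real.hasDerivAt_log (hr₂0.trans_le hs.1).ne')).neg) (fun s hs => ?_)
    · linarith
    · have hs0 := hr₂0.trans hs.1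
      have e1 := hforce s (hr₂.trans hs.1.le)
      have e2 := hr₂' s hs.1.le
      have e3 : μ * s ^ 2 * g (h s) ≤ μ * s ^ 2 * g x₀ := by gcongr
      have e4 : sin (h s) * cos (h s) ≤ 1 := by
        nlinarith [sin_sq_add_cos_sq (h s), sq_nonneg (sin (h s) - cos (h s))]
      have e5 : (n : ℝ) ^ 2 * (sin (h s) * cos (h s)) ≤ n ^ 2 * 1 := by gcongr
      rw [inv_eq_one_div, ← add_div, neg_nonneg]
      exact div_nonpos_of_nonpos_of_nonneg (by linarith) hs0.le
  obtain ⟨r, hr1, hr2⟩ := ((tendsto_log_atTop.eventually_gt_atTop (p r₂ + log r₂)).and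
    (eventually_ge_atTop r₂)).exists
  have := hdec r hr2
  have := hp r (hr₂0.trans_le hr2)
  linarith

/-- The derivative of a profile cannot have a vanishing minimum above the level `ξ`: there the
second derivative of `p` would be `2 μ g(h) < 0`. -/
lemma IsProfile.not_flat (hP : IsProfile n μ g h p) (hg : BistableForce g G ξ L) (hμ : 0 < μ)
    {s : ℝ} (hs : 0 < s) (hps : p s = 0) (hm : h s ∈ Ioo ξ π) (hmin : ∀ᶠ r in 𝓝 s, 0 ≤ p r) :
    False := by
  have h1 := hP.deriv_p s hs
  have h2 : (n ^ 2 * (sin (h s) * cos (h s)) + μ * s ^ 2 * g (h s)) / s = 0 := by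
    refine IsLocalMin.hasDerivAt_eq_zero (f := p) ?_ h1
    filter_upwards [hmin] with r hr
    rw [hps]
    exact hr
  have hA : n ^ 2 * (sin (h s) * cos (h s)) + μ * s ^ 2 * g (h s) = 0 := by
    rcases div_eq_zero_iff.1 h2 with h3 | h3
    · exact h3
    · exact absurd h3 hs.ne'
  have hh : HasDerivAt h 0 s := by
    have := hP.deriv_h s hs
    rwa [hps, zero_div] at this
  have hgd : HasDerivAt (fun r => g (h r)) 0 s := by
    have := (hg.diff (h s) ⟨(hg.mem.1.trans hm.1).le, hm.2⟩).hasDerivAt.comp s hh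
    simpa [Function.comp_def] using this
  have hA' : HasDerivAt (fun r => (n ^ 2 * (sin (h r) * cos (h r)) + μ * r ^ 2 * g (h r)) / r)
      (2 * μ * g (h s)) s := by
    have h3 := ((((hh.sin.mul hh.cos).const_mul ((n : ℝ) ^ 2)).add
      (((hasDerivAt_pow 2 s).const_mul μ).mul hgd)).div (hasDerivAt_id s) hs.ne')
    refine h3.congr_deriv ?_
    simp only [Pi.add_apply, Pi.mul_apply, id, hA, mul_zero, zero_mul, sub_zero]
    field_simp
    push_cast
    ring
  have hde : deriv p =ᶠ[𝓝 s]
      fun r => (n ^ 2 * (sin (h r) * cos (h r)) + μ * r ^ 2 * g (h r)) / r := by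
    filter_upwards [Ioi_mem_nhds hs] with r hr
    exact (hP.deriv_p r hr).deriv
  have hdd : deriv (deriv p) s = 2 * μ * g (h s) := by
    rw [hde.deriv_eq, hA'.deriv]
  have hneg : deriv (deriv p) s < 0 := by
    rw [hdd]
    have := hg.neg (h s) hm
    nlinarith
  have hmax := isLocalMax_of_deriv_deriv_neg hneg (by rw [h1.deriv, h2]) h1.continuousAt
  have hz : p =ᶠ[𝓝 s] fun _ => (0 : ℝ) := by
    filter_upwards [hmax, hmin] with r hr hr2
    rw [hps] at hr
    exact le_antisymm hr hr2
  have : deriv (deriv p) s = 0 := by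
    have h3 : deriv p =ᶠ[𝓝 s] deriv fun _ => (0 : ℝ) := hz.deriv
    rw [h3.deriv_eq]
    simp
  linarith

end Profile

/-- Uniqueness for the profile equation on `(0, ∞)`, forwards and backwards, by a Gronwall estimate
for `E = (h - k)² + (p - q)²`. -/
lemma eq_of_eq_at {n : ℕ} {μ L : ℝ} {g h p k q : ℝ → ℝ} (hμ : 0 ≤ μ) (hL : 0 ≤ L)
    (hgL : ∀ x y, |g x - g y| ≤ L * |x - y|)
    (hh : ∀ r, 0 < r → HasDerivAt h (p r / r) r)
    (hp : ∀ r, 0 < r →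
      HasDerivAt p ((n ^ 2 * (sin (h r) * cos (h r)) + μ * r ^ 2 * g (h r)) / r) r)
    (hk : ∀ r, 0 < r → HasDerivAt k (q r / r) r)
    (hq : ∀ r, 0 < r →
      HasDerivAt q ((n ^ 2 * (sin (k r) * cos (k r)) + μ * r ^ 2 * g (k r)) / r) r)
    {s : ℝ} (hs : 0 < s) (h1 : h s = k s) (h2 : p s = q s) {r : ℝ} (hr : 0 < r) : h r = k r := by
  set E : ℝ → ℝ := fun r => (h r - k r) ^ 2 + (p r - q r) ^ 2 with hE
  set E' : ℝ → ℝ := fun r => 2 * (h r - k r) * (p r / r - q r / r) + 2 * (p r - q r) *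
    ((n ^ 2 * (sin (h r) * cos (h r)) + μ * r ^ 2 * g (h r)) / r
      - (n ^ 2 * (sin (k r) * cos (k r)) + μ * r ^ 2 * g (k r)) / r) with hE'
  have hEd : ∀ r, 0 < r → HasDerivAt E (E' r) r := by
    intro r hr
    have := (((hh r hr).sub (hk r hr)).pow 2).add (((hp r hr).sub (hq r hr)).pow 2)
    refine this.congr_deriv ?_
    simp [hE']
  have hEs : E s = 0 := by simp [hE, h1, h2]
  have hEnn : ∀ r, 0 ≤ E r := fun r => by positivity
  set a := min s r with ha
  set b := max s r with hb
  have ha0 : 0 < a := lt_min hs hr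
  set C := (1 + 3 * n ^ 2 + μ * b ^ 2 * L) / a with hC
  have hbound : ∀ x ∈ Icc a b, |E' x| ≤ C * E x := by
    intro x hx
    have hx0 : 0 < x := ha0.trans_le hx.1
    set dh := |h x - k x| with hdh
    set dp := |p x - q x| with hdp
    have e1 : |sin (h x) * cos (h x) - sin (k x) * cos (k x)| ≤ 3 * dh := by
      have := abs_sinCos_sub_le_two (h x) (k x)
      calc _ = |((sin (h x) * cos (h x) - h x) - (sin (k x) * cos (k x) - k x)) + (h x - k x)| := by
            congr 1; ring
        _ ≤ _ := abs_add_le _ _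
        _ ≤ _ := by rw [← hdh] at *; linarith
    have e2 := hgL (h x) (k x)
    have e3 : |n ^ 2 * (sin (h x) * cos (h x) - sin (k x) * cos (k x))
        + μ * x ^ 2 * (g (h x) - g (k x))| ≤ (3 * n ^ 2 + μ * b ^ 2 * L) * dh := by
      refine (abs_add_le _ _).trans ?_
      rw [abs_mul, abs_mul, abs_of_nonneg (by positivity : (0 : ℝ) ≤ (n : ℝ) ^ 2),
        abs_of_nonneg (by positivity : (0 : ℝ) ≤ μ * x ^ 2)]
      have e4 : (n : ℝ) ^ 2 * |sin (h x) * cos (h x) - sin (k x) * cos (k x)|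
          ≤ n ^ 2 * (3 * dh) := by gcongr
      have e5 : μ * x ^ 2 * |g (h x) - g (k x)| ≤ μ * b ^ 2 * (L * dh) := by
        gcongr
        exact hx.2
      linarith
    have e6 : E' x = (2 * (h x - k x) * (p x - q x) + 2 * (p x - q x) *
        (n ^ 2 * (sin (h x) * cos (h x) - sin (k x) * cos (k x))
        + μ * x ^ 2 * (g (h x) - g (k x)))) / x := by
      rw [hE']
      field_simp
      ring
    have e7 : |2 * (h x - k x) * (p x - q x) + 2 * (p x - q x) *
        (n ^ 2 * (sin (h x) * cos (h x) - sin (k x) * cos (k x))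
        + μ * x ^ 2 * (g (h x) - g (k x)))| ≤ (1 + 3 * n ^ 2 + μ * b ^ 2 * L) * E x := by
      refine (abs_add_le _ _).trans ?_
      rw [abs_mul, abs_mul, abs_mul, abs_mul, abs_two, ← hdh, ← hdp]
      have e8 : 2 * dp * |n ^ 2 * (sin (h x) * cos (h x) - sin (k x) * cos (k x))
        + μ * x ^ 2 * (g (h x) - g (k x))| ≤ 2 * dp * ((3 * n ^ 2 + μ * b ^ 2 * L) * dh) := by
        gcongr
      have e9 : E x = dh ^ 2 + dp ^ 2 := by simp [hE, hdh, hdp]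
      have e10 : 2 * dh * dp ≤ E x := by rw [e9]; nlinarith [sq_nonneg (dh - dp)]
      have e11 : 0 ≤ 3 * (n : ℝ) ^ 2 + μ * b ^ 2 * L := by positivity
      nlinarith [mul_le_mul_of_nonneg_left e10 e11]
    rw [e6, abs_div, abs_of_pos hx0, hC, div_mul_eq_mul_div]
    have : 0 ≤ (1 + 3 * n ^ 2 + μ * b ^ 2 * L) * E x := by
      have := hEnn x
      positivity
    exact div_le_div₀ this e7 ha0 hx.1
  have hexp : ∀ c x : ℝ, HasDerivAt (fun x => exp (c * x)) (exp (c * x) * c) x := fun c x => by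
    simpa using ((hasDerivAt_id x).const_mul c).exp
  have hEr : E r ≤ 0 := by
    rcases le_total s r with hsr | hsr
    · have e := le_of_hasDerivAt_nonneg (f := fun x => -(E x * exp (-C * x))) hsr
        (fun x hx => ((hEd x (hs.trans_le hx.1)).mul (hexp (-C) x)).neg) (fun x hx => by
          have := (abs_le.1 (hbound x ⟨(min_le_left _ _).trans hx.1.le,
            hx.2.le.trans (le_max_right _ _)⟩)).2
          have := exp_pos (-C * x)
          nlinarith)
      simp only [hEs, zero_mul, neg_zero] at e
      have := exp_pos (-C * r)
      by_contra! hc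
      have := mul_pos hc this
      linarith
    · have e := le_of_hasDerivAt_nonneg (f := fun x => E x * exp (C * x)) hsr
        (fun x hx => ((hEd x (hr.trans_le hx.1)).mul (hexp C x))) (fun x hx => by
          have := (abs_le.1 (hbound x ⟨(min_le_right _ _).trans hx.1.le,
            hx.2.le.trans (le_max_left _ _)⟩)).1
          have := exp_pos (C * x)
          nlinarith)
      simp only [hEs, zero_mul] at e
      have := exp_pos (C * r)
      by_contra! hc
      have := mul_pos hc this
      linarith
  have : (h r - k r) ^ 2 ≤ 0 := by
    have := sq_nonneg (p r - q r)
    simp only [hE] at hEr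
    linarith
  have h3 := pow_eq_zero_iff (two_ne_zero) |>.1 (le_antisymm this (sq_nonneg _))
  linarith

/-! ### The two shooting alternatives -/

section Profile

variable {n : ℕ} {μ ξ L : ℝ} {g G h p : ℝ → ℝ}

/-- A profile with `p > 0` up to a point where `h = π` exceeds `π` shortly afterwards. -/
lemma IsProfile.exists_gt_pi (hP : IsProfile n μ g h p) {s : ℝ} (hs : 0 < s) (hπ : h s = π)
    (hp : ∀ r ∈ Ioc 0 s, 0 < p r) : ∃ r, 0 < r ∧ (∀ t ∈ Ioc 0 r, 0 < p t) ∧ π < h r := by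
  obtain ⟨ε, hε, hball⟩ := Metric.eventually_nhds_iff.1
    ((hP.deriv_p s hs).continuousAt.eventually (Ioi_mem_nhds (hp s ⟨hs, le_rfl⟩)))
  have hp' : ∀ t ∈ Ioc 0 (s + ε / 2), 0 < p t := by
    intro t ht
    rcases le_or_gt t s with h1 | h1
    · exact hp t ⟨ht.1, h1⟩
    · refine hball ?_
      rw [Real.dist_eq, abs_of_pos (by linarith)]
      linarith [ht.2]
  refine ⟨s + ε / 2, by linarith, hp', ?_⟩
  rw [← hπ]
  exact hP.strictMono_h hs (by linarith) fun t ht => hp' t ⟨hs.trans ht.1, ht.2.le⟩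

/-- A profile for which neither shooting alternative occurs stays in `(0, π)` and never turns. -/
lemma IsProfile.trapped (hP : IsProfile n μ g h p) (hg : BistableForce g G ξ L) (hμ : 0 < μ)
    (hup : ∀ r, 0 < r → (∀ s ∈ Ioc 0 r, 0 < p s) → h r ≤ π)
    (hdown : ∀ r, 0 < r → (∀ s ∈ Ioc 0 r, h s < π) → 0 ≤ p r) :
    ∀ r, 0 < r → 0 < h r ∧ h r < π ∧ 0 ≤ p r := by
  have hlt : ∀ r, 0 < r → h r < π := by
    by_contra! hc
    obtain ⟨R, hR, hRπ⟩ := hc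
    obtain ⟨s, hs, hs0, hsp⟩ := exists_first_zero (f := fun r => π - h r) (R := R)
      (fun r hr => continuousAt_const.sub (hP.deriv_h r hr).continuousAt)
      ((hP.lim_h.eventually (Iio_mem_nhds pi_pos)).mono fun r hr => sub_pos.2 hr)
      ⟨R, ⟨hR, le_rfl⟩, by linarith⟩
    have hsπ : h s = π := by linarith
    have hbelow : ∀ r ∈ Ioo 0 s, h r < π := fun r hr => by linarith [hsp r hr]
    have hpn : ∀ r ∈ Ioo 0 s, 0 ≤ p r := fun r hr =>
      hdown r hr.1 fun t ht => hbelow t ⟨ht.1, ht.2.trans_lt hr.2⟩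
    have hps : 0 ≤ p s := by
      refine ge_of_tendsto ((hP.deriv_p s hs.1).continuousAt.continuousWithinAt (s := Iio s)) ?_
      filter_upwards [Ioo_mem_nhdsLT hs.1] with r hr
      exact hpn r hr
    have hps' : 0 < p s := by
      refine lt_of_le_of_ne hps fun h0 => ?_
      have hz : HasDerivAt (fun _ : ℝ => π) 0 s := hasDerivAt_const _ _
      have := eq_of_eq_at (k := fun _ => π) (q := fun _ => 0) hμ.le hg.lip_nonneg hg.lip
        hP.deriv_h hP.deriv_p (fun r _ => by simpa using hasDerivAt_const r π)
        (fun r _ => by simpa [hg.at_pi] using hasDerivAt_const r (0 : ℝ)) hs.1 hsπ h0.symm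
        (half_pos hs.1)
      have h2 := hbelow (s / 2) ⟨half_pos hs.1, half_lt_self hs.1⟩
      linarith
    have hpp : ∀ r ∈ Ioc 0 s, 0 < p r := by
      by_contra! hc
      obtain ⟨t, ht, ht0, htp⟩ := exists_first_zero (fun r hr => (hP.deriv_p r hr).continuousAt)
        (hP.pos.mono fun r hr => hr.2) hc
      have hts : t < s := lt_of_le_of_ne ht.2 fun h0 => by rw [h0] at ht0; linarith
      have hξ : ξ < h t := by
        by_contra! hle
        have := hP.rise hg hμ (R := t) (fun r hr =>
          (hP.strictMono_h hr.1 hr.2 fun u hu => htp u ⟨hr.1.trans hu.1, hu.2⟩).trans_le hle)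
          t ⟨ht.1, le_rfl⟩
        linarith [this.2.1]
      refine hP.not_flat hg hμ ht.1 ht0 ⟨hξ, hbelow t ⟨ht.1, hts⟩⟩ ?_
      filter_upwards [Ioo_mem_nhds ht.1 hts] with r hr
      exact hpn r hr
    obtain ⟨r, hr, hrp, hrπ⟩ := hP.exists_gt_pi hs.1 hsπ hpp
    exact absurd (hup r hr hrp) (not_le.2 hrπ)
  have hp : ∀ r, 0 < r → 0 ≤ p r := fun r hr => hdown r hr fun s hs => hlt s hs.1
  exact fun r hr => ⟨hP.pos_of_p_nonneg hr fun s hs => hp s hs.1, hlt r hr, hp r hr⟩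

/-- A profile whose Pohozaev quantity is negative above the level `ξ` turns before reaching `π`. -/
lemma IsProfile.exists_turn (hP : IsProfile n μ g h p) (hg : BistableForce g G ξ L) (hμ : 0 < μ)
    {r₁ : ℝ} (hr₁ : 0 < r₁) (hξ : ξ ≤ h r₁) (hlt : ∀ r ∈ Ioc 0 r₁, h r < π)
    (hF : pohozaev n h p r₁ < 0) : ∃ r, 0 < r ∧ p r < 0 ∧ ∀ s ∈ Ioc 0 r, h s < π := by
  by_contra! hcon
  have hdown : ∀ r, 0 < r → (∀ s ∈ Ioc 0 r, h s < π) → 0 ≤ p r := by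
    intro r hr hs
    by_contra! hpr
    obtain ⟨t, ht, ht2⟩ := hcon r hr hpr
    exact absurd (hs t ht) (not_lt.2 ht2)
  -- the Pohozaev quantity decreases while `h` increases in `[ξ, π]`
  have hdec : ∀ R, r₁ ≤ R → (∀ r ∈ Ioo 0 R, h r < π) → pohozaev n h p R ≤ pohozaev n h p r₁ := by
    intro R hR hm
    have hp : ∀ r ∈ Ioo 0 R, 0 ≤ p r := fun r hr =>
      hdown r hr.1 fun s hs => hm s ⟨hs.1, hs.2.trans_lt hr.2⟩
    have := le_of_hasDerivAt_nonneg (f := fun r => -pohozaev n h p r) hR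
      (fun r hr => (hP.hasDerivAt_pohozaev (hr₁.trans_le hr.1)).neg) (fun r hr => ?_)
    · linarith
    · have hr0 := hr₁.trans hr.1
      have h1 : ξ ≤ h r := hξ.trans (hP.mono_h hr₁ hr.1.le fun s hs =>
        hp s ⟨hr₁.trans hs.1, hs.2.trans hr.2⟩)
      have h2 := hg.nonpos ⟨h1, (hm r ⟨hr0, hr.2⟩).le⟩
      have h3 := hp r ⟨hr0, hr.2⟩
      rw [neg_nonneg]
      exact mul_nonpos_of_nonpos_of_nonneg
        (mul_nonpos_of_nonneg_of_nonpos (by positivity) h2) h3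
  by_cases hall : ∀ r, 0 < r → h r < π
  · have hlim := hP.tendsto_pi hg hμ hall fun r hr => hdown r hr fun s hs => hall s hs.1
    have h1 : Tendsto (fun r => -((n : ℝ) ^ 2 * sin (h r) ^ 2) / 2) atTop (𝓝 0) := by
      have h2 := (Real.continuous_sin.tendsto π).comp hlim
      have := (((h2.pow 2).const_mul ((n : ℝ) ^ 2)).neg).div_const 2
      refine Tendsto.congr (fun r => rfl) (this.trans (by simp))
    obtain ⟨r, hr1, hr2⟩ := ((h1.eventually (Ioi_mem_nhds hF)).and (eventually_ge_atTop r₁)).exists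
    have h2 := hdec r hr2 fun s hs => hall s hs.1
    have h3 : pohozaev n h p r₁ < -((n : ℝ) ^ 2 * sin (h r) ^ 2) / 2 := hr1
    have h4 := sq_nonneg (p r)
    rw [pohozaev] at h2
    linarith
  · push Not at hall
    obtain ⟨R, hR, hRπ⟩ := hall
    obtain ⟨s, hs, hs0, hsp⟩ := exists_first_zero (f := fun r => π - h r) (R := R)
      (fun r hr => continuousAt_const.sub (hP.deriv_h r hr).continuousAt)
      ((hP.lim_h.eventually (Iio_mem_nhds pi_pos)).mono fun r hr => sub_pos.2 hr)
      ⟨R, ⟨hR, le_rfl⟩, by linarith⟩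
    have hsπ : h s = π := by linarith
    have hrs : r₁ ≤ s := by
      by_contra! hc
      have := hlt s ⟨hs.1, hc.le⟩
      linarith
    have h1 := hdec s hrs fun r hr => by linarith [hsp r hr]
    have h2 : 0 ≤ pohozaev n h p s := by
      rw [pohozaev, hsπ, sin_pi]
      have := sq_nonneg (p s)
      linarith
    linarith

/-- Integrating the identity for the Pohozaev quantity by parts leaves a nonpositive integral,
because `G ≥ G(0)`. -/
lemma IsProfile.pohozaev_le (hP : IsProfile n μ g h p) (hg : BistableForce g G ξ L) (hμ : 0 < μ)
    {R : ℝ} (hR : 0 < R) (hm : ∀ r ∈ Ioo 0 R, h r ∈ Icc 0 π) :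
    pohozaev n h p R ≤ μ * R ^ 2 * (G (h R) - G 0) := by
  have hlim : Tendsto (fun r => μ * r ^ 2 * (G (h r) - G 0) - pohozaev n h p r) (𝓝[>] 0) (𝓝 0) := by
    have h1 := (hg.continuous_prim.tendsto 0).comp hP.lim_h
    have h2 : Tendsto (fun r : ℝ => r) (𝓝[>] 0) (𝓝 0) := tendsto_id.mono_left nhdsWithin_le_nhds
    have := (((h2.pow 2).const_mul μ).mul (h1.sub_const (G 0))).sub hP.tendsto_pohozaev
    refine Tendsto.congr (fun r => rfl) (this.trans (by simp))
  have := nonneg_of_tendsto_zero (f' := fun r => 2 * μ * r * (G (h r) - G 0)) hR hlim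
    (fun r hr => ?_) (fun r hr => ?_)
  · linarith
  · have h1 := ((((hasDerivAt_pow 2 r).const_mul μ).mul
      (((hg.prim (h r)).comp r (hP.deriv_h r hr.1)).sub_const (G 0)))).sub
      (hP.hasDerivAt_pohozaev hr.1)
    have hr0 := hr.1.ne'
    refine h1.congr_deriv ?_
    simp
    field_simp
    ring
  · have h1 := hg.prim_ge (hm r hr)
    have h2 := hr.1
    have h3 : 0 ≤ G (h r) - G 0 := by linarith
    positivity

lemma harmonicWork_pos (hg : BistableForce g G ξ L) (hn : 1 ≤ n) {δ : ℝ} (hδ : δ ∈ Ioc 0 ξ) :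
    0 < harmonicWork n G (harmonicRadius n δ) := by
  have hδ' : δ ∈ Ioo 0 π := ⟨hδ.1, hδ.2.trans_lt hg.mem.2⟩
  have hlim : Tendsto (harmonicWork n G) (𝓝[>] 0) (𝓝 0) := by
    have := (continuous_harmonicWork n hg.continuous_prim).tendsto 0
    rw [harmonicWork_zero] at this
    exact this.mono_left nhdsWithin_le_nhds
  refine pos_of_tendsto_zero (harmonicRadius_pos n δ) hlim
    (fun r hr => hasDerivAt_harmonicWork n hg.prim hr.1) fun r hr => ?_
  have hm := arctanProfile_mem n hr.1
  have h1 : arctanProfile n r < δ := by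
    rw [← arctanProfile_harmonicRadius hn hδ']
    refine lt_of_hasDerivAt_pos hr.2
      (fun s hs => hasDerivAt_arctanProfile n (hr.1.trans_le hs.1)) fun s hs => ?_
    have hs0 := hr.1.trans hs.1
    have h2 := arctanProfile_mem n hs0
    have h3 := sin_pos_of_pos_of_lt_pi h2.1 h2.2
    positivity
  have h2 := hg.pos _ ⟨hm.1, h1.trans_le hδ.2⟩
  have h3 := sin_pos_of_pos_of_lt_pi hm.1 hm.2
  have h4 := hr.1
  positivity

lemma IsProfile.hasDerivAt_energy (hP : IsProfile n 1 g h p) (hg : BistableForce g G ξ L)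
    {r : ℝ} (hr : 0 < r) :
    HasDerivAt (fun r => pohozaev n h p r / r ^ 2 - G (h r))
      (-(2 * pohozaev n h p r / r ^ 3)) r := by
  have h1 := ((hP.hasDerivAt_pohozaev hr).div (hasDerivAt_pow 2 r) (by positivity)).sub
    ((hg.prim (h r)).comp r (hP.deriv_h r hr))
  refine h1.congr_deriv ?_
  simp
  field_simp
  ring

/-- The energy `½ h'² - n² sin² h / (2r²) - G(h)` starts from `-G(0)` and loses at most `2 L δ²`
until the level `δ` is reached: the loss is controlled by `h`, however long this takes. -/
lemma IsProfile.energy_at_level (hP : IsProfile n 1 g h p) (hg : BistableForce g G ξ L)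
    (hn : 1 ≤ n) {δ r₀ : ℝ} (hδξ : δ ≤ ξ) (hδπ : δ ≤ π / 2) (hr₀ : 0 < r₀) (h0 : h r₀ = δ)
    (hlt : ∀ r ∈ Ioo 0 r₀, h r < δ) :
    -G 0 - 2 * L * δ ^ 2 ≤ pohozaev n h p r₀ / r₀ ^ 2 - G δ := by
  have hrise := hP.rise hg one_pos (R := r₀) fun r hr => (hlt r hr).trans_le hδξ
  have hm : ∀ r ∈ Ioo 0 r₀, h r ∈ Icc 0 π := fun r hr =>
    ⟨(hrise r ⟨hr.1, hr.2.le⟩).1.le, (hlt r hr).le.trans (by linarith [pi_pos])⟩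
  have hle : ∀ r ∈ Ioo 0 r₀, pohozaev n h p r ≤ r ^ 2 * (G (h r) - G 0) := fun r hr => by
    have := hP.pohozaev_le hg one_pos hr.1 fun s hs => hm s ⟨hs.1, hs.2.trans hr.2⟩
    rwa [one_mul] at this
  have hGq : ∀ x ∈ Icc 0 δ, G x - G 0 ≤ L * x ^ 2 := by
    intro x hx
    have := le_of_hasDerivAt_nonneg (f := fun y => L * x * y - G y) hx.1
      (fun y _ => ((hasDerivAt_id y).const_mul (L * x)).sub (hg.prim y)) fun y hy => by
        have h1 := hg.lip y 0
        rw [hg.zero, sub_zero, sub_zero, abs_of_pos hy.1] at h1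
        have h2 := le_abs_self (g y)
        have h3 : L * y ≤ L * x := mul_le_mul_of_nonneg_left hy.2.le hg.lip_nonneg
        linarith
    nlinarith
  have hlim : Tendsto (fun r => pohozaev n h p r / r ^ 2 - G (h r) + 2 * L * h r ^ 2 + G 0)
      (𝓝[>] 0) (𝓝 0) := by
    have h1 := (hg.continuous_prim.tendsto 0).comp hP.lim_h
    have h2 : Tendsto (fun r => pohozaev n h p r / r ^ 2) (𝓝[>] 0) (𝓝 0) := by
      have h3 := h1.sub_const (G 0)
      rw [sub_self] at h3
      refine squeeze_zero' ?_ ?_ h3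
      · filter_upwards [Ioo_mem_nhdsGT hr₀] with r hr
        exact div_nonneg (hrise r ⟨hr.1, hr.2.le⟩).2.2.le (sq_nonneg r)
      · filter_upwards [Ioo_mem_nhdsGT hr₀] with r hr
        have hr2 : 0 < r ^ 2 := pow_pos hr.1 2
        rw [div_le_iff₀ hr2, mul_comm]
        exact hle r hr
    have := ((h2.sub h1).add ((hP.lim_h.pow 2).const_mul (2 * L))).add_const (G 0)
    refine Tendsto.congr (fun r => rfl) (this.trans (by simp))
  have key := nonneg_of_tendsto_zero hr₀ hlim (fun r hr => ((hP.hasDerivAt_energy hg hr.1).add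
    (((hP.deriv_h r hr.1).pow 2).const_mul (2 * L))).add_const (G 0)) (fun r hr => ?_)
  · rw [h0] at key
    linarith
  · have hr0 := hr.1
    obtain ⟨e1, e2, e3⟩ := hrise r ⟨hr.1, hr.2.le⟩
    have e4 := hle r hr
    have e5 := hGq (h r) ⟨e1.le, (hlt r hr).le⟩
    have e6 := mul_sin_lt_of_pohozaev_pos e2 e3
    have e7 : 2 / π * h r ≤ sin (h r) := mul_le_sin e1.le ((hlt r hr).le.trans hδπ)
    have e8 : 1 / 2 * h r ≤ 2 / π * h r := by
      have : 1 / 2 ≤ 2 / π := by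
        rw [div_le_div_iff₀ two_pos pi_pos]
        linarith [pi_le_four]
      gcongr
    have hn' : (1 : ℝ) ≤ n := by exact_mod_cast hn
    have e9 : h r ≤ 2 * p r := by
      have : sin (h r) ≤ n * sin (h r) := le_mul_of_one_le_left (by
        have : 0 ≤ 1 / 2 * h r := by linarith
        linarith) hn'
      linarith
    have e10 : pohozaev n h p r ≤ r ^ 2 * (L * h r ^ 2) :=
      e4.trans (mul_le_mul_of_nonneg_left e5 (sq_nonneg r))
    have e11 : 2 * pohozaev n h p r / r ^ 3 ≤ 2 * (L * h r ^ 2) / r := by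
      rw [div_le_div_iff₀ (by positivity) hr0]
      calc 2 * pohozaev n h p r * r ≤ 2 * (r ^ 2 * (L * h r ^ 2)) * r := by gcongr
        _ = _ := by ring
    have hL := hg.lip_nonneg
    have e12 : 2 * (L * h r ^ 2) / r ≤ 2 * L * (2 * h r * (p r / r)) := by
      rw [show 2 * L * (2 * h r * (p r / r)) = 2 * (L * (h r * (2 * p r))) / r by ring]
      gcongr
      rw [sq]
      gcongr
    simp only [Nat.cast_ofNat, Nat.add_one_sub_one, pow_one]
    linarith

/-- A profile that stays below a small level `δ` for a long time crosses `π`: by then the curvature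
terms have become negligible and the energy `-G(0) > 0` suffices. -/
theorem exists_crossing_of_slow_start (hg : BistableForce g G ξ L) (hn : 1 ≤ n) :
    ∃ δ R₀ : ℝ, 0 < δ ∧ 0 < R₀ ∧ ∀ h p : ℝ → ℝ, IsProfile n 1 g h p →
      (∀ r ∈ Ioc 0 R₀, h r < δ) → ∃ r, 0 < r ∧ (∀ t ∈ Ioc 0 r, 0 < p t) ∧ π < h r := by
  have hξ := hg.mem
  have hL := hg.lip_nonneg
  obtain ⟨δ, hδ0, hδξ, hδπ, hδL⟩ : ∃ δ : ℝ, 0 < δ ∧ δ ≤ ξ ∧ δ ≤ π / 2 ∧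
      2 * L * δ ^ 2 ≤ -G 0 / 8 := by
    have h1 : Tendsto (fun δ : ℝ => 2 * L * δ ^ 2) (𝓝[>] 0) (𝓝 0) := by
      have : Continuous fun δ : ℝ => 2 * L * δ ^ 2 := by fun_prop
      have := this.tendsto 0
      simp only [ne_eq, OfNat.ofNat_ne_zero, not_false_eq_true, zero_pow, mul_zero] at this
      exact this.mono_left nhdsWithin_le_nhds
    have h2 : 0 < -G 0 / 8 := by linarith [hg.prim_zero]
    obtain ⟨δ, h3, h4⟩ := ((h1.eventually (Iio_mem_nhds h2)).and
      (Ioo_mem_nhdsGT (lt_min hξ.1 (half_pos pi_pos)))).exists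
    exact ⟨δ, h4.1, (h4.2.trans_le (min_le_left _ _)).le, (h4.2.trans_le (min_le_right _ _)).le,
      le_of_lt h3⟩
  have hδπ' : δ < π := by linarith [pi_pos]
  set κ := harmonicWork n G (harmonicRadius n δ) / harmonicRadius n δ ^ 2 with hκ
  have hκ0 : 0 < κ := div_pos (harmonicWork_pos hg hn ⟨hδ0, hδξ⟩)
    (pow_pos (harmonicRadius_pos n δ) 2)
  -- With `F` the Pohozaev quantity, `b` will bound `2 F / r²` from below after the level `δ`.
  set b := min κ (-G 0) with hb
  have hb0 : 0 < b := lt_min hκ0 (by linarith [hg.prim_zero])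
  have hbκ : b ≤ κ := min_le_left _ _
  have hbG : b ≤ -G 0 := min_le_right _ _
  set Y := G ξ - G 0 with hY
  have hY0 : 0 ≤ Y := sub_nonneg.2 (hg.prim_ge ⟨hξ.1.le, hξ.2.le⟩)
  -- `h' ≥ √b` then lets `h` reach `π` within the length `l`
  set l := π / √b with hl
  have hsb : 0 < √b := Real.sqrt_pos.2 hb0
  have hl0 : 0 < l := div_pos pi_pos hsb
  refine ⟨δ, 8 * Y * l / b + 1, hδ0, by positivity, fun h p hP hslow => ?_⟩
  obtain ⟨r₀, hr₀, h0, hlt⟩ := hP.exists_level hg one_pos (δ := δ) ⟨hδ0, hδξ⟩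
  have hrise := hP.rise hg one_pos (R := r₀) fun r hr => (hlt r hr).trans_le hδξ
  have hr₀R : 8 * Y * l / b < r₀ := by
    by_contra! hc
    have := hslow r₀ ⟨hr₀, by linarith⟩
    linarith
  have hloss : 2 * Y / r₀ * l ≤ b / 4 := by
    rw [div_mul_eq_mul_div, div_le_div_iff₀ hr₀ (by norm_num)]
    rw [div_lt_iff₀ hb0] at hr₀R
    linarith
  have hF0 : κ * r₀ ^ 2 < pohozaev n h p r₀ := by
    have := hP.work_lt_pohozaev hg one_pos hn hr₀ (fun r hr => (hlt r hr).trans_le hδξ)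
      (by rw [h0]; exact hδξ)
    rw [h0] at this
    refine lt_of_eq_of_lt ?_ this
    rw [hκ]
    ring
  -- the two lower bounds at the level `δ`: `κ` is used while `h ≤ ξ`, the energy beyond
  have hE0 := hP.energy_at_level hg hn hδξ hδπ hr₀ h0 hlt
  -- bootstrap: as long as `2 F / r² > b` and `h < π`, the length `R - r₀` is at most `l`, and the
  -- energy lost to the factor `1 / r` is too small for `2 F / r²` to come down to `b`
  have hfront : ∀ R, r₀ < R → (∀ r ∈ Ico r₀ R, b / 2 * r ^ 2 < pohozaev n h p r ∧ h r < π) →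
      R - r₀ ≤ l ∧ b / 2 * R ^ 2 < pohozaev n h p R ∧ ∀ r ∈ Ioo 0 R, 0 < p r := by
    intro R hR hass
    have hR0 : 0 < R := hr₀.trans hR
    have hF : ∀ r ∈ Ioo 0 R, 0 < pohozaev n h p r := by
      intro r hr
      rcases le_or_gt r r₀ with h1 | h1
      · exact (hrise r ⟨hr.1, h1⟩).2.2
      · have h2 := hr.1
        exact lt_of_le_of_lt (by positivity) (hass r ⟨h1.le, hr.2⟩).1
    have hp := hP.p_pos_of_pohozaev_pos hF
    have hmono : ∀ r ∈ Icc r₀ R, δ ≤ h r := by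
      intro r hr
      rw [← h0]
      exact hP.mono_h hr₀ hr.1 fun s hs => (hp s ⟨hr₀.trans hs.1, hs.2.trans_le hr.2⟩).le
    have hRπ : h R ≤ π := by
      refine le_of_tendsto ((hP.deriv_h R hR0).continuousAt.continuousWithinAt (s := Iio R)) ?_
      filter_upwards [Ioo_mem_nhdsLT hR] with r hr
      exact (hass r ⟨hr.1.le, hr.2⟩).2.le
    have hm : ∀ r ∈ Ioo 0 R, h r ∈ Icc 0 π := by
      intro r hr
      rcases lt_or_ge r r₀ with h1 | h1
      · exact ⟨(hrise r ⟨hr.1, h1.le⟩).1.le, by linarith [hlt r ⟨hr.1, h1⟩]⟩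
      · exact ⟨by linarith [hmono r ⟨h1, hr.2.le⟩], (hass r ⟨h1, hr.2⟩).2.le⟩
    have hlen : R - r₀ ≤ l := by
      have := le_of_hasDerivAt_nonneg (f := fun r => h r - √b * r) hR.le
        (fun r hr => (hP.deriv_h r (hr₀.trans_le hr.1)).sub ((hasDerivAt_id r).const_mul (√b)))
        fun r hr => by
          have hr0 := hr₀.trans hr.1
          have e1 := (hass r ⟨hr.1.le, hr.2⟩).1
          have e2 := IsProfile.sqrt_le (hp r ⟨hr0, hr.2⟩) e1.le
          have e3 : √(2 * (b / 2 * r ^ 2)) = √b * r := by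
            rw [show 2 * (b / 2 * r ^ 2) = b * r ^ 2 by ring, Real.sqrt_mul hb0.le,
              Real.sqrt_sq hr0.le]
          rw [e3] at e2
          rw [mul_one, sub_nonneg, le_div_iff₀ hr0]
          exact e2
      rw [hl, le_div_iff₀ hsb]
      rw [h0] at this
      nlinarith
    refine ⟨hlen, ?_, hp⟩
    have hen := le_of_hasDerivAt_nonneg
      (f := fun r => pohozaev n h p r / r ^ 2 - G (h r) + 2 * Y / r₀ * r) hR.le
      (fun r hr => (hP.hasDerivAt_energy hg (hr₀.trans_le hr.1)).add
        ((hasDerivAt_id r).const_mul (2 * Y / r₀))) fun r hr => by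
          have hr0 := hr₀.trans hr.1
          have e1 := hP.pohozaev_le hg one_pos hr0 fun s hs => hm s ⟨hs.1, hs.2.trans hr.2⟩
          have e2 := hg.prim_le (hm r ⟨hr0, hr.2⟩)
          have e3 : pohozaev n h p r ≤ r ^ 2 * Y := by
            rw [one_mul] at e1
            exact e1.trans (mul_le_mul_of_nonneg_left (by linarith) (sq_nonneg r))
          have e4 : 2 * pohozaev n h p r / r ^ 3 ≤ 2 * Y / r₀ := by
            rw [div_le_div_iff₀ (by positivity) hr₀]
            calc 2 * pohozaev n h p r * r₀ ≤ 2 * (r ^ 2 * Y) * r := by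
                  have := hr.1.le
                  gcongr
              _ = 2 * Y * r ^ 3 := by ring
          linarith
    rw [h0] at hen
    have hloss' : 2 * Y / r₀ * (R - r₀) ≤ b / 4 :=
      (mul_le_mul_of_nonneg_left hlen (by positivity)).trans hloss
    have hF0' : κ < pohozaev n h p r₀ / r₀ ^ 2 := by rwa [lt_div_iff₀ (by positivity)]
    rw [← lt_div_iff₀ (by positivity)]
    rcases le_total (h R) ξ with h1 | h1
    · have := hg.prim_mono hδ0.le (hmono R ⟨hR.le, le_rfl⟩) h1
      linarith
    · have := hg.prim_nonneg ⟨h1, hRπ⟩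
      linarith
  -- the first time at which one of the bounds fails is a time at which `h = π`
  have hcont : ∀ r, 0 < r → ContinuousAt
      (fun r => min (pohozaev n h p r - b / 2 * r ^ 2) (π - h r)) r := fun r hr =>
    ((hP.hasDerivAt_pohozaev hr).continuousAt.sub (by fun_prop)).min
      (continuousAt_const.sub (hP.deriv_h r hr).continuousAt)
  have hstart : 0 < min (pohozaev n h p r₀ - b / 2 * r₀ ^ 2) (π - h r₀) := by
    refine lt_min ?_ (by rw [h0]; linarith)
    have : b / 2 * r₀ ^ 2 ≤ κ * r₀ ^ 2 := by gcongr; linarith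
    linarith
  obtain ⟨s, hs, hs0, hspos⟩ := exists_first_zero
    (f := fun t => min (pohozaev n h p (r₀ + t) - b / 2 * (r₀ + t) ^ 2) (π - h (r₀ + t)))
    (R := l + 1) (fun t ht => by
      have hc : ContinuousAt (fun t : ℝ => r₀ + t) t := by fun_prop
      exact ContinuousAt.comp (f := fun t : ℝ => r₀ + t) (hcont (r₀ + t) (by linarith)) hc) (by
      have hc : Tendsto (fun t : ℝ => r₀ + t) (𝓝[>] 0) (𝓝 r₀) := by
        have : Continuous fun t : ℝ => r₀ + t := by fun_prop
        have := this.tendsto 0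
        rw [add_zero] at this
        exact this.mono_left nhdsWithin_le_nhds
      exact ((hcont r₀ hr₀).tendsto.comp hc).eventually (Ioi_mem_nhds hstart)) (by
      by_contra! hc
      have := (hfront (r₀ + (l + 1)) (by linarith) fun r hr => by
        rcases hr.1.eq_or_lt with h1 | h1
        · rw [← h1]
          exact ⟨by linarith [(lt_min_iff.1 hstart).1], by linarith [(lt_min_iff.1 hstart).2]⟩
        · have h2 := hc (r - r₀) ⟨by linarith, by linarith [hr.2]⟩
          rw [add_sub_cancel] at h2
          exact ⟨by linarith [(lt_min_iff.1 h2).1], by linarith [(lt_min_iff.1 h2).2]⟩).1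
      linarith)
  obtain ⟨-, hF1, hp1⟩ := hfront (r₀ + s) (by linarith [hs.1]) fun r hr => by
    rcases hr.1.eq_or_lt with h1 | h1
    · rw [← h1]
      exact ⟨by linarith [(lt_min_iff.1 hstart).1], by linarith [(lt_min_iff.1 hstart).2]⟩
    · have h2 := hspos (r - r₀) ⟨by linarith, by linarith [hr.2]⟩
      rw [add_sub_cancel] at h2
      exact ⟨by linarith [(lt_min_iff.1 h2).1], by linarith [(lt_min_iff.1 h2).2]⟩
  have hs1 : 0 < r₀ + s := by linarith [hs.1]
  have hπ : h (r₀ + s) = π := by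
    rcases min_choice (pohozaev n h p (r₀ + s) - b / 2 * (r₀ + s) ^ 2) (π - h (r₀ + s)) with h1 | h1
    · rw [h1] at hs0
      linarith
    · rw [h1] at hs0
      linarith
  refine hP.exists_gt_pi hs1 hπ fun r hr => ?_
  rcases hr.2.eq_or_lt with h1 | h1
  · have h2 : 0 ≤ p (r₀ + s) := by
      refine ge_of_tendsto
        ((hP.deriv_p _ hs1).continuousAt.continuousWithinAt (s := Iio (r₀ + s))) ?_
      filter_upwards [Ioo_mem_nhdsLT hs1] with t ht
      exact (hp1 t ht).le
    have h3 : p (r₀ + s) ≠ 0 := by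
      intro h4
      rw [pohozaev, h4] at hF1
      have h5 : 0 ≤ (n : ℝ) ^ 2 * sin (h (r₀ + s)) ^ 2 := by positivity
      have h6 : 0 ≤ b / 2 * (r₀ + s) ^ 2 := by positivity
      linarith
    rw [h1]
    exact lt_of_le_of_ne h2 (Ne.symm h3)
  · exact hp1 r ⟨hr.1, h1⟩

end Profile

/-! ### The shooting argument -/

/-- `h = rⁿ v` is a profile when `v` solves the equation with `radialForce` and `v(0) = a > 0`. -/
lemma isProfile_of_regular {n : ℕ} (hn : 1 ≤ n) {μ a : ℝ} (ha : 0 < a) {g v q : ℝ → ℝ}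
    (hg0 : g 0 = 0) (hv0 : v 0 = a) (hv : ∀ r, HasDerivAt v (r * q r) r) (hqc : Continuous q)
    (hq : ∀ r, r ≠ 0 →
      HasDerivAt q ((radialForce n μ g r (v r) - (2 * n + 2) * q r) / r) r) :
    IsProfile n μ g (fun r => r ^ n * v r) (fun r => r ^ n * (n * v r + r ^ 2 * q r)) := by
  have hvc : Continuous v := continuous_iff_continuousAt.2 fun r => (hv r).continuousAt
  have hpow : ∀ r : ℝ, r ^ n = r ^ (n - 1) * r := fun r => by
    rw [← pow_succ, Nat.sub_add_cancel hn]
  have hPc : Continuous fun r => n * v r + r ^ 2 * q r := by fun_prop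
  refine ⟨fun r hr => ?_, fun r hr => ?_, ?_, ?_, ?_⟩
  · refine ((hasDerivAt_pow n r).mul (hv r)).congr_deriv ?_
    rw [hpow r]
    field_simp
  · have h1 := (hasDerivAt_pow n r).mul (((hv r).const_mul (n : ℝ)).add
      ((hasDerivAt_pow 2 r).mul (hq r hr.ne')))
    refine h1.congr_deriv ?_
    have h2 := pow_mul_radialForce hn μ hg0 r (v r)
    have h3 : (n : ℝ) ^ 2 * (sin (r ^ n * v r) * cos (r ^ n * v r)) + μ * r ^ 2 * g (r ^ n * v r)
        = r ^ (n + 2) * radialForce n μ g r (v r) + n ^ 2 * (r ^ n * v r) := by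
      rw [h2]
      ring
    rw [h3, pow_add, hpow r]
    simp only [Nat.cast_ofNat, Nat.add_one_sub_one, pow_one, Pi.add_apply, Pi.mul_apply]
    field_simp
    ring
  · have : Continuous fun r => r ^ n * v r := by fun_prop
    have := this.tendsto 0
    simp only [zero_pow (by lia : n ≠ 0), zero_mul] at this
    exact this.mono_left nhdsWithin_le_nhds
  · have : Continuous fun r => r ^ n * (n * v r + r ^ 2 * q r) := by fun_prop
    have := this.tendsto 0
    simp only [zero_pow (by lia : n ≠ 0), zero_mul] at this
    exact this.mono_left nhdsWithin_le_nhds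
  · have hn' : (0 : ℝ) < n := by positivity
    have h1 : ∀ᶠ r in 𝓝 (0 : ℝ), 0 < v r :=
      hvc.continuousAt.eventually (Ioi_mem_nhds (by rw [hv0]; exact ha))
    have h2 : ∀ᶠ r in 𝓝 (0 : ℝ), 0 < n * v r + r ^ 2 * q r :=
      hPc.continuousAt.eventually (Ioi_mem_nhds (by simp [hv0]; positivity))
    filter_upwards [nhdsWithin_le_nhds h1, nhdsWithin_le_nhds h2, self_mem_nhdsWithin]
      with r h3 h4 h5
    have h6 : (0 : ℝ) < r ^ n := pow_pos h5 n
    exact ⟨mul_pos h6 h3, mul_pos h6 h4⟩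

/-- The only solution of the profile equation without force and with `h ~ 2 rⁿ` is the harmonic
profile: the Pohozaev quantity vanishes, so `h` is a dilate of the harmonic profile near `0`, and
uniqueness extends the identity. -/
lemma eq_arctanProfile {n : ℕ} (hn : 1 ≤ n) {g v q : ℝ → ℝ} {L : ℝ} (hL : 0 ≤ L)
    (hgL : ∀ x y, |g x - g y| ≤ L * |x - y|) (hg0 : g 0 = 0) (hv0 : v 0 = 2)
    (hv : ∀ r, HasDerivAt v (r * q r) r) (hqc : Continuous q)
    (hq : ∀ r, r ≠ 0 →
      HasDerivAt q ((radialForce n 0 g r (v r) - (2 * n + 2) * q r) / r) r) {r : ℝ} (hr : 0 < r) :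
    r ^ n * v r = arctanProfile n r := by
  have hn' : (0 : ℝ) < n := by positivity
  have hP := isProfile_of_regular hn two_pos hg0 hv0 hv hqc hq
  set h : ℝ → ℝ := fun r => r ^ n * v r with hh
  set p : ℝ → ℝ := fun r => r ^ n * (n * v r + r ^ 2 * q r) with hp
  have hF : ∀ r, 0 < r → pohozaev n h p r = 0 := by
    intro r hr
    have h1 := nonneg_of_tendsto_zero hr hP.tendsto_pohozaev
      (fun s hs => hP.hasDerivAt_pohozaev hs.1) fun s _ => by simp
    have h2 := hP.tendsto_pohozaev.neg
    rw [neg_zero] at h2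
    have h3 := nonneg_of_tendsto_zero hr h2
      (fun s hs => (hP.hasDerivAt_pohozaev hs.1).neg) fun s _ => by simp
    linarith
  obtain ⟨ε, hε, hball⟩ := mem_nhdsGT_iff_exists_Ioo_subset.1
    (hP.pos.and (hP.lim_h.eventually (Iio_mem_nhds pi_pos)))
  have hε' : (0 : ℝ) < ε := hε
  have hm : ∀ r ∈ Ioo 0 ε, h r ∈ Ioo 0 π := fun r hr => ⟨(hball hr).1.1, (hball hr).2⟩
  have hsin : ∀ r ∈ Ioo 0 ε, p r = n * sin (h r) := by
    intro r hr
    have h1 := hF r hr.1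
    have h2 := sin_pos_of_pos_of_lt_pi (hm r hr).1 (hm r hr).2
    have h3 : 0 < p r := (hball hr).1.2
    rw [pohozaev] at h1
    have h4 : p r ^ 2 = (n * sin (h r)) ^ 2 := by rw [mul_pow]; linarith
    exact (pow_left_inj₀ h3.le (by positivity) two_ne_zero).1 h4
  -- the quotient of the harmonic radius of `h(r)` by `r` is constant, so `h(r) = φ(c r)`
  set c := harmonicRadius n (h (ε / 2)) / (ε / 2) with hc
  have hc0 : 0 < c := div_pos (harmonicRadius_pos _ _) (half_pos hε')
  have hconst : ∀ r ∈ Ioo 0 ε, harmonicRadius n (h r) = c * r := by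
    intro r hr
    have hd : ∀ x ∈ Ioo 0 ε, HasDerivAt (fun r => harmonicRadius n (h r) / r) 0 x := by
      intro x hx
      have h1 := (((hasDerivAt_harmonicRadius hn (hm x hx)).comp x (hP.deriv_h x hx.1)).div
        (hasDerivAt_id x) hx.1.ne')
      refine h1.congr_deriv ?_
      have h2 := (sin_pos_of_pos_of_lt_pi (hm x hx).1 (hm x hx).2).ne'
      have h3 := hx.1.ne'
      rw [hsin x hx]
      simp only [Function.comp, id]
      field_simp
      ring
    have h1 : harmonicRadius n (h r) / r = c := by
      refine isOpen_Ioo.is_const_of_deriv_eq_zero isPreconnected_Ioo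
        (f := fun r => harmonicRadius n (h r) / r)
        (fun x hx => (hd x hx).differentiableAt.differentiableWithinAt)
        (fun x hx => (hd x hx).deriv) hr ⟨half_pos hε', half_lt_self hε'⟩
    rw [← h1, div_mul_cancel₀ _ hr.1.ne']
  have hφ : ∀ r ∈ Ioo 0 ε, h r = arctanProfile n (c * r) := fun r hr => by
    rw [← hconst r hr, arctanProfile_harmonicRadius hn (hm r hr)]
  have hc1 : c = 1 := by
    have hlim1 : Tendsto v (𝓝[>] 0) (𝓝 2) := by
      rw [← hv0]
      exact (hv 0).continuousAt.tendsto.mono_left nhdsWithin_le_nhds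
    have hslope : Tendsto (fun x : ℝ => arctan x / x) (𝓝[≠] 0) (𝓝 1) := by
      have h1 := (Real.hasDerivAt_arctan 0).tendsto_slope
      simp only [slope_fun_def, arctan_zero, sub_zero, vsub_eq_sub, smul_eq_mul] at h1
      refine (h1.congr fun x => ?_).trans (by simp)
      rw [div_eq_inv_mul]
    have hx : Tendsto (fun r : ℝ => (c * r) ^ n) (𝓝[>] 0) (𝓝[≠] 0) := by
      refine tendsto_nhdsWithin_iff.2 ⟨?_, ?_⟩
      · have : Continuous fun r : ℝ => (c * r) ^ n := by fun_prop
        have := this.tendsto 0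
        simp only [mul_zero, zero_pow (by lia : n ≠ 0)] at this
        exact this.mono_left nhdsWithin_le_nhds
      · filter_upwards [self_mem_nhdsWithin] with r hr
        have : (0 : ℝ) < r := hr
        exact (by positivity : (c * r) ^ n ≠ 0)
    have hlim2 : Tendsto v (𝓝[>] 0) (𝓝 (2 * c ^ n * 1)) := by
      refine ((hslope.comp hx).const_mul (2 * c ^ n)).congr' ?_
      filter_upwards [Ioo_mem_nhdsGT hε'] with r hr
      have h1 := hφ r hr
      have h2 : r ^ n ≠ 0 := pow_ne_zero _ hr.1.ne'
      have h3 : c ^ n ≠ 0 := pow_ne_zero _ hc0.ne'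
      simp only [hh, arctanProfile] at h1
      have h4 : v r = 2 * arctan ((c * r) ^ n) / r ^ n := by
        rw [eq_div_iff h2, mul_comm]
        exact h1
      rw [h4]
      simp only [Function.comp, mul_pow]
      field_simp
    have h1 := tendsto_nhds_unique hlim1 hlim2
    have h2 : c ^ n = 1 := by linarith
    exact (pow_eq_one_iff_of_nonneg hc0.le (by lia : n ≠ 0)).1 h2
  have hs : ε / 2 ∈ Ioo 0 ε := ⟨half_pos hε', half_lt_self hε'⟩
  have e1 : h (ε / 2) = arctanProfile n (ε / 2) := by rw [hφ _ hs, hc1, one_mul]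
  refine eq_of_eq_at (k := arctanProfile n) (q := fun r => n * sin (arctanProfile n r)) le_rfl hL
    hgL hP.deriv_h hP.deriv_p (fun r hr => hasDerivAt_arctanProfile n hr)
    (fun r hr => ?_) hs.1 e1 ?_ hr
  · refine ((hasDerivAt_arctanProfile n hr).sin.const_mul (n : ℝ)).congr_deriv ?_
    field_simp
    ring
  · rw [← e1]
    exact hsin _ hs

/-- The Pohozaev identity, integrated by parts. -/
lemma pohozaev_eq_integral {n : ℕ} {μ ξ L : ℝ} {g G h p : ℝ → ℝ} (hP : IsProfile n μ g h p)
    (hg : BistableForce g G ξ L) (hc : Continuous h) {R : ℝ} (hR : 0 < R) :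
    pohozaev n h p R = μ * (R ^ 2 * G (h R) - 2 * ∫ s in (0 : ℝ)..R, G (h s) * s) := by
  have hGc : Continuous fun s => G (h s) * s :=
    (hg.continuous_prim.comp hc).mul continuous_id
  have hI : ∀ r, HasDerivAt (fun r => ∫ s in (0 : ℝ)..r, G (h s) * s) (G (h r) * r) r := fun r =>
    intervalIntegral.integral_hasDerivAt_right (hGc.intervalIntegrable 0 r)
      (hGc.stronglyMeasurableAtFilter _ _) hGc.continuousAt
  have hd : ∀ r ∈ Ioc 0 R, HasDerivAt (fun r => pohozaev n h p r
      - μ * (r ^ 2 * G (h r) - 2 * ∫ s in (0 : ℝ)..r, G (h s) * s)) 0 r := by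
    intro r hr
    have h1 := (hP.hasDerivAt_pohozaev hr.1).sub ((((hasDerivAt_pow 2 r).mul
      ((hg.prim (h r)).comp r (hP.deriv_h r hr.1))).sub ((hI r).const_mul 2)).const_mul μ)
    refine h1.congr_deriv ?_
    have := hr.1.ne'
    simp
    field_simp
    ring
  have hlim : Tendsto (fun r => pohozaev n h p r
      - μ * (r ^ 2 * G (h r) - 2 * ∫ s in (0 : ℝ)..r, G (h s) * s)) (𝓝[>] 0) (𝓝 0) := by
    have h1 : Continuous fun r => μ * (r ^ 2 * G (h r) - 2 * ∫ s in (0 : ℝ)..r, G (h s) * s) := by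
      have h2 : Continuous fun r => ∫ s in (0 : ℝ)..r, G (h s) * s :=
        continuous_iff_continuousAt.2 fun r => (hI r).continuousAt
      have h3 : Continuous fun r => G (h r) := hg.continuous_prim.comp hc
      exact continuous_const.mul (((continuous_pow 2).mul h3).sub (continuous_const.mul h2))
    have h4 := (h1.tendsto 0).mono_left (nhdsWithin_le_nhds (s := Ioi 0))
    have h5 := hP.tendsto_pohozaev.sub h4
    simpa using h5
  have h1 := nonneg_of_tendsto_zero hR hlim hd fun _ _ => le_rfl
  have hlim' := hlim.neg
  rw [neg_zero] at hlim'
  have h2 := nonneg_of_tendsto_zero hR hlim' (fun r hr => (hd r hr).neg) fun _ _ => by simp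
  linarith

/-- Existence: if the work of `g` along the harmonic profile is negative at some radius beyond the
level `ξ`, shooting in the two parameters `a` (initial coefficient) and `μ` (squared length
scale) produces a regular profile that increases to `π`. -/
theorem exists_connecting_profile {n : ℕ} (hn : 1 ≤ n) {ξ L : ℝ} {g G : ℝ → ℝ}
    (hg : BistableForce g G ξ L) {r₁ : ℝ} (hr₁ : 0 < r₁) (hξ : ξ < arctanProfile n r₁)
    (hneg : harmonicWork n G r₁ < 0) :
    ∃ (μ : ℝ) (v q : ℝ → ℝ), 0 < μ ∧ Continuous q ∧ (∀ r, HasDerivAt v (r * q r) r) ∧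
      (∀ r, r ≠ 0 → HasDerivAt q ((radialForce n μ g r (v r) - (2 * n + 2) * q r) / r) r) ∧
      (2 * n + 2) * q 0 = radialForce n μ g 0 (v 0) ∧
      IsProfile n μ g (fun r => r ^ n * v r) (fun r => r ^ n * (n * v r + r ^ 2 * q r)) ∧
      (∀ r, 0 < r → 0 < r ^ n * v r ∧ r ^ n * v r < π) ∧
      Tendsto (fun r => r ^ n * v r) atTop (𝓝 π) := by
  have hn' : (0 : ℝ) < n := by positivity
  have hgd : DifferentiableAt ℝ g 0 := hg.diff 0 ⟨le_rfl, pi_pos⟩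
  obtain ⟨v, q, hvc, hqc, hzero, hfam⟩ :=
    exists_profile_family hn hg.lip_nonneg hg.lip hg.zero hgd
  set S : Set (ℝ × ℝ) := Ioc 0 2 ×ˢ Ioc 0 1 with hS
  have hmem : ∀ θ ∈ S, θ.1 ∈ Icc (0 : ℝ) 2 ∧ θ.2 ∈ Icc (0 : ℝ) 1 := fun θ hθ =>
    ⟨⟨hθ.1.1.le, hθ.1.2⟩, ⟨hθ.2.1.le, hθ.2.2⟩⟩
  let h : ℝ × ℝ → ℝ → ℝ := fun θ r => r ^ n * v θ r
  let P : ℝ × ℝ → ℝ → ℝ := fun θ r => n * v θ r + r ^ 2 * q θ r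
  have hvc' : Continuous fun z : (ℝ × ℝ) × ℝ => v z.1 z.2 := hvc
  have hqc' : Continuous fun z : (ℝ × ℝ) × ℝ => q z.1 z.2 := hqc
  have hhc : Continuous fun z : (ℝ × ℝ) × ℝ => h z.1 z.2 := by
    simp only [h]
    fun_prop
  have hPc : Continuous fun z : (ℝ × ℝ) × ℝ => P z.1 z.2 := by
    simp only [P]
    fun_prop
  have hq1 : ∀ θ, Continuous (q θ) := fun θ => hqc'.comp (continuous_const.prodMk continuous_id)
  have hh1 : ∀ θ, Continuous (h θ) := fun θ => hhc.comp (continuous_const.prodMk continuous_id)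
  have hhr : ∀ r, Continuous fun θ => h θ r := fun r =>
    hhc.comp (continuous_id.prodMk continuous_const)
  have hPr : ∀ r, Continuous fun θ => P θ r := fun r =>
    hPc.comp (continuous_id.prodMk continuous_const)
  have hprof : ∀ θ ∈ S, IsProfile n θ.2 g (h θ) (fun r => r ^ n * P θ r) := by
    rintro ⟨a, μ⟩ hθ
    obtain ⟨h1, h2, h3, -⟩ := hfam a (hmem _ hθ).1 μ (hmem _ hθ).2
    exact isProfile_of_regular hn hθ.1.1 hg.zero h1 h2 (hq1 _) h3
  have hP0 : ∀ θ ∈ S, 0 < P θ 0 := by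
    rintro ⟨a, μ⟩ hθ
    have h1 := (hfam a (hmem _ hθ).1 μ (hmem _ hθ).2).1
    have h2 : (0 : ℝ) < a := hθ.1.1
    have h3 : 0 < (n : ℝ) * a := mul_pos hn' h2
    simpa [P, h1] using h3
  have hh0 : ∀ θ, h θ 0 = 0 := fun θ => by simp [h, zero_pow (by lia : n ≠ 0)]
  have hsign : ∀ θ r, 0 < r → (0 < r ^ n * P θ r ↔ 0 < P θ r) := fun θ r hr =>
    mul_pos_iff_of_pos_left (pow_pos hr n)
  -- the two alternatives: `h` crosses `π` while increasing, or turns before reaching `π`;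
  -- positivity is stated for `P = r⁻ⁿ p`, which does not degenerate at `r = 0`, so that both
  -- sets are open
  set U : Set (ℝ × ℝ) := {θ | ∃ r, 0 < r ∧ π < h θ r ∧ ∀ s ∈ Icc 0 r, 0 < P θ s} with hU
  set D : Set (ℝ × ℝ) := {θ | ∃ r, 0 < r ∧ P θ r < 0 ∧ ∀ s ∈ Icc 0 r, h θ s < π} with hD
  have hUo : IsOpen U := by
    rw [isOpen_iff_mem_nhds]
    rintro θ ⟨r, hr, h1, h2⟩
    have e1 : ∀ᶠ θ' in 𝓝 θ, π < h θ' r := (hhr r).continuousAt.eventually (Ioi_mem_nhds h1)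
    have e2 : ∀ᶠ θ' in 𝓝 θ, ∀ s ∈ Icc 0 r, 0 < P θ' s :=
      isCompact_Icc.eventually_forall_of_forall_eventually fun s hs =>
        hPc.continuousAt.eventually (Ioi_mem_nhds (h2 s hs))
    filter_upwards [e1, e2] with θ' h3 h4
    exact ⟨r, hr, h3, h4⟩
  have hDo : IsOpen D := by
    rw [isOpen_iff_mem_nhds]
    rintro θ ⟨r, hr, h1, h2⟩
    have e1 : ∀ᶠ θ' in 𝓝 θ, P θ' r < 0 := (hPr r).continuousAt.eventually (Iio_mem_nhds h1)
    have e2 : ∀ᶠ θ' in 𝓝 θ, ∀ s ∈ Icc 0 r, h θ' s < π :=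
      isCompact_Icc.eventually_forall_of_forall_eventually fun s hs =>
        hhc.continuousAt.eventually (Iio_mem_nhds (h2 s hs))
    filter_upwards [e1, e2] with θ' h3 h4
    exact ⟨r, hr, h3, h4⟩
  have hdisj : ∀ θ, θ ∈ U → θ ∈ D → False := by
    rintro θ ⟨r, hr, h1, h2⟩ ⟨s, hs, h3, h4⟩
    rcases le_total s r with hsr | hsr
    · have := h2 s ⟨hs.le, hsr⟩
      linarith
    · have := h4 r ⟨hr.le, hsr⟩
      linarith
  have hconn : IsPreconnected S := ((convex_Ioc 0 2).prod (convex_Ioc 0 1)).isPreconnected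
  -- a small coefficient gives a slow start and a crossing
  have hUne : (S ∩ U).Nonempty := by
    obtain ⟨δ, R₀, hδ, -, hcross⟩ := exists_crossing_of_slow_start hg hn
    have e1 : ∀ᶠ θ in 𝓝 ((0 : ℝ), (1 : ℝ)), ∀ r ∈ Icc 0 R₀, h θ r < δ :=
      isCompact_Icc.eventually_forall_of_forall_eventually fun s hs =>
        hhc.continuousAt.eventually (Iio_mem_nhds (by
          simp only [h]
          rw [hzero 1 ⟨zero_le_one, le_rfl⟩, mul_zero]
          exact hδ))
    have e2 : Tendsto (fun a : ℝ => (a, (1 : ℝ))) (𝓝[>] 0) (𝓝 ((0 : ℝ), (1 : ℝ))) := by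
      have : Continuous fun a : ℝ => (a, (1 : ℝ)) := by fun_prop
      exact (this.tendsto 0).mono_left nhdsWithin_le_nhds
    obtain ⟨a, ha1, ha2⟩ := ((e2.eventually e1).and (Ioo_mem_nhdsGT two_pos)).exists
    have hθ : ((a, 1) : ℝ × ℝ) ∈ S := ⟨⟨ha2.1, ha2.2.le⟩, ⟨one_pos, le_rfl⟩⟩
    obtain ⟨r, hr, hr1, hr2⟩ := hcross _ _ (hprof _ hθ) fun r hr => ha1 r ⟨hr.1.le, hr.2⟩
    refine ⟨_, hθ, r, hr, hr2, fun s hs => ?_⟩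
    rcases hs.1.eq_or_lt with h1 | h1
    · rw [← h1]
      exact hP0 _ hθ
    · exact (hsign _ _ h1).1 (hr1 s ⟨h1, hs.2⟩)
  -- a small length scale gives a perturbation of the harmonic profile, which turns
  have hDne : (S ∩ D).Nonempty := by
    obtain ⟨f1, f2, f3, -⟩ := hfam 2 ⟨zero_le_two, le_rfl⟩ 0 ⟨le_rfl, zero_le_one⟩
    have hharm : ∀ r, 0 ≤ r → h (2, 0) r = arctanProfile n r := by
      intro r hr
      rcases hr.eq_or_lt with h1 | h1
      · rw [← h1, hh0]
        simp [arctanProfile, zero_pow (by lia : n ≠ 0)]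
      · exact eq_arctanProfile hn hg.lip_nonneg hg.lip hg.zero f1 f2 (hq1 _) f3 h1
    have e1 : ∀ᶠ θ in 𝓝 ((2 : ℝ), (0 : ℝ)), ∀ r ∈ Icc 0 r₁, h θ r < π :=
      isCompact_Icc.eventually_forall_of_forall_eventually fun s hs =>
        hhc.continuousAt.eventually (Iio_mem_nhds (by
          simp only
          rw [hharm s hs.1]
          rcases hs.1.eq_or_lt with h1 | h1
          · rw [← h1]
            simp [arctanProfile, zero_pow (by lia : n ≠ 0), pi_pos]
          · exact (arctanProfile_mem n h1).2))
    have e2 : ∀ᶠ θ in 𝓝 ((2 : ℝ), (0 : ℝ)), ξ < h θ r₁ :=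
      (hhr r₁).continuousAt.eventually (Ioi_mem_nhds (by
        show ξ < h (2, 0) r₁
        rw [hharm r₁ hr₁.le]
        exact hξ))
    have hGc := hg.continuous_prim
    have e3 : ∀ᶠ θ in 𝓝 ((2 : ℝ), (0 : ℝ)),
        r₁ ^ 2 * G (h θ r₁) - 2 * (∫ s in (0 : ℝ)..r₁, G (h θ s) * s) < 0 := by
      have hc1 : Continuous fun θ : ℝ × ℝ => ∫ s in (0 : ℝ)..r₁, G (h θ s) * s := by
        apply intervalIntegral.continuous_parametric_intervalIntegral_of_continuous'
        exact (hGc.comp hhc).mul continuous_snd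
      have hc2 : Continuous fun θ : ℝ × ℝ => G (h θ r₁) := hGc.comp (hhr r₁)
      have hc3 : Continuous fun θ : ℝ × ℝ =>
          r₁ ^ 2 * G (h θ r₁) - 2 * (∫ s in (0 : ℝ)..r₁, G (h θ s) * s) := by fun_prop
      refine hc3.continuousAt.eventually (Iio_mem_nhds ?_)
      have h1 : ∫ s in (0 : ℝ)..r₁, G (h (2, 0) s) * s = harmonicIntegral n G r₁ := by
        refine intervalIntegral.integral_congr fun s hs => ?_
        rw [uIcc_of_le hr₁.le] at hs
        simp only [hharm s hs.1]
      show r₁ ^ 2 * G (h (2, 0) r₁) - 2 * (∫ s in (0 : ℝ)..r₁, G (h (2, 0) s) * s) < 0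
      rw [h1, hharm r₁ hr₁.le]
      exact hneg
    have e4 : Tendsto (fun μ : ℝ => ((2 : ℝ), μ)) (𝓝[>] 0) (𝓝 ((2 : ℝ), (0 : ℝ))) := by
      have : Continuous fun μ : ℝ => ((2 : ℝ), μ) := by fun_prop
      exact (this.tendsto 0).mono_left nhdsWithin_le_nhds
    obtain ⟨μ, ⟨h1, h2, h3⟩, hμ⟩ := ((e4.eventually (e1.and (e2.and e3))).and
      (Ioo_mem_nhdsGT one_pos)).exists
    have hθ : ((2, μ) : ℝ × ℝ) ∈ S := ⟨⟨two_pos, le_rfl⟩, ⟨hμ.1, hμ.2.le⟩⟩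
    have hF : pohozaev n (h (2, μ)) (fun r => r ^ n * P (2, μ) r) r₁ < 0 := by
      rw [pohozaev_eq_integral (hprof _ hθ) hg (hh1 _) hr₁]
      exact mul_neg_of_pos_of_neg hμ.1 h3
    obtain ⟨r, hr, hr1, hr2⟩ := (hprof _ hθ).exists_turn hg hμ.1 hr₁ h2.le
      (fun r hr => h1 r ⟨hr.1.le, hr.2⟩) hF
    refine ⟨_, hθ, r, hr, ?_, fun s hs => ?_⟩
    · by_contra! hc
      exact absurd (mul_nonneg (pow_pos hr n).le hc) (not_le.2 hr1)
    · rcases hs.1.eq_or_lt with h4 | h4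
      · rw [← h4, hh0]
        exact pi_pos
      · exact hr2 s ⟨h4, hs.2⟩
  obtain ⟨θ, hθ, hθU, hθD⟩ : ∃ θ ∈ S, θ ∉ U ∧ θ ∉ D := by
    by_contra! hc
    obtain ⟨θ, -, h1, h2⟩ := hconn U D hUo hDo
      (fun θ hθ => or_iff_not_imp_left.2 (hc θ hθ)) hUne hDne
    exact hdisj θ h1 h2
  have hprofθ := hprof θ hθ
  have htrap := hprofθ.trapped hg hθ.2.1 (fun r hr hs => by
      by_contra! hc
      refine hθU ⟨r, hr, hc, fun s hs' => ?_⟩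
      rcases hs'.1.eq_or_lt with h1 | h1
      · rw [← h1]
        exact hP0 _ hθ
      · exact (hsign _ _ h1).1 (hs s ⟨h1, hs'.2⟩)) (fun r hr hs => by
      by_contra! hc
      refine hθD ⟨r, hr, ?_, fun s hs' => ?_⟩
      · by_contra! hc2
        exact absurd (mul_nonneg (pow_pos hr n).le hc2) (not_le.2 hc)
      · rcases hs'.1.eq_or_lt with h1 | h1
        · rw [← h1, hh0]
          exact pi_pos
        · exact hs s ⟨h1, hs'.2⟩)
  obtain ⟨f1, f2, f3, f4⟩ := hfam θ.1 (hmem _ hθ).1 θ.2 (hmem _ hθ).2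
  refine ⟨θ.2, v θ, q θ, hθ.2.1, hq1 _, f2, f3, ?_, hprofθ,
    fun r hr => ⟨(htrap r hr).1, (htrap r hr).2.1⟩,
    hprofθ.tendsto_pi hg hθ.2.1 (fun r hr => (htrap r hr).2.1) fun r hr => (htrap r hr).2.2⟩
  rw [f1]
  exact f4

/-! ### The integral condition -/

section Condition

variable {n : ℕ} {ξ L : ℝ} {g G : ℝ → ℝ}

lemma arctanProfile_mono (n : ℕ) {r s : ℝ} (hr : 0 ≤ r) (hrs : r ≤ s) :
    arctanProfile n r ≤ arctanProfile n s := by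
  unfold arctanProfile
  have : arctan (r ^ n) ≤ arctan (s ^ n) := Real.arctan_strictMono.monotone (by gcongr)
  linarith

lemma arctanProfile_lt (hn : 1 ≤ n) {r s : ℝ} (hr : 0 ≤ r) (hrs : r < s) :
    arctanProfile n r < arctanProfile n s := by
  unfold arctanProfile
  have : arctan (r ^ n) < arctan (s ^ n) :=
    Real.arctan_strictMono (pow_lt_pow_left₀ hrs hr (by lia))
  linarith

lemma tendsto_arctanProfile (hn : 1 ≤ n) : Tendsto (arctanProfile n) atTop (𝓝 π) := by
  have h1 : Tendsto (fun r : ℝ => arctan (r ^ n)) atTop (𝓝 (π / 2)) :=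
    (tendsto_arctan_atTop.mono_right nhdsWithin_le_nhds).comp (tendsto_pow_atTop (by lia))
  have := h1.const_mul 2
  rwa [mul_div_cancel₀ π two_ne_zero] at this

lemma harmonicIntegral_mono (hg : BistableForce g G ξ L) {r s : ℝ} (hr : 0 < r) (hrs : r ≤ s)
    (hξ : ξ ≤ arctanProfile n r) : harmonicIntegral n G r ≤ harmonicIntegral n G s :=
  le_of_hasDerivAt_nonneg hrs (fun _ _ => hasDerivAt_harmonicIntegral n hg.continuous_prim _)
    fun _ hx => mul_nonneg (hg.prim_nonneg
      ⟨hξ.trans (arctanProfile_mono n hr.le hx.1.le), (arctanProfile_mem n (hr.trans hx.1)).2.le⟩)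
      (hr.trans hx.1).le

/-- If the integral of `G` along the harmonic profile is positive at some radius, the work of `g`
is negative at some larger radius: otherwise the integral would grow quadratically, although
`G(φ(r)) → 0`. -/
lemma exists_harmonicWork_neg (hg : BistableForce g G ξ L) (hn : 1 ≤ n) {r₀ : ℝ} (hr₀ : 0 < r₀)
    (hI : 0 < harmonicIntegral n G r₀) :
    ∃ r₁, r₀ ≤ r₁ ∧ harmonicWork n G r₁ < 0 := by
  by_contra! hcon
  set c := harmonicIntegral n G r₀ / r₀ ^ 2 with hc
  have hc0 : 0 < c := by positivity
  have h1 : ∀ r, r₀ ≤ r → c ≤ harmonicIntegral n G r / r ^ 2 := by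
    intro r hr
    refine le_of_hasDerivAt_nonneg (f := fun r => harmonicIntegral n G r / r ^ 2) hr
      (fun x hx => (hasDerivAt_harmonicIntegral n hg.continuous_prim x).div (hasDerivAt_pow 2 x)
        (pow_pos (hr₀.trans_le hx.1) 2).ne') fun x hx => ?_
    have hx0 := hr₀.trans hx.1
    have h2 := hcon x hx.1.le
    rw [harmonicWork] at h2
    refine div_nonneg ?_ (by positivity)
    simp only [Nat.cast_ofNat, Nat.add_one_sub_one, pow_one]
    nlinarith
  have h2 : ∀ r, r₀ ≤ r → 2 * c ≤ G (arctanProfile n r) := by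
    intro r hr
    have hr0 := hr₀.trans_le hr
    have h3 := h1 r hr
    have h4 := hcon r hr
    rw [le_div_iff₀ (by positivity)] at h3
    rw [harmonicWork] at h4
    have h5 : 0 < r ^ 2 := by positivity
    nlinarith
  have h3 := (hg.continuous_prim.tendsto π).comp (tendsto_arctanProfile hn)
  rw [hg.prim_pi] at h3
  have := ge_of_tendsto h3 ((eventually_ge_atTop r₀).mono fun r hr => h2 r hr)
  linarith

end Condition

/-! ### The improper integral -/

lemma extIntegral_congr {F₁ F₂ : ℝ → ℝ} (h : ∀ r, 0 < r → F₁ r = F₂ r) :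
    extIntegral F₁ = extIntegral F₂ := by
  unfold extIntegral
  rw [setLIntegral_congr_fun measurableSet_Ioi fun r hr => by rw [h r hr],
    setLIntegral_congr_fun (f := fun r => ENNReal.ofReal (-F₁ r)) measurableSet_Ioi
      fun r hr => congrArg (fun y => ENNReal.ofReal (-y)) (h r hr)]

/-- For an integrand that is eventually nonnegative, the improper integral is positive exactly
when some partial integral, taken beyond the negative part, is. -/
lemma extIntegral_pos_iff {F : ℝ → ℝ} (hF : Continuous F) {ρ : ℝ} (hρ : 0 ≤ ρ)
    (hnn : ∀ r, ρ ≤ r → 0 ≤ F r) :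
    0 < extIntegral F ↔ ∃ r, ρ ≤ r ∧ 0 < ∫ s in (0 : ℝ)..r, F s := by
  set P : Set ℝ → ℝ≥0∞ := fun S => ∫⁻ r in S, ENNReal.ofReal (F r) with hP
  set N : Set ℝ → ℝ≥0∞ := fun S => ∫⁻ r in S, ENNReal.ofReal (-F r) with hN
  have hlt : 0 < extIntegral F ↔ N (Ioi 0) < P (Ioi 0) := by
    rw [extIntegral, EReal.sub_pos, EReal.coe_ennreal_lt_coe_ennreal_iff]
  have hNr : ∀ r, ρ ≤ r → N (Ioi 0) = N (Ioc 0 r) := by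
    intro r hr
    have h1 : N (Ioi r) = 0 := by
      simp only [hN]
      rw [setLIntegral_congr_fun (g := fun _ => 0) measurableSet_Ioi fun x hx =>
        ENNReal.ofReal_of_nonpos (neg_nonpos.2 (hnn x (hr.trans (le_of_lt hx))))]
      simp
    simp only [hN] at h1 ⊢
    rw [← Ioc_union_Ioi_eq_Ioi (hρ.trans hr), lintegral_union measurableSet_Ioi
      (Ioc_disjoint_Ioi le_rfl), h1, add_zero]
  have hfin : ∀ {f : ℝ → ℝ} (_ : Continuous f) (r : ℝ),
      ∫⁻ x in Ioc 0 r, ENNReal.ofReal (f x) ≠ ∞ := fun {f} hf r =>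
    ((hf.integrableOn_Icc.mono_set Ioc_subset_Icc_self).lintegral_lt_top).ne
  have hint : ∀ r, ρ ≤ r → (0 < ∫ s in (0 : ℝ)..r, F s ↔ N (Ioc 0 r) < P (Ioc 0 r)) := by
    intro r hr
    rw [intervalIntegral.integral_of_le (hρ.trans hr),
      integral_eq_lintegral_pos_part_sub_lintegral_neg_part
        (hF.integrableOn_Icc.mono_set Ioc_subset_Icc_self), sub_pos,
      ENNReal.toReal_lt_toReal (hfin (f := fun x => -F x) hF.neg r) (hfin hF r)]
  rw [hlt]
  constructor
  · intro h
    have hU : Ioi (0 : ℝ) = ⋃ k : ℕ, Ioc 0 (k : ℝ) := by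
      ext x
      simp only [mem_Ioi, mem_iUnion, mem_Ioc]
      exact ⟨fun hx => (exists_nat_ge x).imp fun k hk => ⟨hx, hk⟩, fun ⟨_, hx⟩ => hx.1⟩
    have hmono : Monotone fun k : ℕ => Ioc 0 (k : ℝ) := fun i j hij =>
      Ioc_subset_Ioc_right (by exact_mod_cast hij)
    have hsup : P (Ioi 0) = ⨆ k : ℕ, P (Ioc 0 (k : ℝ)) := by
      simp only [hP]
      rw [hU, setLIntegral_iUnion_of_directed _ hmono.directed_le]
    rw [hsup, lt_iSup_iff] at h
    obtain ⟨k, hk⟩ := h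
    refine ⟨max ρ k, le_max_left _ _, (hint _ (le_max_left _ _)).2 ?_⟩
    rw [← hNr _ (le_max_left _ _)]
    exact hk.trans_le (lintegral_mono_set (Ioc_subset_Ioc_right (le_max_right _ _)))
  · rintro ⟨r, hr, h⟩
    rw [hNr r hr]
    exact ((hint r hr).1 h).trans_le (lintegral_mono_set Ioc_subset_Ioi_self)

/-- The integral condition, in terms of partial integrals beyond the level `ξ`. -/
lemma extIntegral_harmonicProfile_pos_iff {m : ℤ} (hm : m ≠ 0) {ξ L : ℝ} {g g₁ G : ℝ → ℝ}
    (hg : BistableForce g₁ G ξ L) (hG : ∀ x ∈ Icc 0 π, primitivePi g x = G x) :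
    0 < extIntegral (fun r => primitivePi g (harmonicProfile m r) * r) ↔
      ∃ r, 0 < r ∧ ξ ≤ arctanProfile m.natAbs r ∧ 0 < harmonicIntegral m.natAbs G r := by
  have hn : 1 ≤ m.natAbs := Int.natAbs_pos.2 hm
  set n := m.natAbs with hn_def
  have hρ := harmonicRadius_pos n ξ
  have hξ := arctanProfile_harmonicRadius hn hg.mem
  rw [extIntegral_congr (F₂ := fun r => G (arctanProfile n r) * r) fun r hr => by
    rw [← hG _ ⟨(arctanProfile_mem n hr).1.le, (arctanProfile_mem n hr).2.le⟩]
    rfl,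
    extIntegral_pos_iff (F := fun r => G (arctanProfile n r) * r)
      ((hg.continuous_prim.comp (continuous_arctanProfile n)).mul continuous_id)
      hρ.le fun r hr => mul_nonneg
        (hg.prim_nonneg ⟨?_, (arctanProfile_mem n (hρ.trans_le hr)).2.le⟩)
        (hρ.le.trans hr)]
  · constructor
    · rintro ⟨r, hr, h⟩
      exact ⟨r, hρ.trans_le hr, hξ.ge.trans (arctanProfile_mono n hρ.le hr), h⟩
    · rintro ⟨r, hr, h1, h2⟩
      exact ⟨max (harmonicRadius n ξ) r, le_max_left _ _,
        h2.trans_le (harmonicIntegral_mono hg hr (le_max_right _ _) h1)⟩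
  · exact hξ.ge.trans (arctanProfile_mono n hρ.le hr)

/-! ### Extension of the nonlinearity -/

/-- The extension of `g : [0, π] → ℝ` to the real line, constant beyond `π`, and linear below `0`
with the slope that makes it differentiable at `0`. -/
def extendForce (g : ℝ → ℝ) (x : ℝ) : ℝ :=
  g (clamp 0 π x) + derivWithin g (Icc 0 π) 0 * min x 0

lemma extendForce_of_mem (g : ℝ → ℝ) {x : ℝ} (hx : x ∈ Icc 0 π) : extendForce g x = g x := by
  rw [extendForce, clamp_of_mem hx, min_eq_right hx.1, mul_zero, add_zero]

lemma IsAdmissible.exists_bistableForce {g : ℝ → ℝ} (hg : IsAdmissible g)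
    (hsm : ContDiffOn ℝ 1 g (Icc 0 π)) :
    ∃ ξ L, BistableForce (extendForce g) (primitivePi (extendForce g)) ξ L := by
  obtain ⟨ξ, hξ, h0, -, hπ, hpos, hneg⟩ := hg.sign
  obtain ⟨K, hK⟩ := hsm.exists_lipschitzOnWith one_ne_zero (convex_Icc 0 π) isCompact_Icc
  set c := derivWithin g (Icc 0 π) 0 with hc
  have h0m : (0 : ℝ) ∈ Icc 0 π := ⟨le_rfl, pi_pos.le⟩
  have hπm : π ∈ Icc 0 π := ⟨pi_pos.le, le_rfl⟩
  have hlip : ∀ x y, |extendForce g x - extendForce g y| ≤ (K + |c|) * |x - y| := by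
    intro x y
    have h1 := hK.dist_le_mul _ (clamp_mem pi_pos.le x) _ (clamp_mem pi_pos.le y)
    rw [Real.dist_eq, Real.dist_eq] at h1
    have h2 : |min x 0 - min y 0| ≤ |x - y| := by
      simpa using abs_min_sub_min_le_max x 0 y 0
    calc |extendForce g x - extendForce g y|
        = |(g (clamp 0 π x) - g (clamp 0 π y)) + c * (min x 0 - min y 0)| := by
          rw [extendForce, extendForce]
          congr 1
          ring
      _ ≤ K * |x - y| + |c| * |x - y| := by
          refine (abs_add_le _ _).trans (add_le_add ?_ ?_)
          · exact h1.trans (mul_le_mul_of_nonneg_left (abs_clamp_sub_le _ _ _ _) K.2)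
          · rw [abs_mul]
            exact mul_le_mul_of_nonneg_left h2 (abs_nonneg c)
      _ = (K + |c|) * |x - y| := by ring
  have hL : 0 ≤ (K : ℝ) + |c| := by positivity
  have hcont : Continuous (extendForce g) :=
    (LipschitzWith.of_dist_le_mul (K := ⟨_, hL⟩) fun x y => hlip x y).continuous
  refine ⟨ξ, K + |c|, hξ, ?_, ?_, fun x hx => ?_, fun x hx => ?_, hL, hlip, fun x hx => ?_,
    fun x => ?_, ?_, ?_⟩
  · rw [extendForce_of_mem g h0m, h0]
  · rw [extendForce_of_mem g hπm, hπ]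
  · rw [extendForce_of_mem g ⟨hx.1.le, hx.2.le.trans hξ.2.le⟩]
    exact hpos x hx
  · rw [extendForce_of_mem g ⟨hξ.1.le.trans hx.1.le, hx.2.le⟩]
    exact hneg x hx
  · rcases hx.1.eq_or_lt with h | h
    · subst h
      have h1 : HasDerivWithinAt (extendForce g) c (Ici 0) 0 := by
        have h2 : HasDerivWithinAt g c (Icc 0 π) 0 :=
          (hsm.differentiableOn one_ne_zero 0 h0m).hasDerivWithinAt
        exact (h2.congr (fun y hy => extendForce_of_mem g hy)
          (extendForce_of_mem g h0m)).mono_of_mem_nhdsWithin (Icc_mem_nhdsGE pi_pos)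
      have h3 : HasDerivWithinAt (extendForce g) c (Iic 0) 0 := by
        have h4 : HasDerivWithinAt (fun x => g 0 + c * x) c (Iic 0) 0 := by
          simpa using (((hasDerivAt_id (0 : ℝ)).const_mul c).const_add (g 0)).hasDerivWithinAt
        have h5 : ∀ y ∈ Iic (0 : ℝ), extendForce g y = g 0 + c * y := fun y hy => by
          have hy' : y ≤ 0 := hy
          rw [extendForce, clamp, min_eq_right (hy'.trans pi_pos.le), max_eq_left hy',
            min_eq_left hy']
        exact h4.congr h5 (h5 0 (mem_Iic.2 le_rfl))
      have h6 := h3.union h1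
      rw [Iic_union_Ici, hasDerivWithinAt_univ] at h6
      exact h6.differentiableAt
    · have h1 := (hsm.differentiableOn one_ne_zero x ⟨h.le, hx.2.le⟩).differentiableAt
        (Icc_mem_nhds h hx.2)
      refine h1.congr_of_eventuallyEq ?_
      filter_upwards [Icc_mem_nhds h hx.2] with y hy
      exact extendForce_of_mem g hy
  · have := (intervalIntegral.integral_hasDerivAt_left (hcont.intervalIntegrable x π)
      (hcont.stronglyMeasurableAtFilter _ _) hcont.continuousAt).neg
    rw [neg_neg] at this
    exact this
  · simp [primitivePi]
  · rw [primitivePi, neg_lt_zero, intervalIntegral.integral_congr (g := g) fun x hx =>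
      extendForce_of_mem g (by rwa [uIcc_of_le pi_pos.le] at hx)]
    exact hg.integral_pos

lemma primitivePi_extendForce (g : ℝ → ℝ) {x : ℝ} (hx : x ∈ Icc 0 π) :
    primitivePi g x = primitivePi (extendForce g) x := by
  rw [primitivePi, primitivePi]
  congr 1
  refine intervalIntegral.integral_congr fun y hy => ?_
  rw [uIcc_of_le hx.2] at hy
  exact (extendForce_of_mem g ⟨hx.1.trans hy.1, hy.2⟩).symm

/-! ### Rotating maps and profiles -/

lemma cross_sub (a b c : Space) : cross a (b - c) = cross a b - cross a c := by
  unfold cross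
  rw [WithLp.ofLp_sub, map_sub, WithLp.toLp_sub]

lemma continuous_cross : Continuous fun p : Space × Space => cross p.1 p.2 := by
  unfold cross
  refine (PiLp.continuous_toLp 2 _).comp (continuous_pi fun i => ?_)
  fin_cases i <;> simp [cross_apply] <;> fun_prop

lemma continuous_laplacian {f : Plane → Space} (hf : ContDiff ℝ 2 f) : Continuous (Δ f) := by
  have h1 : Continuous (fderiv ℝ (fderiv ℝ f)) :=
    (hf.fderiv_right (m := 1) (by norm_num)).continuous_fderiv one_ne_zero
  have h2 : Δ f = fun x => fderiv ℝ (fderiv ℝ f) x (unitVec 0) (unitVec 0)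
      + fderiv ℝ (fderiv ℝ f) x (unitVec (0 + π / 2)) (unitVec (0 + π / 2)) :=
    funext fun x => laplacian_eq_unitVec f x 0
  rw [h2]
  fun_prop

/-- Both sides of the flow equation, for a rotating map, away from the origin. -/
lemma rotating_equation {m : ℤ} {ω t : ℝ} {u : ℝ → Plane → Space} (hu : ContDiff ℝ 2 (u t))
    {h h₁ Γ : ℝ → ℝ} {h₂ γ r θ : ℝ} (hr : 0 < r)
    (hform : ∀ t r θ, 0 < r → u t (r • unitVec θ) = spherePoint (h r) (m * θ + ω * t))
    (hh : ∀ s, 0 < s → HasDerivAt h (h₁ s) s) (hh₁ : HasDerivAt h₁ h₂ r) (hmem : h r ∈ Ioo 0 π)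
    (hΓ : HasDerivAt Γ γ (h r)) :
    deriv (fun s => u s (r • unitVec θ)) t
        = (ω * sin (h r)) • !₂[-sin (m * θ + ω * t), cos (m * θ + ω * t), 0] ∧
      cross (u t (r • unitVec θ)) (Δ (u t) (r • unitVec θ)
          - sphereGradient (fun y => Γ (polarDist y)) (u t (r • unitVec θ)))
        = (h₂ + h₁ r / r - m ^ 2 * (sin (h r) * cos (h r)) / r ^ 2 - γ) •
          !₂[-sin (m * θ + ω * t), cos (m * θ + ω * t), 0] := by
  constructor
  · have h1 : HasDerivAt (fun s : ℝ => m * θ + ω * s) ω t := by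
      simpa using ((hasDerivAt_id t).const_mul ω).const_add (m * θ)
    have h2 := hasDerivAt_spherePoint (hasDerivAt_const t (h r)) h1
    have h3 : (fun s => u s (r • unitVec θ)) = fun s => spherePoint (h r) (m * θ + ω * s) :=
      funext fun s => hform s r θ hr
    rw [h3, h2.deriv]
    ext i
    fin_cases i <;> simp
  · rw [cross_sub, cross_laplacian hu hr (fun r θ hr => hform t r θ hr) hh hh₁, hform t r θ hr,
      sphereGradient_spherePoint hmem hΓ, sub_smul _ γ]
    congr 1
    have t1 := sin_sq_add_cos_sq (h r)
    ext i
    fin_cases i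
    · simp [cross, spherePoint, cross_apply]
      linear_combination (-γ * sin (m * θ + ω * t)) * t1
    · simp [cross, spherePoint, cross_apply]
      linear_combination (γ * cos (m * θ + ω * t)) * t1
    · simp [cross, spherePoint, cross_apply]
      ring

/-- When the tension of the profile tends to `0` at the origin, so does `u × Δu`. -/
lemma cross_laplacian_zero {m : ℤ} {c : ℝ} {f : Plane → Space} (hf : ContDiff ℝ 2 f)
    {h h₁ h₂ : ℝ → ℝ}
    (hform : ∀ r θ, 0 < r → f (r • unitVec θ) = spherePoint (h r) (m * θ + c))
    (hh : ∀ s, 0 < s → HasDerivAt h (h₁ s) s) (hh₁ : ∀ s, 0 < s → HasDerivAt h₁ (h₂ s) s)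
    (hlim : Tendsto (fun r => h₂ r + h₁ r / r - m ^ 2 * (sin (h r) * cos (h r)) / r ^ 2)
      (𝓝[>] 0) (𝓝 0)) :
    cross (f 0) (Δ f 0) = 0 := by
  have hc : Continuous fun r : ℝ => cross (f (r • unitVec 0)) (Δ f (r • unitVec 0)) := by
    have e1 := continuous_laplacian hf
    have e2 := hf.continuous
    have e3 : Continuous fun r : ℝ => r • unitVec 0 := by fun_prop
    exact continuous_cross.comp ((e2.comp e3).prodMk (e1.comp e3))
  have hlim1 := (hc.tendsto 0).mono_left (nhdsWithin_le_nhds (s := Ioi 0))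
  rw [zero_smul] at hlim1
  have hlim2 := hlim.smul_const (!₂[-sin (m * 0 + c), cos (m * 0 + c), 0] : Space)
  rw [zero_smul] at hlim2
  refine tendsto_nhds_unique hlim1 (hlim2.congr' ?_)
  filter_upwards [self_mem_nhdsWithin] with r hr
  exact (cross_laplacian hf hr hform hh (hh₁ r hr)).symm

lemma IsRotating.form' {m : ℤ} {ω : ℝ} {h : ℝ → ℝ} {u : ℝ → Plane → Space}
    (hu : IsRotating m ω h u) (t : ℝ) {r : ℝ} (hr : 0 ≤ r) (θ : ℝ) :
    u t (r • unitVec θ) = spherePoint (h r) (m * θ + ω * t) := by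
  rw [smul_unitVec, hu.form t r θ hr, spherePoint]

lemma natCast_natAbs_sq (m : ℤ) : ((m.natAbs : ℕ) : ℝ) ^ 2 = (m : ℝ) ^ 2 := by
  rw [Nat.cast_natAbs, Int.cast_abs, sq_abs]

/-- The profile of a rotating solution solves the profile equation. -/
theorem IsRotating.isProfile {m : ℤ} {ω ξ L : ℝ} {g G Γ h : ℝ → ℝ}
    {u : ℝ → Plane → Space} (hu : IsSchrodingerFlow (fun y => Γ (polarDist y)) u)
    (hrot : IsRotating m ω h u) (hm : ∀ r, 0 < r → 0 < h r ∧ h r < π)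
    (hg : BistableForce g G ξ L)
    (hΓ : ∀ x ∈ Ioo 0 π, HasDerivAt Γ (g x - ω * sin x) x) :
    IsProfile m.natAbs 1 g h (fun r => r * deriv h r) := by
  have hu0 : ContDiff ℝ 2 (u 0) :=
    hu.contDiff.comp
      (contDiff_const.prodMk contDiff_id : ContDiff ℝ 2 fun x : Plane => ((0 : ℝ), x))
  have hray : ContDiff ℝ 2 fun r : ℝ => u 0 (r • unitVec 0) :=
    hu0.comp (contDiff_id.smul contDiff_const)
  -- along a ray, the map is `(sin h, 0, cos h)`
  set a : ℝ → ℝ := fun r => u 0 (r • unitVec 0) 0 with ha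
  set e : ℝ → ℝ := fun r => u 0 (r • unitVec 0) 2 with he
  have ha2 : ContDiff ℝ 2 a := contDiff_euclidean.1 hray 0
  have he2 : ContDiff ℝ 2 e := contDiff_euclidean.1 hray 2
  have ha_eq : ∀ r, 0 ≤ r → a r = sin (h r) := fun r hr => by
    simp only [ha]
    rw [hrot.form' 0 hr 0]
    simp [spherePoint]
  have he_eq : ∀ r, 0 ≤ r → e r = cos (h r) := fun r hr => by
    simp only [he]
    rw [hrot.form' 0 hr 0]
    simp [spherePoint]
  have hh_eq : ∀ r, 0 ≤ r → h r = arccos (e r) := by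
    intro r hr
    rw [he_eq r hr]
    rcases hr.eq_or_lt with h0 | h0
    · rw [← h0, hrot.profile_zero, arccos_cos le_rfl pi_pos.le]
    · rw [arccos_cos (hm r h0).1.le (hm r h0).2.le]
  have hsin : ∀ r, 0 < r → 0 < sin (h r) := fun r hr =>
    sin_pos_of_pos_of_lt_pi (hm r hr).1 (hm r hr).2
  have hh2 : ∀ r, 0 < r → ContDiffAt ℝ 2 h r := by
    intro r hr
    have h1 := sin_sq_add_cos_sq (h r)
    have h2 := hsin r hr
    have h3 : e r ≠ -1 := by
      rw [he_eq r hr.le]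
      nlinarith
    have h4 : e r ≠ 1 := by
      rw [he_eq r hr.le]
      nlinarith
    refine ((Real.contDiffAt_arccos h3 h4).comp r he2.contDiffAt).congr_of_eventuallyEq ?_
    filter_upwards [Ioi_mem_nhds hr] with s hs
    exact hh_eq s (le_of_lt hs)
  have hd : ∀ r, 0 < r → HasDerivAt h (deriv h r) r := fun r hr =>
    ((hh2 r hr).differentiableAt two_ne_zero).hasDerivAt
  have hdd : ∀ r, 0 < r → HasDerivAt (deriv h) (deriv (deriv h) r) r := fun r hr =>
    ((((hh2 r hr).fderiv_right (m := 1) (by norm_num)).clm_apply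
      (contDiffAt_const (c := (1 : ℝ)))).differentiableAt one_ne_zero).hasDerivAt
  have hode : ∀ r, 0 < r → deriv (deriv h) r + deriv h r / r
      - m ^ 2 * (sin (h r) * cos (h r)) / r ^ 2 = g (h r) := by
    intro r hr
    obtain ⟨h1, h2⟩ := rotating_equation (θ := 0) hu0 hr (fun t r θ hr => hrot.form' t hr.le θ) hd
      (hdd r hr) (hm r hr) (hΓ _ (hm r hr))
    have h3 := hu.equation 0 (r • unitVec 0)
    rw [h1, h2] at h3
    have h4 := congrArg (fun w : Space => w 1) h3
    simp at h4
    linarith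
  have hp : ∀ r, 0 < r → HasDerivAt (fun r => r * deriv h r)
      ((m.natAbs ^ 2 * (sin (h r) * cos (h r)) + 1 * r ^ 2 * g (h r)) / r) r := by
    intro r hr
    refine ((hasDerivAt_id r).mul (hdd r hr)).congr_deriv ?_
    have h1 := hode r hr
    rw [natCast_natAbs_sq, ← h1]
    simp only [id]
    field_simp
    ring
  have hlim : Tendsto h (𝓝[>] 0) (𝓝 0) := by
    have h1 : Continuous fun r => arccos (e r) := Real.continuous_arccos.comp he2.continuous
    have h2 := h1.tendsto 0
    simp only [← hh_eq 0 le_rfl, hrot.profile_zero] at h2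
    refine (h2.mono_left nhdsWithin_le_nhds).congr' ?_
    filter_upwards [self_mem_nhdsWithin] with r hr
    exact (hh_eq r (le_of_lt hr)).symm
  have hlimp : Tendsto (fun r => r * deriv h r) (𝓝[>] 0) (𝓝 0) := by
    have h1 : Continuous fun r => r * (e r * deriv a r - a r * deriv e r) := by
      have := ha2.continuous_deriv one_le_two
      have := he2.continuous_deriv one_le_two
      have := ha2.continuous
      have := he2.continuous
      fun_prop
    have h2 := h1.tendsto 0
    simp only [zero_mul] at h2
    refine (h2.mono_left nhdsWithin_le_nhds).congr' ?_
    filter_upwards [self_mem_nhdsWithin] with r hr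
    have hr' : 0 < r := hr
    have h3 : deriv a r = cos (h r) * deriv h r := by
      refine ((hd r hr').sin.congr_of_eventuallyEq ?_).deriv
      filter_upwards [Ioi_mem_nhds hr'] with s hs
      exact ha_eq s (le_of_lt hs)
    have h4 : deriv e r = -sin (h r) * deriv h r := by
      refine ((hd r hr').cos.congr_of_eventuallyEq ?_).deriv
      filter_upwards [Ioi_mem_nhds hr'] with s hs
      exact he_eq s (le_of_lt hs)
    rw [h3, h4, ha_eq r hr'.le, he_eq r hr'.le]
    linear_combination r * deriv h r * sin_sq_add_cos_sq (h r)
  refine ⟨fun r hr => (hd r hr).congr_deriv (by field_simp), hp, hlim, hlimp, ?_⟩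
  have hξ := hg.mem.1
  obtain ⟨ε, hε, hball⟩ := mem_nhdsGT_iff_exists_Ioo_subset.1
    (hlim.eventually (Iio_mem_nhds (lt_min hξ pi_div_two_pos)))
  filter_upwards [Ioo_mem_nhdsGT (show (0 : ℝ) < ε from hε)] with r hr
  refine ⟨(hm r hr.1).1, pos_of_tendsto_zero (f := fun r => r * deriv h r) hr.1 hlimp
    (fun s hs => hp s hs.1) fun s hs => ?_⟩
  have h1 : h s < min ξ (π / 2) := hball ⟨hs.1, hs.2.trans hr.2⟩
  have h2 := (hm s hs.1).1
  have h3 := hg.pos (h s) ⟨h2, h1.trans_le (min_le_left _ _)⟩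
  have h4 := hsin s hs.1
  have h5 : 0 < cos (h s) :=
    cos_pos_of_mem_Ioo ⟨by linarith [pi_pos], h1.trans_le (min_le_right _ _)⟩
  have h6 := hs.1
  positivity

/-- The dilation `r ↦ s r` multiplies the parameter `μ` by `s²`. -/
lemma IsProfile.dilate {n : ℕ} {μ s : ℝ} {g h p : ℝ → ℝ} (hP : IsProfile n μ g h p) (hs : 0 < s)
    {r : ℝ} (hr : 0 < r) :
    HasDerivAt (fun r => h (s * r)) (p (s * r) / r) r ∧
      HasDerivAt (fun r => p (s * r) / r) (n ^ 2 * (sin (h (s * r)) * cos (h (s * r))) / r ^ 2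
        + μ * s ^ 2 * g (h (s * r)) - p (s * r) / r / r) r := by
  have hsd : HasDerivAt (fun r => s * r) s r := by simpa using (hasDerivAt_id r).const_mul s
  constructor
  · refine ((hP.deriv_h (s * r) (by positivity)).comp r hsd).congr_deriv ?_
    field_simp
  · have h1 := (((hP.deriv_p (s * r) (by positivity)).comp r hsd).div (hasDerivAt_id r) hr.ne')
    refine h1.congr_deriv ?_
    simp only [id, Function.comp]
    field_simp

/-- A dilated coefficient of a regular profile is a `C²` radial function on the plane. -/
lemma contDiff_dilated_coefficient {n : ℕ} {μ s : ℝ} {g v q : ℝ → ℝ} (hs : 0 < s)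
    (hgc : Continuous g) (hgd : DifferentiableAt ℝ g 0) (hqc : Continuous q)
    (hv : ∀ r, HasDerivAt v (r * q r) r)
    (hq : ∀ r, r ≠ 0 → HasDerivAt q ((radialForce n μ g r (v r) - (2 * n + 2) * q r) / r) r)
    (hq0 : (2 * n + 2) * q 0 = radialForce n μ g 0 (v 0)) :
    ContDiff ℝ 2 fun x : Plane => s ^ n * v (s * ‖x‖) := by
  have hvc : Continuous v := continuous_iff_continuousAt.2 fun r => (hv r).continuousAt
  have hsd : ∀ r : ℝ, HasDerivAt (fun r => s * r) s r := fun r => by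
    simpa using (hasDerivAt_id r).const_mul s
  have hF : Continuous fun r =>
      radialForce n μ g (s * r) (v (s * r)) - (2 * n + 2) * q (s * r) := by
    have h2 : Continuous fun r : ℝ => ((μ, s * r, v (s * r)) : ℝ × ℝ × ℝ) := by fun_prop
    have h3 := (continuous_radialForce n hgc hgd).comp h2
    have h4 : Continuous fun r => (2 * n + 2) * q (s * r) := by fun_prop
    exact h3.sub h4
  refine contDiff_two_comp_norm (v := fun r => s ^ n * v (s * r))
    (q := fun r => s ^ (n + 2) * q (s * r))
    (q' := fun r => s ^ (n + 2) *
      ((radialForce n μ g (s * r) (v (s * r)) - (2 * n + 2) * q (s * r)) / (s * r) * s))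
    (fun r => ?_) (by fun_prop) (fun r hr => ?_) ?_ ?_
  · refine (((hv (s * r)).comp r (hsd r)).const_mul (s ^ n)).congr_deriv ?_
    ring
  · exact ((hq (s * r) (by positivity)).comp r (hsd r)).const_mul _
  · refine continuousOn_const.mul ((hF.continuousOn.div (by fun_prop) fun r hr => ?_).mul
      continuousOn_const)
    have : 0 < r := hr
    positivity
  · have h1 := (hF.const_mul (s ^ (n + 2))).tendsto 0
    simp only [mul_zero, ← hq0, sub_self] at h1
    refine (h1.mono_left nhdsWithin_le_nhds).congr' ?_
    filter_upwards [self_mem_nhdsWithin] with r hr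
    have : 0 < r := hr
    field_simp

lemma exists_eq_norm_smul_unitVec (x : Plane) : ∃ θ, x = ‖x‖ • unitVec θ := by
  obtain ⟨θ, hθ⟩ := exists_polar x
  exact ⟨θ, by rwa [smul_unitVec]⟩

/-- A smooth rotating map whose profile solves the profile equation solves the flow equation. -/
lemma isSchrodingerFlow_of_profile {m : ℤ} {ω : ℝ} {g Γ h h₁ : ℝ → ℝ} {u : ℝ → Plane → Space}
    (hg : Continuous g) (hg0 : g 0 = 0) (hΓ : ∀ x ∈ Ioo 0 π, HasDerivAt Γ (g x - ω * sin x) x)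
    (hu : ContDiff ℝ 2 fun p : ℝ × Plane => u p.1 p.2)
    (hform : ∀ t r θ, 0 ≤ r → u t (r • unitVec θ) = spherePoint (h r) (m * θ + ω * t))
    (hc : Continuous h) (h0 : h 0 = 0) (hmem : ∀ r, 0 < r → h r ∈ Ioo 0 π)
    (hh : ∀ r, 0 < r → HasDerivAt h (h₁ r) r)
    (hh₁ : ∀ r, 0 < r → HasDerivAt h₁
      (m ^ 2 * (sin (h r) * cos (h r)) / r ^ 2 + g (h r) - h₁ r / r) r) :
    IsSchrodingerFlow (fun y => Γ (polarDist y)) u := by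
  have hut : ∀ t, ContDiff ℝ 2 (u t) := fun t =>
    hu.comp (contDiff_const.prodMk contDiff_id : ContDiff ℝ 2 fun x : Plane => (t, x))
  refine ⟨fun t x => ?_, hu, fun t x => ?_⟩
  · obtain ⟨θ, hθ⟩ := exists_eq_norm_smul_unitVec x
    rw [hθ, hform t _ θ (norm_nonneg x)]
    exact norm_spherePoint _ _
  obtain ⟨θ, hθ⟩ := exists_eq_norm_smul_unitVec x
  rcases (norm_nonneg x).eq_or_lt with hx | hx
  · -- at the origin both sides vanish, the right-hand side by continuity
    rw [← hx, zero_smul] at hθ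
    subst hθ
    have hN : ∀ t, u t 0 = northPole := fun t => by
      have := hform t 0 0 le_rfl
      rw [zero_smul, h0] at this
      rw [this]
      simp [spherePoint, northPole]
    have h1 : cross (u t 0) (Δ (u t) 0) = 0 := by
      refine cross_laplacian_zero (hut t) (fun r θ hr => hform t r θ hr.le) hh hh₁ ?_
      have e1 := (hg.comp hc).tendsto 0
      simp only [Function.comp, h0, hg0] at e1
      refine (e1.mono_left nhdsWithin_le_nhds).congr fun r => ?_
      rw [Function.comp_apply]
      ring
    have h2 : (fun s => u s 0) = fun _ => northPole := funext hN
    rw [cross_sub, h1, h2, hN, cross_sphereGradient_northPole, deriv_const, sub_zero]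
  · rw [hθ]
    obtain ⟨h1, h2⟩ := rotating_equation (t := t) (θ := θ) (hut t) hx
      (fun t r θ hr => hform t r θ hr.le) hh (hh₁ _ hx) (hmem _ hx) (hΓ _ (hmem _ hx))
    rw [h1, h2]
    congr 1
    ring

/-- A regular profile produces a rotating solution. The parameter `μ` is removed by the dilation
`r ↦ r / √μ`. -/
theorem exists_rotating_flow {m : ℤ} (hm : m ≠ 0) (ω : ℝ) {μ ξ L : ℝ} {g G Γ v q : ℝ → ℝ}
    (hg : BistableForce g G ξ L) (hΓ : ∀ x ∈ Ioo 0 π, HasDerivAt Γ (g x - ω * sin x) x)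
    (hμ : 0 < μ) (hqc : Continuous q) (hv : ∀ r, HasDerivAt v (r * q r) r)
    (hq : ∀ r, r ≠ 0 → HasDerivAt q
      ((radialForce m.natAbs μ g r (v r) - (2 * m.natAbs + 2) * q r) / r) r)
    (hq0 : (2 * m.natAbs + 2) * q 0 = radialForce m.natAbs μ g 0 (v 0))
    (hP : IsProfile m.natAbs μ g (fun r => r ^ m.natAbs * v r)
      (fun r => r ^ m.natAbs * (m.natAbs * v r + r ^ 2 * q r)))
    (hmem : ∀ r, 0 < r → 0 < r ^ m.natAbs * v r ∧ r ^ m.natAbs * v r < π) :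
    ∃ u, IsSchrodingerFlow (fun y => Γ (polarDist y)) u ∧
      IsRotating m ω (fun r => ((√μ)⁻¹ * r) ^ m.natAbs * v ((√μ)⁻¹ * r)) u := by
  have hs : 0 < (√μ)⁻¹ := inv_pos.2 (Real.sqrt_pos.2 hμ)
  have hμs : μ * (√μ)⁻¹ ^ 2 = 1 := by
    rw [inv_pow, Real.sq_sqrt hμ.le, mul_inv_cancel₀ hμ.ne']
  generalize (√μ)⁻¹ = s at hs hμs ⊢
  have hvc : Continuous v := continuous_iff_continuousAt.2 fun r => (hv r).continuousAt
  have hC := contDiff_rotatingMap m ω (v := fun r => s ^ m.natAbs * v (s * r))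
    (contDiff_dilated_coefficient hs hg.continuous (hg.diff 0 ⟨le_rfl, pi_pos⟩) hqc hv hq hq0)
  have h0 : (s * 0) ^ m.natAbs * v (s * 0) = 0 := by simp [hm]
  have hform : ∀ t r θ, 0 ≤ r →
      rotatingMap m ω (fun r => s ^ m.natAbs * v (s * r)) t (r • unitVec θ)
        = spherePoint ((s * r) ^ m.natAbs * v (s * r)) (m * θ + ω * t) := by
    intro t r θ hr
    rw [smul_unitVec, rotatingMap_polar hm ω _ t hr θ]
    congr 1
    ring
  refine ⟨_, isSchrodingerFlow_of_profile hg.continuous hg.zero hΓ hC hform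
    (((continuous_const.mul continuous_id).pow _).mul
      (hvc.comp (continuous_const.mul continuous_id))) h0
    (fun r hr => hmem (s * r) (mul_pos hs hr)) (fun r hr => (hP.dilate hs hr).1) fun r hr => ?_,
    h0, fun t r θ hr => ?_⟩
  · refine (hP.dilate hs hr).2.congr_deriv ?_
    rw [natCast_natAbs_sq, hμs, one_mul]
  · rw [← smul_unitVec, hform t r θ hr, spherePoint]

end

theorem theorem6p2 (m : ℤ) (hm : m ≠ 0) (ω : ℝ) (g : ℝ → ℝ)
    (hg_smooth : ContDiffOn ℝ ((max 1 (m.natAbs - 2) : ℕ) : WithTop ℕ∞) g (Icc 0 π))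
    (hg : IsAdmissible g) (Gtilde : ℝ → ℝ)
    (hG : ∀ x ∈ Icc 0 π, HasDerivWithinAt Gtilde (g x - ω * sin x) (Icc 0 π) x) :
    ((∃ (u : ℝ → Plane → Space) (h : ℝ → ℝ),
        IsSchrodingerFlow (fun y => Gtilde (polarDist y)) u ∧ IsRotating m ω h u ∧
        (∀ r, 0 < r → 0 < h r ∧ h r < π)) ↔
      0 < extIntegral (fun r => primitivePi g (harmonicProfile m r) * r)) ∧
    ((∃ (u : ℝ → Plane → Space) (h : ℝ → ℝ),
        IsSchrodingerFlow (fun y => Gtilde (polarDist y)) u ∧ IsRotating m ω h u ∧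
        (∀ r, 0 < r → 0 < h r ∧ h r < π) ∧ Tendsto h atTop (𝓝 π)) ↔
      0 < extIntegral (fun r => primitivePi g (harmonicProfile m r) * r)) := by
  have hn : 1 ≤ m.natAbs := Int.natAbs_pos.2 hm
  have hsm : ContDiffOn ℝ 1 g (Icc 0 π) := hg_smooth.of_le (by
    exact_mod_cast le_max_left 1 (m.natAbs - 2))
  obtain ⟨ξ, L, hF⟩ := hg.exists_bistableForce hsm
  have hΓ : ∀ x ∈ Ioo 0 π, HasDerivAt Gtilde (extendForce g x - ω * sin x) x := fun x hx => by
    rw [extendForce_of_mem g ⟨hx.1.le, hx.2.le⟩]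
    exact (hG x ⟨hx.1.le, hx.2.le⟩).hasDerivAt (Icc_mem_nhds hx.1 hx.2)
  rw [extIntegral_harmonicProfile_pos_iff hm hF fun x hx => primitivePi_extendForce g hx]
  have necessary : (∃ (u : ℝ → Plane → Space) (h : ℝ → ℝ),
      IsSchrodingerFlow (fun y => Gtilde (polarDist y)) u ∧ IsRotating m ω h u ∧
      (∀ r, 0 < r → 0 < h r ∧ h r < π)) →
      ∃ r, 0 < r ∧ ξ ≤ arctanProfile m.natAbs r ∧
        0 < harmonicIntegral m.natAbs (primitivePi (extendForce g)) r := by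
    rintro ⟨u, h, hu, hrot, hmem⟩
    exact (IsRotating.isProfile hu hrot hmem hF hΓ).exists_harmonicIntegral_pos hF one_pos hn
      fun r hr => (hmem r hr).2
  have sufficient : (∃ r, 0 < r ∧ ξ ≤ arctanProfile m.natAbs r ∧
        0 < harmonicIntegral m.natAbs (primitivePi (extendForce g)) r) →
      ∃ (u : ℝ → Plane → Space) (h : ℝ → ℝ),
        IsSchrodingerFlow (fun y => Gtilde (polarDist y)) u ∧ IsRotating m ω h u ∧
        (∀ r, 0 < r → 0 < h r ∧ h r < π) ∧ Tendsto h atTop (𝓝 π) := by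
    rintro ⟨r, hr, hξ, hpos⟩
    -- a slightly larger radius makes the inequality `ξ ≤ φ(r)` strict
    have hr1 : 0 < r + 1 := by linarith
    obtain ⟨r₁, hr₁, hneg⟩ := exists_harmonicWork_neg hF hn hr1
      (hpos.trans_le (harmonicIntegral_mono hF hr (by linarith) hξ))
    have hξ₁ : ξ < arctanProfile m.natAbs r₁ :=
      hξ.trans_lt (arctanProfile_lt hn hr.le (by linarith))
    obtain ⟨μ, v, q, hμ, hqc, hv, hq, hq0, hP, hmem, hlim⟩ :=
      exists_connecting_profile hn hF (hr1.trans_le hr₁) hξ₁ hneg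
    obtain ⟨u, hu, hrot⟩ := exists_rotating_flow hm ω hF hΓ hμ hqc hv hq hq0 hP hmem
    have hs : 0 < (√μ)⁻¹ := inv_pos.2 (Real.sqrt_pos.2 hμ)
    exact ⟨u, _, hu, hrot, fun r hr => hmem _ (mul_pos hs hr),
      hlim.comp (tendsto_id.const_mul_atTop hs)⟩
  exact ⟨⟨necessary, fun hc => by
      obtain ⟨u, h, hu, hrot, hmem, -⟩ := sufficient hc
      exact ⟨u, h, hu, hrot, hmem⟩⟩,
    ⟨fun ⟨u, h, hu, hrot, hmem, _⟩ => necessary ⟨u, h, hu, hrot, hmem⟩, sufficient⟩⟩
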